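/- **Setting.** Let $\lambda$ be the security parameter. Algorithms, adversaries, simulators and distinguishers are non-uniform PPT. Let $\mathcal G$ be an efficient group-generation scheme: on input $1^\lambda$ it outputs (a description of) a group $\mathbb G$ of prime order $p$, where $p$ has $\lambda$ bits, and a generator $g$. Let $\sigma=\sigma(\lambda)$ be polynomially bounded, and let $\mathtt G:\{0,1\}^*\to\{0,1\}^{\sigma+\lambda}$ be a random oracle, to which everyone, including simulators and distinguishers, has access. Let $\pi$ be a random permutation of the two positions of a pair; it is *secure* if the original index of each element of the permuted pair takes each of the two possible values with probability $1/2$. The delegated-unknown-query OT functionality with parties $S,P_1,P_2,R,T$ is $$\mathcal F:\big((m_0,m_1),\epsilon,\epsilon,\epsilon,s\big)\mapsto(\epsilon,\epsilon,\epsilon,m_s,\epsilon),\qquad m_0,m_1\in\{0,1\}^\sigma,\ s\in\{0,1\}.$$ **The protocol DUQ-OT.** 1. $S$ runs $\mathcal G(1^\lambda)$, picks a uniform $C\in\mathbb G$ and publishes $pk=(C,p,g)$ with the description of $\mathbb G$. 2. $R$ picks uniform $r_1,r_2\in\mathbb Z_p$ and sends $r_1$ to $P_1$ and $r_2$ to $P_2$.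 3. $T$ picks a uniform bit $s_1$, sets $s_2=s\oplus s_1$, picks a uniform $r_3\in\{0,1\}^\lambda$, and sends $s_1$ to $P_1$, $s_2$ to $P_2$, $r_3$ to $S$ and $(s_2,r_3)$ to $R$. 4. $P_2$ sets $\delta_{s_2}=g^{r_2}$, $\delta_{1-s_2}=C/g^{r_2}$ and sends $(\delta_0,\delta_1)$ to $P_1$. 5. $P_1$ sets $\beta_{s_1}=\delta_0\, g^{r_1}$, $\beta_{1-s_1}=\delta_1/g^{r_1}$ and sends $(\beta_0,\beta_1)$ to $S$. 6. $S$ aborts if $C\ne\beta_0\beta_1$. Otherwise it picks uniform $y_0,y_1\in\mathbb Z_p$, sets $e_b=\big(g^{y_b},\ \mathtt G(\beta_b^{y_b})\oplus(m_b\|r_3)\big)$ for $b\in\{0,1\}$, and sends $(e'_0,e'_1)=\pi(e_0,e_1)$ to $R$. 7. $R$ sets $x=r_2+r_1(-1)^{s_2}$. For $i=0,1$ it computes $\mathtt G\big((e'_{i,0})^x\big)\oplus e'_{i,1}=u_1\|u_2$ with $|u_2|=\lambda$, and it outputs $u_1$ if $u_2=r_3$. **Theorem.** If the discrete-logarithm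 and computational Diffie–Hellman assumptions hold for $\mathcal G$, $\mathtt G$ is a random oracle, and $\pi$ is secure, then DUQ-OT securely computes $\mathcal F$ in the presence of a semi-honest adversary who corrupts any one of $S,R,P_1,P_2,T$. That is: * (correctness) for all inputs, except with probability negligible in $\lambda$ (uniformly in the inputs), no party aborts, $R$ outputs $m_s$, and the other parties output $\epsilon$; * (privacy) for each party $X\in\{S,R,P_1,P_2,T\}$ there is a non-uniform PPT simulator $\mathsf{Sim}_X$, which is given only the input and the output that $\mathcal F$ assigns to $X$, such that its output is computationally indistinguishable, as an ensemble indexed by $(m_0,m_1,s)$, from the view of $X$ in the protocol (its input, its random choices, the messages it receives and its output). In particular, $R$ obtains $m_s$ without learning $s$. Moreover, the protocol has sender-push communication ($R$ sends nothing to $S$, and all that $S$ sends, apart from the published key, goes to $R$). The request generation of $R$ is efficient: the number of its operations is bounded by a constant independent of $\lambda$, a uniform choice from $\mathbb Z_p$ being one operation. -/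

import Mathlib

open MeasureTheory
open scoped ENNReal

noncomputable section

/-! ### Bit strings -/

/-- Bit strings of length `k`. -/
abbrev Bits (k : ℕ) : Type := Fin k → Bool

/-- The `w` low-order bits of `n`, least significant bit first. -/
def natBits (w n : ℕ) : List Bool := (List.range w).map n.testBit

/-- Bitwise exclusive or. -/
def xorBits {k : ℕ} (a b : Bits k) : Bits k := fun i => a i ^^ b i

/-! ### Random oracles -/

/-- Functions `{0,1}^* → {0,1}^n`. -/
abbrev RO (n : ℕ) : Type := List Bool → Bits n

/-- The law of a random oracle `{0,1}^* → {0,1}^n`: the values at all strings are independent and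
uniformly distributed. -/
def roMeasure (n : ℕ) : Measure (RO n) :=
  Measure.infinitePi fun _ : List Bool => (PMF.uniformOfFintype (Bits n)).toMeasure

/-! ### Non-uniform probabilistic polynomial time, with access to an oracle

A straight-line program over bit registers is a Boolean circuit (over all binary gates) with random
gates and oracle gates; families of polynomially many gates are non-uniform probabilistic
polynomial-time algorithms. -/

/-- Memory: one bit in each register. -/
abbrev Mem : Type := ℕ → Bool

/-- The contents of registers `src, …, src + w - 1`. -/
def Mem.read (m : Mem) (src w : ℕ) : List Bool := (List.range w).map fun i => m (src + i)

/-- Overwrite registers `dst, …, dst + l.length - 1` by `l`. -/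
def Mem.write (m : Mem) (dst : ℕ) (l : List Bool) : Mem := fun i =>
  if dst ≤ i ∧ i < dst + l.length then l.getD (i - dst) false else m i

/-- The instructions.
* `gate f a b dst`: apply the binary Boolean gate `f` to registers `a` and `b`;
* `coin dst`: toss a fair coin;
* `unif w src dst`: choose uniformly an element of `{0, …, N - 1}`, where `N` is the number with the
  `w` binary digits in the registers from `src` on (nothing happens if `N = 0`), and write its
  `w` binary digits from `dst` on;
* `query w src dst`: ask the oracle for its value at the `w`-bit string in the registers from
  `src` on, and write the answer from `dst` on. -/
inductive Instr : Type
  | gate (f : Bool → Bool → Bool) (a b dst : ℕ)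
  | coin (dst : ℕ)
  | unif (w src dst : ℕ)
  | query (w src dst : ℕ)

/-- The number of steps an instruction is charged for. -/
def Instr.cost : Instr → ℕ
  | .gate _ _ _ _ => 1
  | .coin _ => 1
  | .unif w _ _ => w + 1
  | .query w _ _ => w + 1

/-- Oracle instructions. -/
def Instr.IsQuery : Instr → Prop
  | .query _ _ _ => True
  | _ => False

/-- Execution of one instruction. -/
def Instr.exec {n : ℕ} (O : RO n) : Instr → Mem → PMF Mem
  | .gate f a b dst, m => PMF.pure (m.write dst [f (m a) (m b)])
  | .coin dst, m => (PMF.uniformOfFintype Bool).map fun b => m.write dst [b]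
  | .unif w src dst, m =>
      if h : (Finset.range (Nat.ofBits fun i : Fin w => m (src + i))).Nonempty then
        (PMF.uniformOfFinset _ h).map fun a => m.write dst (natBits w a)
      else PMF.pure m
  | .query w src dst, m => PMF.pure (m.write dst (List.ofFn (O (m.read src w))))

/-- Execution of a list of instructions. -/
def execAll {n : ℕ} (O : RO n) : List Instr → Mem → PMF Mem
  | [], m => PMF.pure m
  | i :: l, m => (i.exec O m).bind (execAll O l)

/-- A program, together with the place and the length of its output. -/
structure Prog : Type where
  code : List Instr
  out : ℕ
  outLen : ℕ

/-- Running time of a program. -/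
def Prog.size (A : Prog) : ℕ := (A.code.map Instr.cost).sum + A.outLen

/-- The program makes no oracle queries. -/
def Prog.NoQuery (A : Prog) : Prop := ∀ i ∈ A.code, ¬ i.IsQuery

/-- The law of the output of a program with a given oracle and a given input. The input is in the
first registers, all the others are `0`. -/
def Prog.run {n : ℕ} (A : Prog) (O : RO n) (input : List Bool) : PMF (List Bool) :=
  (execAll O A.code fun i => input.getD i false).map fun m => m.read A.out A.outLen

/-- The law of the output of a program without oracle. -/
def Prog.runPlain (A : Prog) (input : List Bool) : PMF (List Bool) :=
  A.run (fun _ => (Fin.elim0 : Bits 0)) input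

/-- `f` is bounded by a polynomial. -/
def PolyBounded (f : ℕ → ℕ) : Prop := ∃ q : Polynomial ℕ, ∀ lam, f lam ≤ q.eval lam

/-- Non-uniform PPT algorithms: one program for each security parameter, of polynomial size. -/
def PolySize (A : ℕ → Prog) : Prop := PolyBounded fun lam => (A lam).size

/-- Negligible functions of the security parameter. -/
def Negligible (μ : ℕ → ℝ) : Prop :=
  Asymptotics.SuperpolynomialDecay Filter.atTop (fun lam : ℕ => (lam : ℝ)) μ

/-! ### Group generation, discrete logarithms, Diffie-Hellman -/

/-- A cyclic group of prime order with a generator `g`, whose elements are represented by strings of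
`ℓ` bits. -/
structure GroupInst (ℓ : ℕ) : Type 1 where
  Carrier : Type
  [group : CommGroup Carrier]
  [fintype : Fintype Carrier]
  enc : Carrier → Bits ℓ
  enc_injective : Function.Injective enc
  g : Carrier
  g_generates : ∀ x : Carrier, x ∈ Subgroup.zpowers g
  prime_card : (Fintype.card Carrier).Prime

attribute [instance] GroupInst.group GroupInst.fintype

/-- The order of the group. -/
def GroupInst.p {ℓ : ℕ} (I : GroupInst ℓ) : ℕ := Fintype.card I.Carrier

instance {ℓ : ℕ} (I : GroupInst ℓ) : Fact I.p.Prime := ⟨I.prime_card⟩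

/-- The representation of a group element, as a string. -/
def GroupInst.str {ℓ : ℕ} (I : GroupInst ℓ) (x : I.Carrier) : List Bool := List.ofFn (I.enc x)

/-- `I.pow x r` is `x ^ r`, for an exponent modulo the order of the group. -/
def GroupInst.pow {ℓ : ℕ} (I : GroupInst ℓ) (x : I.Carrier) (r : ZMod I.p) : I.Carrier := x ^ r.val

/-- The number of binary digits of the group order at security parameter `lam`: this is `lam`,
except that no prime number has fewer than two digits. -/
def ordLen (lam : ℕ) : ℕ := max 2 lam

/-- The representation of an element of `ℤ_p`, as a string. -/
def GroupInst.expStr {ℓ : ℕ} (I : GroupInst ℓ) (lam : ℕ) (r : ZMod I.p) : List Bool :=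
  natBits (ordLen lam) r.val

/-- The string representing `(𝔾, p, g)`, where `d` is a description of the group. -/
def GroupInst.setup {ℓ k : ℕ} (I : GroupInst ℓ) (lam : ℕ) (d : Bits k) : List Bool :=
  List.ofFn d ++ natBits (ordLen lam) I.p ++ I.str I.g

/-- A group-generation scheme. On security parameter `lam` it makes random choices `ω` of law
`rand lam` and outputs `(𝔾, p, g)`, with `𝔾` described by the string `desc lam ω`. The scheme, the
multiplication and the inversion in the groups that it outputs run in polynomial time. -/
structure GroupScheme : Type 1 where
  coinLen : ℕ → ℕ
  descLen : ℕ → ℕ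
  elemLen : ℕ → ℕ
  rand : (lam : ℕ) → PMF (Bits (coinLen lam))
  desc : (lam : ℕ) → Bits (coinLen lam) → Bits (descLen lam)
  inst : (lam : ℕ) → Bits (descLen lam) → GroupInst (elemLen lam)
  order_digits : ∀ lam, ∀ ω ∈ (rand lam).support,
    (inst lam (desc lam ω)).p.size = ordLen lam
  gen_efficient : ∃ A : ℕ → Prog, PolySize A ∧ (∀ lam, (A lam).NoQuery) ∧
    ∀ lam, (A lam).runPlain [] = (rand lam).map fun ω =>
      List.ofFn ω ++ (inst lam (desc lam ω)).setup lam (desc lam ω)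
  mul_efficient : ∃ A : ℕ → Prog, PolySize A ∧ (∀ lam, (A lam).NoQuery) ∧
    ∀ lam, ∀ ω ∈ (rand lam).support, ∀ x y : (inst lam (desc lam ω)).Carrier,
      (A lam).runPlain ((inst lam (desc lam ω)).setup lam (desc lam ω) ++
          (inst lam (desc lam ω)).str x ++ (inst lam (desc lam ω)).str y) =
        PMF.pure ((inst lam (desc lam ω)).str (x * y))
  inv_efficient : ∃ A : ℕ → Prog, PolySize A ∧ (∀ lam, (A lam).NoQuery) ∧
    ∀ lam, ∀ ω ∈ (rand lam).support, ∀ x : (inst lam (desc lam ω)).Carrier,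
      (A lam).runPlain ((inst lam (desc lam ω)).setup lam (desc lam ω) ++
          (inst lam (desc lam ω)).str x) =
        PMF.pure ((inst lam (desc lam ω)).str x⁻¹)

namespace GroupScheme

variable (𝒢 : GroupScheme)

/-- The group that the scheme outputs when its random choices are `ω`. -/
abbrev grp (lam : ℕ) (ω : Bits (𝒢.coinLen lam)) : GroupInst (𝒢.elemLen lam) :=
  𝒢.inst lam (𝒢.desc lam ω)

/-- The string representing the output `(𝔾, p, g)` of the scheme. -/
def setup (lam : ℕ) (ω : Bits (𝒢.coinLen lam)) : List Bool :=
  (𝒢.grp lam ω).setup lam (𝒢.desc lam ω)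

open Classical in
/-- The discrete-logarithm experiment: `A` is given `(𝔾, p, g)` and `g ^ a` and has to find `a`. -/
def dlExp (lam : ℕ) (A : Prog) : PMF Bool :=
  (𝒢.rand lam).bind fun ω =>
  (PMF.uniformOfFintype (ZMod (𝒢.grp lam ω).p)).bind fun a =>
  (A.runPlain (𝒢.setup lam ω ++ (𝒢.grp lam ω).str ((𝒢.grp lam ω).pow (𝒢.grp lam ω).g a))).map
    fun o => decide (o = (𝒢.grp lam ω).expStr lam a)

/-- The discrete-logarithm assumption. -/
def DL : Prop := ∀ A : ℕ → Prog, PolySize A → (∀ lam, (A lam).NoQuery) →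
  Negligible fun lam => (𝒢.dlExp lam (A lam) true).toReal

open Classical in
/-- The Diffie-Hellman experiment: `A` is given `(𝔾, p, g)`, `g ^ a₁` and `g ^ a₂` and has to find
`g ^ (a₁ a₂)`. -/
def cdhExp (lam : ℕ) (A : Prog) : PMF Bool :=
  (𝒢.rand lam).bind fun ω =>
  (PMF.uniformOfFintype (ZMod (𝒢.grp lam ω).p)).bind fun a₁ =>
  (PMF.uniformOfFintype (ZMod (𝒢.grp lam ω).p)).bind fun a₂ =>
  (A.runPlain (𝒢.setup lam ω ++ (𝒢.grp lam ω).str ((𝒢.grp lam ω).pow (𝒢.grp lam ω).g a₁) ++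
      (𝒢.grp lam ω).str ((𝒢.grp lam ω).pow (𝒢.grp lam ω).g a₂))).map
    fun o => decide (o = (𝒢.grp lam ω).str ((𝒢.grp lam ω).pow (𝒢.grp lam ω).g (a₁ * a₂)))

/-- The computational Diffie-Hellman assumption. -/
def CDH : Prop := ∀ A : ℕ → Prog, PolySize A → (∀ lam, (A lam).NoQuery) →
  Negligible fun lam => (𝒢.cdhExp lam (A lam) true).toReal

end GroupScheme

/-! ### Random permutations -/

/-- A random permutation of the `n` positions of a tuple is secure if the original index of each
element of the permuted tuple equals each of the `n` possible values with probability `1 / n`. -/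
def SecurePermutation {ι : Type} [Fintype ι] (π : PMF (Equiv.Perm ι)) : Prop :=
  ∀ i j : ι, (π.map fun τ => τ i) j = (Fintype.card ι : ℝ≥0∞)⁻¹

/-! ### Five-party protocols, views, and the functionality -/

/-- Sender, receiver, query issuer, and the two helper servers. -/
inductive Party : Type
  | S | R | T | P1 | P2
  deriving DecidableEq

/-- A message; `dst = none` means that it is published, i.e. sent to everyone. -/
structure Event : Type where
  src : Party
  dst : Option Party
  payload : List Bool

/-- A run of a protocol: the random choices of each party, the messages in their order, and the
output of each party (`none` if it aborts or finds no output). -/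
structure Execution : Type where
  coins : Party → List Bool
  transcript : List Event
  output : Party → Option (List Bool)

/-- The inputs of delegated-unknown-query OT with messages of `σ` bits: the messages `m_0`, `m_1`
of the sender (indexed by `false`, `true`) and the index `s` of the query issuer. -/
structure Inputs (σ : ℕ) : Type where
  m : Bool → Bits σ
  s : Bool

/-- The input of each party; `[]` is the empty string. -/
def Inputs.ofParty {σ : ℕ} (x : Inputs σ) : Party → List Bool
  | .S => List.ofFn (x.m false) ++ List.ofFn (x.m true)
  | .T => [x.s]
  | _ => []

/-- The delegated-unknown-query OT functionality: the receiver obtains `m_s`, the others nothing. -/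
def Inputs.functionality {σ : ℕ} (x : Inputs σ) : Party → List Bool
  | .R => List.ofFn (x.m x.s)
  | _ => []

/-- Protocols in the random-oracle model, for messages of `σ lam` bits and an oracle with values of
`n lam` bits. -/
abbrev Protocol (σ n : ℕ → ℕ) : Type :=
  (lam : ℕ) → RO (n lam) → Inputs (σ lam) → PMF Execution

/-- The view of a party: its input, its random choices, the messages that it receives (and those
that are published), and its output. -/
def Execution.view {σ : ℕ} (e : Execution) (x : Inputs σ) (P : Party) : List Bool :=
  x.ofParty P ++ e.coins P ++
    (e.transcript.filter fun v => v.dst = none ∨ v.dst = some P).flatMap Event.payload ++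
    (e.output P).getD []

/-! ### Security in the presence of semi-honest adversaries -/

/-- The probability that `D` outputs `1` on a sample of `X`, over the random oracle, which is shared
by `D` and `X`, and over the random choices of `D` and `X`. -/
def acceptProb {n : ℕ} (D : Prog) (X : RO n → PMF (List Bool)) : ℝ :=
  (∫⁻ O, ((X O).bind (D.run O)) [true] ∂roMeasure n).toReal

/-- Computational indistinguishability of ensembles indexed by the security parameter and by
inputs. -/
def CompIndist {n : ℕ → ℕ} {ι : ℕ → Type}
    (X Y : (lam : ℕ) → ι lam → RO (n lam) → PMF (List Bool)) : Prop :=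
  ∀ D : ℕ → Prog, PolySize D → ∃ μ : ℕ → ℝ, Negligible μ ∧
    ∀ (lam : ℕ) (i : ι lam), |acceptProb (D lam) (X lam i) - acceptProb (D lam) (Y lam i)| ≤ μ lam

namespace Protocol

variable {σ n : ℕ → ℕ} (Γ : Protocol σ n)

/-- Correctness: with overwhelming probability all parties obtain the outputs that the functionality
specifies. -/
def Correct : Prop := ∃ μ : ℕ → ℝ, Negligible μ ∧ ∀ (lam : ℕ) (x : Inputs (σ lam)),
  (∫⁻ O, (Γ lam O x).toOuterMeasure {e | ∃ P, e.output P ≠ some (x.functionality P)}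
    ∂roMeasure (n lam)).toReal ≤ μ lam

/-- Privacy against a semi-honest party: a simulator that is given only the input and the output of
this party generates its view, up to computational indistinguishability. -/
def Simulatable (P : Party) : Prop := ∃ Sim : ℕ → Prog, PolySize Sim ∧
  CompIndist
    (fun lam (x : Inputs (σ lam)) (O : RO (n lam)) =>
      (Sim lam).run O (x.ofParty P ++ x.functionality P))
    (fun lam (x : Inputs (σ lam)) (O : RO (n lam)) => (Γ lam O x).map fun e => e.view x P)

/-- The protocol securely computes the functionality in the presence of a semi-honest adversary
who corrupts any one of the five parties. -/
def SecurelyComputes : Prop := Γ.Correct ∧ ∀ P : Party, Γ.Simulatable P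

/-- Sender-push communication: the receiver never sends anything to the sender, and all that the
sender sends, apart from what it publishes, goes to the receiver. -/
def SenderPush : Prop := ∀ (lam : ℕ) (O : RO (n lam)) (x : Inputs (σ lam)),
  ∀ e ∈ (Γ lam O x).support, ∀ v ∈ e.transcript,
    (v.src = .R → v.dst ≠ none ∧ v.dst ≠ some .S) ∧
    (v.src = .S → v.dst = none ∨ v.dst = some .R)

end Protocol

/-! ### The protocol DUQ-OT -/

namespace DUQOT

/-- `(2,2)` XOR secret sharing of `s` with random first share: the second share. -/
def share₂ (s s₁ : Bool) : Bool := s₁ ^^ s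

section Algorithms

variable {ℓ : ℕ} (I : GroupInst ℓ)

/-- Delegation by the receiver: `r₁` and `r₂`. -/
def request : PMF (ZMod I.p × ZMod I.p) :=
  (PMF.uniformOfFintype (ZMod I.p)).bind fun r₁ =>
  (PMF.uniformOfFintype (ZMod I.p)).bind fun r₂ => PMF.pure (r₁, r₂)

/-- Query generation by the second server:
`δ_{s₂} = g ^ r₂` and `δ_{1 - s₂} = C / g ^ r₂`. -/
def genQuery₂ (C : I.Carrier) (s₂ : Bool) (r₂ : ZMod I.p) : Bool → I.Carrier := fun b =>
  if b = s₂ then I.pow I.g r₂ else C / I.pow I.g r₂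

/-- Query generation by the first server:
`β_{s₁} = δ_0 g ^ r₁` and `β_{1 - s₁} = δ_1 / g ^ r₁`. -/
def genQuery₁ (δ : Bool → I.Carrier) (s₁ : Bool) (r₁ : ZMod I.p) : Bool → I.Carrier := fun b =>
  if b = s₁ then δ false * I.pow I.g r₁ else δ true / I.pow I.g r₁

variable {σ lam : ℕ} (G : RO (σ + lam))

open Classical in
/-- Response generation by the sender. It aborts if `C ≠ β_0 β_1`. Otherwise it encrypts `m_b || r₃`
as `e_b = (g ^ y_b, G(β_b ^ y_b) ⊕ (m_b || r₃))` and permutes the pair `(e_0, e_1)`. -/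
def genRes (C : I.Carrier) (m : Bool → Bits σ) (r₃ : Bits lam) (y : Bool → ZMod I.p)
    (τ : Equiv.Perm Bool) (β : Bool → I.Carrier) : Option (Bool → I.Carrier × Bits (σ + lam)) :=
  if C ≠ β false * β true then none
  else
    let e : Bool → I.Carrier × Bits (σ + lam) := fun b =>
      (I.pow I.g (y b), xorBits (G (I.str (I.pow (β b) (y b)))) (Fin.append (m b) r₃))
    some fun i => e (τ i)

/-- Message extraction by the receiver. It sets `x = r₂ + r₁ (-1) ^ s₂`, decrypts both `e'_i`, splits
each result into `u₁` and the last `lam` bits `u₂`, and accepts `u₁` if `u₂ = r₃`. -/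
def retrieve (e' : Bool → I.Carrier × Bits (σ + lam)) (r₁ r₂ : ZMod I.p) (s₂ : Bool)
    (r₃ : Bits lam) : Option (Bits σ) :=
  let x : ZMod I.p := r₂ + r₁ * (-1) ^ s₂.toNat
  [false, true].foldl (fun acc i =>
    let y : Bits (σ + lam) := xorBits (G (I.str (I.pow (e' i).1 x))) (e' i).2
    let u₁ : Bits σ := fun j => y (Fin.castAdd lam j)
    let u₂ : Bits lam := fun j => y (Fin.natAdd σ j)
    if u₂ = r₃ then some u₁ else acc) none

end Algorithms

/-- The random choices of the sender: those for the choice of the group, `C`, `y_0`, `y_1`, and the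
permutation. -/
structure SenderCoins (𝒢 : GroupScheme) (lam : ℕ) : Type where
  ω : Bits (𝒢.coinLen lam)
  C : (𝒢.grp lam ω).Carrier
  y : Bool → ZMod (𝒢.grp lam ω).p
  τ : Equiv.Perm Bool

/-- The random choices of the sender, with permutation law `π`. -/
def senderCoins (𝒢 : GroupScheme) (lam : ℕ) (π : PMF (Equiv.Perm Bool)) :
    PMF (SenderCoins 𝒢 lam) :=
  (𝒢.rand lam).bind fun ω =>
  (PMF.uniformOfFintype (𝒢.grp lam ω).Carrier).bind fun C =>
  (PMF.uniformOfFintype (ZMod (𝒢.grp lam ω).p)).bind fun y₀ =>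
  (PMF.uniformOfFintype (ZMod (𝒢.grp lam ω).p)).bind fun y₁ =>
  π.map fun τ => ⟨ω, C, fun b => if b then y₁ else y₀, τ⟩

/-- The public key `(C, p, g)`, with the description of the group. -/
def pk (𝒢 : GroupScheme) (lam : ℕ) (ω : Bits (𝒢.coinLen lam)) (C : (𝒢.grp lam ω).Carrier) :
    List Bool :=
  𝒢.setup lam ω ++ (𝒢.grp lam ω).str C

/-- The run of DUQ-OT, as a function of all random choices: those of the sender (`c`), of the
receiver (`r₁`, `r₂`) and of the query issuer (the share `s₁` and the tag `r₃`). -/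
def execution (𝒢 : GroupScheme) (lam : ℕ) {σ : ℕ} (G : RO (σ + lam)) (x : Inputs σ)
    (c : SenderCoins 𝒢 lam) (r₁ r₂ : ZMod (𝒢.grp lam c.ω).p) (s₁ : Bool) (r₃ : Bits lam) :
    Execution :=
  let I := 𝒢.grp lam c.ω
  let s₂ := share₂ x.s s₁
  let δ := genQuery₂ I c.C s₂ r₂
  let β := genQuery₁ I δ s₁ r₁
  let res := genRes I G c.C x.m r₃ c.y c.τ β
  { coins := fun
      | .S => List.ofFn c.ω ++ I.str c.C ++ I.expStr lam (c.y false) ++ I.expStr lam (c.y true) ++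
          [c.τ false]
      | .R => I.expStr lam r₁ ++ I.expStr lam r₂
      | .T => s₁ :: List.ofFn r₃
      | .P1 => []
      | .P2 => []
    transcript :=
      [⟨.S, none, pk 𝒢 lam c.ω c.C⟩,
       ⟨.R, some .P1, I.expStr lam r₁⟩,
       ⟨.R, some .P2, I.expStr lam r₂⟩,
       ⟨.T, some .P1, [s₁]⟩,
       ⟨.T, some .P2, [s₂]⟩,
       ⟨.T, some .S, List.ofFn r₃⟩,
       ⟨.T, some .R, s₂ :: List.ofFn r₃⟩,
       ⟨.P2, some .P1, I.str (δ false) ++ I.str (δ true)⟩,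
       ⟨.P1, some .S, I.str (β false) ++ I.str (β true)⟩] ++
      match res with
      | none => []
      | some e' =>
        [⟨.S, some .R, I.str (e' false).1 ++ List.ofFn (e' false).2 ++
          I.str (e' true).1 ++ List.ofFn (e' true).2⟩]
    output := fun
      | .S => res.map fun _ => []
      | .R => (res.bind fun e' => retrieve I G e' r₁ r₂ s₂ r₃).map fun u => List.ofFn u
      | _ => some [] }

/-- The protocol DUQ-OT, over the groups of `𝒢`, for messages of `σ lam` bits, with a random oracle
`G : {0,1}^* → {0,1}^(σ lam + lam)` and a random permutation of law `π lam`. -/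
def protocol (𝒢 : GroupScheme) (σ : ℕ → ℕ) (π : ℕ → PMF (Equiv.Perm Bool)) :
    Protocol σ (fun lam => σ lam + lam) := fun lam G x =>
  (senderCoins 𝒢 lam (π lam)).bind fun c =>
  (request (𝒢.grp lam c.ω)).bind fun r =>
  (PMF.uniformOfFintype Bool).bind fun s₁ =>
  (PMF.uniformOfFintype (Bits lam)).map fun r₃ =>
    execution 𝒢 lam G x c r.1 r.2 s₁ r₃

/-- Efficiency of delegation: given the public key, the receiver generates its request by a number
of instructions that is bounded independently of the security parameter (a uniform choice from
`ℤ_p` is one instruction). -/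
def ReceiverEfficient (𝒢 : GroupScheme) : Prop := ∃ (c : ℕ) (Q : ℕ → Prog),
  (∀ lam, (Q lam).code.length ≤ c) ∧ (∀ lam, (Q lam).NoQuery) ∧
  ∀ lam, ∀ ω ∈ (𝒢.rand lam).support, ∀ C : (𝒢.grp lam ω).Carrier,
    (Q lam).runPlain (pk 𝒢 lam ω C) = (request (𝒢.grp lam ω)).map fun r =>
      (𝒢.grp lam ω).expStr lam r.1 ++ (𝒢.grp lam ω).expStr lam r.2

end DUQOT

end

/-!
Why DUQ-OT is secure. Put `x = r₂ + r₁ (-1) ^ s₂`. Whatever the shares of `s` are, the two keys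
that reach the sender are `β_s = g ^ x` and `β_{1-s} = C / g ^ x` (`DUQOT.genQuery₁_genQuery₂`).
The receiver knows `x`, hence opens the ciphertext of `m_s`. As `r₁`, `r₂` and the share are
uniform, the pair `β` that `S` sees and the pair `δ` that `P₁` sees consist of a uniform group
element and its complement, independently of `s`, and the shares that `P₁` and `P₂` see are uniform
bits. The views of `S`, `T`, `P₁` and `P₂` can therefore be generated exactly
(`DUQOT.simulatable_S` and its analogues).

For the receiver, relabel the random choices as `C = g ^ c`, the exponent `z` of the ciphertext of
`m_{1-s}`, and all others (`DUQOT.protocol_map_eq_runOf`); since the permutation is secure, the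
position of each ciphertext is a uniform bit. The message `m_{1-s}` is masked by the oracle value
at the *hidden query* `(C / g ^ x) ^ z`. The simulator puts a uniform string in place of this
ciphertext. Resample the oracle at the hidden query: unless the group elements coincide by
accident, or the receiver finds the tag `r₃` in a wrong decryption (both have probability
`O (2 ^ (-lam))`), the real and the ideal view only differ for a distinguisher that queries the oracle at
the hidden query, after seeing the ideal view (`DUQOT.realProb_idealProb_le`, which rests on
`Prog.run_le_add_probe`). The ideal view contains `g ^ c` and `g ^ z` but nothing else that depends
on `c` and `z`, and a distinguisher that finds `(C / g ^ x) ^ z = g ^ (c z) / (g ^ z) ^ x` solves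
the Diffie-Hellman problem (`DUQOT.negligible_hitExp`). Its oracle has to be removed first, by lazy
sampling (`Prog.exists_lazy`). As adversaries are non-uniform, one reduction with the worst query
and the worst message at each security parameter gives a bound that is uniform in the inputs
(`DUQOT.simulatable_R`).

Correctness follows from the same estimate of accidental coincidences and tags (`DUQOT.correct`).

Simulators and reductions are assembled from closure properties of polynomial-size programs:
`Impl src K` says that a family of programs, given the strings of the family `src`, has output law `K`,
and `Det src f` that it computes the family `f`. Group exponentiation is square-and-multiply
(`Det.pow`).
-/

/-! ### Memory layout -/

namespace Mem

/-- The memory that agrees with `lo` below the register `F`, and carries a copy of the memory `hi`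
from the register `F` on. -/
def splice (F : ℕ) (lo hi : Mem) : Mem := fun i => if i < F then lo i else hi (i - F)

/-- The initial memory of a program on the input `s`. -/
def ofInput (s : List Bool) : Mem := fun i => s.getD i false

theorem length_read (m : Mem) (src w : ℕ) : (m.read src w).length = w := by simp [read]

theorem write_of_lt (m : Mem) (dst : ℕ) (l : List Bool) {i : ℕ} (h : i < dst) :
    m.write dst l i = m i := by
  unfold write; rw [if_neg]; omega

theorem read_write (m : Mem) (dst : ℕ) (l : List Bool) :
    (m.write dst l).read dst l.length = l := by
  apply List.ext_getElem
  · simp [read]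
  · intro i h1 h2
    simp [read, write, h2]

theorem read_write_of_le (m : Mem) (src w dst : ℕ) (l : List Bool) (h : src + w ≤ dst) :
    (m.write dst l).read src w = m.read src w := by
  apply List.map_congr_left
  intro i hi
  rw [List.mem_range] at hi
  exact write_of_lt _ _ _ (by omega)

theorem write_cons (m : Mem) (dst : ℕ) (b : Bool) (l : List Bool) :
    (m.write dst [b]).write (dst + 1) l = m.write dst (b :: l) := by
  funext i
  simp only [write, List.length_cons, List.length_nil]
  by_cases h1 : dst + 1 ≤ i ∧ i < dst + 1 + l.length
  · rw [if_pos h1, if_pos (by omega)]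
    obtain ⟨k, rfl⟩ : ∃ k, i = dst + 1 + k := ⟨i - (dst + 1), by omega⟩
    rw [show dst + 1 + k - dst = k + 1 by omega, show dst + 1 + k - (dst + 1) = k by omega]
    simp
  · rw [if_neg h1]
    by_cases h2 : i = dst
    · subst h2; simp
    · rw [if_neg (by omega), if_neg (by omega)]

theorem write_nil (m : Mem) (dst : ℕ) : m.write dst [] = m := by
  funext i; simp only [write, List.length_nil]; rw [if_neg]; omega

theorem splice_add (F : ℕ) (lo hi : Mem) (i : ℕ) : splice F lo hi (i + F) = hi i := by
  simp [splice]

theorem splice_of_lt {F : ℕ} (lo hi : Mem) {i : ℕ} (h : i < F) : splice F lo hi i = lo i := by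
  simp [splice, h]

theorem read_splice_add (F : ℕ) (lo hi : Mem) (src w : ℕ) :
    (splice F lo hi).read (src + F) w = hi.read src w := by
  apply List.map_congr_left
  intro i _
  rw [show src + F + i = src + i + F by omega, splice_add]

theorem read_splice_lo {F : ℕ} (lo hi : Mem) {src w : ℕ} (h : src + w ≤ F) :
    (splice F lo hi).read src w = lo.read src w := by
  apply List.map_congr_left
  intro i hi
  rw [List.mem_range] at hi
  exact splice_of_lt _ _ (by omega)

theorem write_splice_add (F : ℕ) (lo hi : Mem) (dst : ℕ) (l : List Bool) :
    (splice F lo hi).write (dst + F) l = splice F lo (hi.write dst l) := by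
  funext i
  simp only [write, splice]
  by_cases h : i < F
  · rw [if_neg (by omega), if_pos h, if_pos h]
  · rw [if_neg h, if_neg h]
    by_cases h2 : dst ≤ i - F ∧ i - F < dst + l.length
    · rw [if_pos h2, if_pos (by omega)]; congr 1; omega
    · rw [if_neg h2, if_neg (by omega)]

theorem write_splice_lo {F : ℕ} (lo hi : Mem) {dst : ℕ} {l : List Bool}
    (h : dst + l.length ≤ F) :
    (splice F lo hi).write dst l = splice F (lo.write dst l) hi := by
  funext i
  simp only [write, splice]
  by_cases h1 : i < F
  · simp [h1]
  · rw [if_neg (by omega), if_neg h1, if_neg h1]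

theorem ofInput_eq_splice {F : ℕ} {s : List Bool} (h : s.length ≤ F) :
    ofInput s = splice F (ofInput s) (fun _ => false) := by
  funext i
  unfold splice ofInput
  split_ifs with h1
  · rfl
  · rw [List.getD_eq_default]; omega

theorem write_zero_eq_ofInput (s : List Bool) :
    Mem.write (fun _ => false) 0 s = ofInput s := by
  funext i
  unfold write ofInput
  split_ifs with h
  · rfl
  · rw [List.getD_eq_default]; omega

theorem splice_zero_write (F : ℕ) (m : Mem) (s : List Bool) :
    (splice F m fun _ => false).write F s = splice F m (ofInput s) := by
  have := write_splice_add F m (fun _ => false) 0 s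
  rw [Nat.zero_add, write_zero_eq_ofInput] at this
  exact this

end Mem

/-! ### Relocation and straight-line gates -/

/-- The instruction with all register numbers increased by `F`. -/
def Instr.shift (F : ℕ) : Instr → Instr
  | .gate f a b dst => .gate f (a + F) (b + F) (dst + F)
  | .coin dst => .coin (dst + F)
  | .unif w src dst => .unif w (src + F) (dst + F)
  | .query w src dst => .query w (src + F) (dst + F)

/-- All registers that the instruction reads or writes lie below `F`, when the oracle has `n`-bit
values. -/
def Instr.Below (n F : ℕ) : Instr → Prop
  | .gate _ a b dst => a < F ∧ b < F ∧ dst < F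
  | .coin dst => dst < F
  | .unif w src dst => src + w ≤ F ∧ dst + w ≤ F
  | .query w src dst => src + w ≤ F ∧ dst + n ≤ F

theorem Instr.cost_shift (F : ℕ) (i : Instr) : (i.shift F).cost = i.cost := by
  cases i <;> rfl

theorem cost_map_shift (F : ℕ) (l : List Instr) :
    ((l.map (Instr.shift F)).map Instr.cost).sum = (l.map Instr.cost).sum := by
  rw [List.map_map]
  congr 1
  exact List.map_congr_left fun i _ => i.cost_shift F

theorem Instr.one_le_cost (i : Instr) : 1 ≤ i.cost := by
  cases i <;> simp [cost]

theorem length_le_cost (l : List Instr) : l.length ≤ (l.map Instr.cost).sum := by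
  induction l with
  | nil => simp
  | cons i l ih => have := i.one_le_cost; simp; omega

theorem Instr.Below.mono {n F F' : ℕ} (h : F ≤ F') {i : Instr} (hi : i.Below n F) :
    i.Below n F' := by
  cases i <;> simp only [Below] at * <;> omega

theorem exists_below (n : ℕ) (l : List Instr) : ∃ F, ∀ i ∈ l, i.Below n F := by
  induction l with
  | nil => exact ⟨0, by simp⟩
  | cons i l ih =>
    obtain ⟨F, hF⟩ := ih
    obtain ⟨F', hF'⟩ : ∃ F', i.Below n F' := by
      cases i with
      | gate f a b dst => exact ⟨a + b + dst + 1, by simp only [Instr.Below]; omega⟩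
      | coin dst => exact ⟨dst + 1, by simp only [Instr.Below]; omega⟩
      | unif w src dst => exact ⟨src + w + dst, by simp only [Instr.Below]; omega⟩
      | query w src dst => exact ⟨src + w + dst + n, by simp only [Instr.Below]; omega⟩
    refine ⟨F + F', fun j hj => ?_⟩
    rcases List.mem_cons.1 hj with rfl | hj
    · exact hF'.mono (by omega)
    · exact (hF j hj).mono (by omega)

section Exec

variable {n : ℕ} (O : RO n)

theorem Instr.exec_shift (F : ℕ) (lo m : Mem) (i : Instr) :
    (i.shift F).exec O (Mem.splice F lo m) = (i.exec O m).map (Mem.splice F lo) := by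
  cases i with
  | gate f a b dst =>
    simp [shift, exec, PMF.pure_map, Mem.write_splice_add, Mem.splice_add]
  | coin dst =>
    simp only [shift, exec, PMF.map_comp, Mem.write_splice_add]; rfl
  | unif w src dst =>
    have h : (fun i : Fin w => Mem.splice F lo m (src + F + i)) = fun i : Fin w => m (src + i) := by
      funext i
      rw [show src + F + (i : ℕ) = src + i + F by omega, Mem.splice_add]
    simp only [shift, exec, h]
    split_ifs with h1
    · simp only [PMF.map_comp, Mem.write_splice_add]; rfl
    · rw [PMF.pure_map]
  | query w src dst =>
    simp [shift, exec, PMF.pure_map, Mem.write_splice_add, Mem.read_splice_add]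

theorem execAll_shift (F : ℕ) (lo : Mem) (l : List Instr) (m : Mem) :
    execAll O (l.map (Instr.shift F)) (Mem.splice F lo m) =
      (execAll O l m).map (Mem.splice F lo) := by
  induction l generalizing m with
  | nil => simp [execAll, PMF.pure_map]
  | cons i l ih =>
    simp only [List.map_cons, execAll, Instr.exec_shift, PMF.bind_map, PMF.map_bind]
    congr 1
    funext m'
    exact ih m'

theorem Instr.exec_splice {F : ℕ} (hi m : Mem) {i : Instr} (h : i.Below n F) :
    i.exec O (Mem.splice F m hi) = (i.exec O m).map fun m' => Mem.splice F m' hi := by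
  cases i with
  | gate f a b dst =>
    simp only [Below] at h
    simp only [exec, PMF.pure_map]
    rw [Mem.write_splice_lo _ _ (by simp; omega), Mem.splice_of_lt _ _ h.1,
      Mem.splice_of_lt _ _ h.2.1]
  | coin dst =>
    simp only [Below] at h
    simp only [exec, PMF.map_comp]
    congr 1
    funext b
    exact Mem.write_splice_lo _ _ (by simp; omega)
  | unif w src dst =>
    simp only [Below] at h
    have h' : (fun i : Fin w => Mem.splice F m hi (src + i)) = fun i : Fin w => m (src + i) := by
      funext i
      rw [Mem.splice_of_lt _ _ (by omega)]
    simp only [exec, h']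
    split_ifs with h1
    · simp only [PMF.map_comp]
      congr 1
      funext b
      exact Mem.write_splice_lo _ _ (by simp [natBits]; omega)
    · rw [PMF.pure_map]
  | query w src dst =>
    simp only [Below] at h
    simp only [exec, PMF.pure_map]
    rw [Mem.write_splice_lo _ _ (by simp; omega), Mem.read_splice_lo _ _ h.1]

theorem execAll_splice {F : ℕ} (hi : Mem) {l : List Instr} (h : ∀ i ∈ l, i.Below n F) (m : Mem) :
    execAll O l (Mem.splice F m hi) = (execAll O l m).map fun m' => Mem.splice F m' hi := by
  induction l generalizing m with
  | nil => simp [execAll, PMF.pure_map]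
  | cons i l ih =>
    simp only [execAll, Instr.exec_splice O hi m (h i (by simp)), PMF.bind_map, PMF.map_bind]
    congr 1
    funext m'
    exact ih (fun j hj => h j (by simp [hj])) m'

theorem execAll_append (l l' : List Instr) (m : Mem) :
    execAll O (l ++ l') m = (execAll O l m).bind (execAll O l') := by
  induction l generalizing m with
  | nil => simp [execAll]
  | cons i l ih =>
    simp only [List.cons_append, execAll, PMF.bind_bind]
    congr 1
    funext m'
    exact ih m'

/-- A binary gate with its two input registers. -/
abbrev Gate : Type := (Bool → Bool → Bool) × ℕ × ℕ

/-- The value of a gate in a memory. -/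
def Gate.eval (t : Gate) (m : Mem) : Bool := t.1 (m t.2.1) (m t.2.2)

/-- The identity gate on a register. -/
def Gate.wire (a : ℕ) : Gate := (fun x _ => x, a, a)

/-- Code that evaluates a list of gates into consecutive registers. -/
def gateCode : List Gate → ℕ → List Instr
  | [], _ => []
  | t :: ts, dst => .gate t.1 t.2.1 t.2.2 dst :: gateCode ts (dst + 1)

theorem cost_gateCode (ts : List Gate) (dst : ℕ) :
    ((gateCode ts dst).map Instr.cost).sum = ts.length := by
  induction ts generalizing dst with
  | nil => rfl
  | cons t ts ih => simp [gateCode, ih, Instr.cost]; omega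

theorem execAll_gateCode_of_disjoint {ts : List Gate} {dst : ℕ}
    (h : ∀ t ∈ ts, (t.2.1 < dst ∨ dst + ts.length ≤ t.2.1) ∧
      (t.2.2 < dst ∨ dst + ts.length ≤ t.2.2)) (m : Mem) :
    execAll O (gateCode ts dst) m = PMF.pure (m.write dst (ts.map fun t => t.eval m)) := by
  induction ts generalizing dst m with
  | nil => simp [gateCode, execAll, Mem.write_nil]
  | cons t ts ih =>
    simp only [List.length_cons] at h
    simp only [gateCode, execAll, Instr.exec, PMF.pure_bind]
    rw [ih (fun t ht => by have := h t (by simp [ht]); omega)]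
    rw [List.map_cons, ← Mem.write_cons m dst (t.eval m) (ts.map fun t => t.eval m)]
    congr 2
    apply List.map_congr_left
    intro t' ht'
    have := h t' (by simp [ht'])
    have hw : ∀ a, (a < dst ∨ dst + (ts.length + 1) ≤ a) → ∀ b, m.write dst [b] a = m a := by
      intro a ha b
      simp only [Mem.write, List.length_singleton]
      rw [if_neg]
      omega
    simp only [Gate.eval]
    rw [hw _ this.1, hw _ this.2]

theorem execAll_gateCode {ts : List Gate} {dst : ℕ} (h : ∀ t ∈ ts, t.2.1 < dst ∧ t.2.2 < dst)
    (m : Mem) :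
    execAll O (gateCode ts dst) m = PMF.pure (m.write dst (ts.map fun t => t.eval m)) :=
  execAll_gateCode_of_disjoint O (fun t ht => ⟨Or.inl (h t ht).1, Or.inl (h t ht).2⟩) m

end Exec

/-! ### Combining programs -/

namespace Prog

theorem run_eq {n : ℕ} (A : Prog) (O : RO n) (s : List Bool) :
    A.run O s = (execAll O A.code (Mem.ofInput s)).map fun m => m.read A.out A.outLen := rfl

theorem length_of_mem_run {n : ℕ} (A : Prog) (O : RO n) (s t : List Bool)
    (h : t ∈ (A.run O s).support) : t.length = A.outLen := by
  rw [run_eq, PMF.mem_support_map_iff] at h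
  obtain ⟨m, _, rfl⟩ := h
  exact Mem.length_read _ _ _

theorem map_wire_range (m : Mem) (src w : ℕ) :
    (((List.range w).map fun i => Gate.wire (src + i)).map fun t => t.eval m) = m.read src w := by
  simp [Mem.read, Gate.wire, Gate.eval, Function.comp_def]

/-- Sequential composition. -/
theorem exists_comp (n L : ℕ) (A B : Prog) : ∃ A' : Prog, A'.size = A.size + B.size ∧
    ∀ (O : RO n) (s : List Bool), s.length ≤ L → A'.run O s = (A.run O s).bind (B.run O) := by
  obtain ⟨F₀, hF₀⟩ := exists_below n A.code
  set F := F₀ + L + A.out + A.outLen with hF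
  refine ⟨⟨A.code ++ (gateCode ((List.range A.outLen).map fun i => Gate.wire (A.out + i)) F ++
    B.code.map (Instr.shift F)), B.out + F, B.outLen⟩, ?_, fun O s hs => ?_⟩
  · simp only [size, List.map_append, List.sum_append, cost_gateCode, cost_map_shift,
      List.length_map, List.length_range]
    omega
  · simp only [run_eq, execAll_append, PMF.map_bind, PMF.bind_map]
    rw [Mem.ofInput_eq_splice (show s.length ≤ F by omega),
      execAll_splice O _ (fun i hi => (hF₀ i hi).mono (by omega)), PMF.bind_map, PMF.bind_map]
    congr 1
    funext m
    simp only [Function.comp_apply]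
    rw [execAll_gateCode, map_wire_range, Mem.read_splice_lo _ _ (by omega),
      Mem.splice_zero_write, PMF.pure_bind, execAll_shift, PMF.map_comp]
    · simp only [Function.comp_def, Mem.read_splice_add]
      rfl
    · intro t ht
      simp only [List.mem_map, List.mem_range] at ht
      obtain ⟨i, hi, rfl⟩ := ht
      simp only [Gate.wire]
      omega

/-- The program that evaluates gates on its input. -/
theorem exists_gates (n L : ℕ) (ts : List Gate) (h : ∀ t ∈ ts, t.2.1 < L ∧ t.2.2 < L) :
    ∃ A : Prog, A.size = 2 * ts.length ∧ ∀ (O : RO n) (s : List Bool),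
      A.run O s = PMF.pure (ts.map fun t => t.eval (Mem.ofInput s)) := by
  refine ⟨⟨gateCode ts L, L, ts.length⟩, ?_, fun O s => ?_⟩
  · simp [size, cost_gateCode]; omega
  · rw [run_eq, execAll_gateCode O h, PMF.pure_map]
    have := Mem.read_write (Mem.ofInput s) L (ts.map fun t => t.eval (Mem.ofInput s))
    rw [List.length_map] at this
    rw [this]

/-- Running a program while keeping its input. -/
theorem exists_keep (n L : ℕ) (A : Prog) :
    ∃ A' : Prog, A'.size ≤ 3 * L + 2 * A.size ∧ A'.outLen = L + A.outLen ∧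
    ∀ (O : RO n) (s : List Bool), s.length = L → A'.run O s = (A.run O s).map (s ++ ·) := by
  set G := L + A.out + A.outLen with hG
  set ts := (List.range L).map (fun i => Gate.wire (0 + i)) ++
    (List.range A.outLen).map (fun i => Gate.wire (A.out + L + i)) with hts
  refine ⟨⟨gateCode ((List.range L).map fun i => Gate.wire (0 + i)) L ++
    (A.code.map (Instr.shift L) ++ gateCode ts G), G, L + A.outLen⟩, ?_, rfl, fun O s hs => ?_⟩
  · simp only [size, List.map_append, List.sum_append, cost_gateCode, cost_map_shift, hts,
      List.length_append, List.length_map, List.length_range]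
    omega
  · simp only [run_eq, execAll_append, PMF.map_bind]
    have h0 : (Mem.ofInput s).read 0 L = s := by
      have := Mem.read_write (fun _ => false) 0 s
      rwa [Mem.write_zero_eq_ofInput, hs] at this
    rw [execAll_gateCode, map_wire_range, PMF.pure_bind, h0]
    conv_lhs => rw [Mem.ofInput_eq_splice (show s.length ≤ L by omega)]
    rw [Mem.splice_zero_write, execAll_shift,
      PMF.bind_map, PMF.map_comp, ← PMF.bind_pure_comp]
    · congr 1
      funext m
      simp only [Function.comp_apply]
      rw [execAll_gateCode, PMF.pure_map]
      · simp only [hts, List.map_append, map_wire_range]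
        rw [Mem.read_splice_lo _ _ (by omega), Mem.read_splice_add, h0]
        congr 1
        have := Mem.read_write (Mem.splice L (Mem.ofInput s) m) G (s ++ m.read A.out A.outLen)
        rw [List.length_append, hs, Mem.length_read] at this
        exact this
      · intro t ht
        simp only [hts, List.mem_append, List.mem_map, List.mem_range] at ht
        rcases ht with ⟨i, hi, rfl⟩ | ⟨i, hi, rfl⟩ <;> simp only [Gate.wire] <;> omega
    · intro t ht
      simp only [List.mem_map, List.mem_range] at ht
      obtain ⟨i, hi, rfl⟩ := ht
      simp only [Gate.wire]
      omega

theorem ofInput_eq_getElem {s : List Bool} {i : ℕ} (h : i < s.length) :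
    Mem.ofInput s i = s[i] := by simp [Mem.ofInput, h]

/-- Running two programs on the same input. -/
theorem exists_par (n L : ℕ) (A B : Prog) :
    ∃ A' : Prog, A'.size ≤ 10 * (L + A.size + B.size) ∧
    ∀ (O : RO n) (s : List Bool), s.length = L →
      A'.run O s = (A.run O s).bind fun a => (B.run O s).map fun b => a ++ b := by
  obtain ⟨A₁, hA₁, hA₁', hA₁r⟩ := exists_keep n L A
  obtain ⟨B₀, hB₀, hB₀r⟩ := exists_gates n (L + A.outLen)
    ((List.range L).map fun i => Gate.wire i) (by
      intro t ht
      simp only [List.mem_map, List.mem_range] at ht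
      obtain ⟨i, hi, rfl⟩ := ht
      simp only [Gate.wire]
      omega)
  obtain ⟨B₁, hB₁, hB₁r⟩ := exists_comp n (L + A.outLen) B₀ B
  obtain ⟨B₂, hB₂, hB₂', hB₂r⟩ := exists_keep n (L + A.outLen) B₁
  obtain ⟨C₁, hC₁, hC₁r⟩ := exists_comp n L A₁ B₂
  obtain ⟨D, hD, hDr⟩ := exists_gates n (L + A.outLen + B.outLen)
    ((List.range (A.outLen + B.outLen)).map fun i => Gate.wire (L + i)) (by
      intro t ht
      simp only [List.mem_map, List.mem_range] at ht
      obtain ⟨i, hi, rfl⟩ := ht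
      simp only [Gate.wire]
      omega)
  obtain ⟨A', hA', hA'r⟩ := exists_comp n L C₁ D
  have hAo : A.outLen ≤ A.size := by simp [size]
  have hBo : B.outLen ≤ B.size := by simp [size]
  refine ⟨A', ?_, fun O s hs => ?_⟩
  · simp only [List.length_map, List.length_range] at hB₀ hD
    omega
  · rw [hA'r O s hs.le, hC₁r O s hs.le, hA₁r O s hs, PMF.bind_map, PMF.bind_bind,
      ← PMF.bindOnSupport_eq_bind, ← PMF.bindOnSupport_eq_bind]
    congr 1
    funext a ha
    have hal := A.length_of_mem_run O s a ha
    simp only [Function.comp_apply]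
    have hsa : (s ++ a).length = L + A.outLen := by simp [hs, hal]
    have h0 : ((List.range L).map fun i => Gate.wire i).map
        (fun t => t.eval (Mem.ofInput (s ++ a))) = s := by
      apply List.ext_getElem
      · simp [hs]
      · intro i h1 h2
        have h3 : i < (s ++ a).length := by simp; omega
        simp only [List.getElem_map, List.getElem_range, Gate.wire, Gate.eval]
        rw [ofInput_eq_getElem h3, List.getElem_append_left]
    rw [hB₂r O _ hsa, hB₁r O _ hsa.le, hB₀r, h0, PMF.pure_bind, PMF.bind_map, ← PMF.bind_pure_comp,
      ← PMF.bindOnSupport_eq_bind, ← PMF.bindOnSupport_eq_bind]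
    congr 1
    funext b hb
    have hbl := B.length_of_mem_run O s b hb
    simp only [Function.comp_apply]
    rw [hDr]
    congr 1
    apply List.ext_getElem
    · simp [hal, hbl]
    · intro i h1 h2
      have h3 : L + i < (s ++ a ++ b).length := by simp at h2 ⊢; omega
      simp only [List.getElem_map, List.getElem_range, Gate.wire, Gate.eval]
      rw [ofInput_eq_getElem h3]
      simp only [List.append_assoc]
      rw [List.getElem_append_right (by omega)]
      simp [hs]

end Prog

/-! ### Uniform distributions -/

namespace PMF

theorem uniformOfFintype_map_equiv {α β : Type*} [Fintype α] [Nonempty α] [Fintype β] [Nonempty β]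
    (e : α ≃ β) : (uniformOfFintype α).map e = uniformOfFintype β := by
  ext b
  rw [map_apply, tsum_eq_single (e.symm b)]
  · simp [Fintype.card_congr e]
  · intro a ha
    rw [if_neg]
    rintro rfl
    simp at ha

/-- The law of a pair of independent random elements. -/
noncomputable def indep {α β : Type*} (p : PMF α) (q : PMF β) : PMF (α × β) :=
  p.bind fun a => q.map fun b => (a, b)

theorem indep_apply {α β : Type*} (p : PMF α) (q : PMF β) (x : α × β) :
    p.indep q x = p x.1 * q x.2 := by
  rw [indep, bind_apply, tsum_eq_single x.1]
  · rw [map_apply, tsum_eq_single x.2]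
    · simp
    · intro b hb
      rw [if_neg]
      exact fun h => hb (congrArg Prod.snd h).symm
  · intro a ha
    rw [map_apply, ENNReal.tsum_eq_zero.2, mul_zero]
    intro b
    rw [if_neg]
    exact fun h => ha (congrArg Prod.fst h).symm

theorem indep_uniformOfFintype {α β : Type*} [Fintype α] [Nonempty α] [Fintype β] [Nonempty β] :
    (uniformOfFintype α).indep (uniformOfFintype β) = uniformOfFintype (α × β) := by
  ext x
  rw [indep_apply]
  simp only [uniformOfFintype_apply, Fintype.card_prod, Nat.cast_mul]
  rw [ENNReal.mul_inv (by simp) (by simp)]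

theorem bind_indep {α β γ : Type*} (p : PMF α) (q : PMF β) (f : α × β → PMF γ) :
    (p.indep q).bind f = p.bind fun a => q.bind fun b => f (a, b) := by
  simp [indep, bind_bind, bind_map, Function.comp_def]

end PMF

/-! ### Coins -/

/-- Code that tosses `k` coins into consecutive registers. -/
def coinCode : ℕ → ℕ → List Instr
  | _, 0 => []
  | dst, k + 1 => .coin dst :: coinCode (dst + 1) k

theorem cost_coinCode (dst k : ℕ) : ((coinCode dst k).map Instr.cost).sum = k := by
  induction k generalizing dst with
  | zero => rfl
  | succ k ih => simp [coinCode, ih, Instr.cost]; omega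

theorem execAll_coinCode {n : ℕ} (O : RO n) (dst k : ℕ) (m : Mem) :
    execAll O (coinCode dst k) m =
      (PMF.uniformOfFintype (Bits k)).map fun a => m.write dst (List.ofFn a) := by
  induction k generalizing dst m with
  | zero =>
    simp only [coinCode, execAll, List.ofFn_zero, Mem.write_nil]
    exact (PMF.map_const _ _).symm
  | succ k ih =>
    rw [← PMF.uniformOfFintype_map_equiv (Fin.consEquiv fun _ : Fin (k + 1) => Bool),
      ← PMF.indep_uniformOfFintype, PMF.map_comp, ← PMF.bind_pure_comp, PMF.bind_indep]
    simp only [coinCode, execAll, Instr.exec, PMF.bind_map]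
    congr 1
    funext b
    simp only [Function.comp_apply, ih]
    rw [← PMF.bind_pure_comp]
    congr 1
    funext a
    simp [Mem.write_cons, List.ofFn_succ, Fin.consEquiv]

/-! ### The random oracle -/

/-- `X` depends only on the values of the oracle at strings of length at most `W`. -/
def DependsUpTo {n : ℕ} {α : Type*} (W : ℕ) (X : RO n → α) : Prop :=
  ∀ O O' : RO n, (∀ q : List Bool, q.length ≤ W → O q = O' q) → X O = X O'

namespace DependsUpTo

variable {n : ℕ} {α β : Type*} {W : ℕ}

theorem comp {X : RO n → α} (h : DependsUpTo W X) (g : α → β) : DependsUpTo W fun O => g (X O) :=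
  fun O O' hO => congrArg g (h O O' hO)

theorem measurable {X : RO n → ℝ≥0∞} (h : DependsUpTo W X) : Measurable X := by
  have hS : {q : List Bool | q.length ≤ W}.Finite := List.finite_length_le Bool W
  have : Finite {q : List Bool | q.length ≤ W} := hS
  let G : ({q : List Bool | q.length ≤ W} → Bits n) → ℝ≥0∞ := fun x =>
    X fun q => if hq : q.length ≤ W then x ⟨q, hq⟩ else fun _ => false
  have hG : X = G ∘ fun O q => O q.1 := by
    funext O
    apply h
    intro q hq
    simp [hq]
  rw [hG]
  exact (Measurable.of_discrete (f := G)).comp (by fun_prop)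

end DependsUpTo

/-- A program reads the oracle only at strings of bounded length, so that the probabilities of its
outputs are measurable functions of the oracle. -/
theorem exists_dependsUpTo_execAll (l : List Instr) : ∃ W, ∀ (n : ℕ) (m : Mem),
    DependsUpTo W fun O : RO n => execAll O l m := by
  induction l with
  | nil => exact ⟨0, fun n m O O' _ => rfl⟩
  | cons i l ih =>
    obtain ⟨W, hW⟩ := ih
    obtain ⟨W', hW'⟩ : ∃ W', ∀ (n : ℕ) (m : Mem), DependsUpTo W' fun O : RO n => i.exec O m := by
      cases i with
      | query w src dst =>
        refine ⟨w, fun n m O O' h => ?_⟩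
        simp only [Instr.exec]
        rw [h _ (Mem.length_read _ _ _).le]
      | _ => exact ⟨0, fun n m O O' _ => rfl⟩
    refine ⟨W + W', fun n m O O' h => ?_⟩
    simp only [execAll]
    have h1 : i.exec O m = i.exec O' m := hW' n m O O' fun q hq => h q (by omega)
    rw [h1]
    congr 1
    funext m'
    exact hW n m' O O' fun q hq => h q (by omega)

theorem Prog.exists_dependsUpTo_run (A : Prog) : ∃ W, ∀ (n : ℕ) (s : List Bool),
    DependsUpTo W fun O : RO n => A.run O s := by
  obtain ⟨W, hW⟩ := exists_dependsUpTo_execAll A.code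
  exact ⟨W, fun n s => (hW n _).comp _⟩

instance (n : ℕ) : IsProbabilityMeasure (roMeasure n) := by
  unfold roMeasure; infer_instance

/-- The values of the oracle are independent: the law of the oracle does not change when
its value at one string is sampled afresh. -/
theorem lintegral_roMeasure_update {n : ℕ} (k : List Bool) {F : RO n → ℝ≥0∞} (hF : Measurable F) :
    ∫⁻ O, F O ∂roMeasure n =
      ∑ a : Bits n, PMF.uniformOfFintype (Bits n) a *
        ∫⁻ O, F (Function.update O k a) ∂roMeasure n := by
  classical
  set μ : Measure (Bits n) := (PMF.uniformOfFintype (Bits n)).toMeasure with hμ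
  have hm : Measurable fun x : RO n × Bits n => Function.update x.1 k x.2 := by
    rw [measurable_pi_iff]
    intro q
    by_cases hq : q = k
    · subst hq; simpa using measurable_snd
    · simp only [Function.update_of_ne hq]
      exact (measurable_pi_apply q).comp measurable_fst
  have key : ((roMeasure n).prod μ).map (fun x => Function.update x.1 k x.2) = roMeasure n := by
    apply Measure.eq_infinitePi
    intro s t ht
    rw [Measure.map_apply hm (MeasurableSet.pi s.countable_toSet fun i _ => ht i)]
    have : (fun x : RO n × Bits n => Function.update x.1 k x.2) ⁻¹' (Set.pi s t) =
        (Set.pi (s.erase k : Finset _) t) ×ˢ (if k ∈ s then t k else Set.univ) := by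
      ext ⟨O, a⟩
      simp only [Set.mem_preimage, Set.mem_pi, Set.mem_prod, Finset.mem_coe, Finset.mem_erase]
      constructor
      · intro h
        refine ⟨fun i hi => by simpa [Function.update_of_ne hi.1] using h i hi.2, ?_⟩
        split_ifs with hk
        · simpa using h k hk
        · trivial
      · rintro ⟨h1, h2⟩ i hi
        by_cases hik : i = k
        · subst hik; simpa [hi] using h2
        · rw [Function.update_of_ne hik]; exact h1 i ⟨hik, hi⟩
    rw [this, Measure.prod_prod, roMeasure, Measure.infinitePi_pi _ fun i _ => ht i]
    split_ifs with hk
    · rw [mul_comm, Finset.mul_prod_erase s (fun i => μ (t i)) hk]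
    · rw [measure_univ, mul_one, Finset.erase_eq_of_notMem hk]
  conv_lhs => rw [← key]
  rw [lintegral_map hF hm, lintegral_prod_symm
    (fun x : RO n × Bits n => F (Function.update x.1 k x.2))
    (hF.comp hm).aemeasurable, lintegral_fintype]
  apply Finset.sum_congr rfl
  intro a _
  rw [hμ, PMF.toMeasure_apply_singleton _ _ (measurableSet_singleton a), mul_comm]

theorem lintegral_bind {n : ℕ} {α β : Type*} [Countable α] (p : PMF α) {X : α → RO n → PMF β}
    (b : β) (hX : ∀ a, Measurable fun O => X a O b) :
    ∫⁻ O, (p.bind fun a => X a O) b ∂roMeasure n = ∑' a, p a * ∫⁻ O, X a O b ∂roMeasure n := by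
  simp only [PMF.bind_apply]
  rw [lintegral_tsum fun a => ((hX a).const_mul _).aemeasurable]
  congr 1
  funext a
  rw [lintegral_const_mul _ (hX a)]

theorem Instr.exists_exec_eq_map {i : Instr} (hi : ¬ i.IsQuery) (m : Mem) :
    ∃ (α : Type) (_ : Countable α) (p : PMF α) (f : α → Mem),
      ∀ (n : ℕ) (O : RO n), i.exec O m = p.map f := by
  cases i with
  | gate f a b dst =>
    exact ⟨Unit, inferInstance, PMF.pure (), fun _ => m.write dst [f (m a) (m b)], fun n O => by
      rw [PMF.pure_map]; rfl⟩
  | coin dst => exact ⟨Bool, inferInstance, _, _, fun n O => rfl⟩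
  | unif w src dst =>
    by_cases h : (Finset.range (Nat.ofBits fun i : Fin w => m (src + i))).Nonempty
    · exact ⟨ℕ, inferInstance, PMF.uniformOfFinset _ h, fun a => m.write dst (natBits w a),
        fun n O => by simp only [exec]; rw [dif_pos h]⟩
    · exact ⟨Unit, inferInstance, PMF.pure (), fun _ => m, fun n O => by
        simp only [exec]; rw [dif_neg h, PMF.pure_map]⟩
  | query w src dst => exact absurd trivial hi

/-! ### Lazy sampling of the random oracle -/

namespace LazySampling

/-- A table entry: the width of a query, the first register of the query, and the first register of
the answer. -/
abbrev Entry : Type := ℕ × ℕ × ℕ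

/-- The oracle `O`, reprogrammed at the queries that are recorded in the memory `T`. -/
def overlay {n : ℕ} (O : RO n) (T : Mem) : List Entry → RO n
  | [] => O
  | e :: es => Function.update (overlay O T es) (T.read e.2.1 e.1) fun i => T (e.2.2 + i)

/-- Code that compares the `w`-bit strings from `a` and `b` on, with the result in `z`. -/
def eqCode (a b z : ℕ) : ℕ → List Instr
  | 0 => [.gate (fun _ _ => true) z z z]
  | w + 1 => eqCode a b z w ++
      [.gate (fun x y => x == y) (a + w) (b + w) (z + 1), .gate (fun x y => x && y) z (z + 1) z]

/-- Code that copies `k` bits from `a` to `b` if the register `z` contains `1`. -/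
def copyIfCode (a b z : ℕ) : ℕ → List Instr
  | 0 => []
  | k + 1 => copyIfCode a b z k ++
      [.gate (fun x y => x && y) z (a + k) (z + 1), .gate (fun x y => !x && y) z (b + k) (z + 2),
        .gate (fun x y => x || y) (z + 1) (z + 2) (b + k)]

/-- Code that replaces the answer from `ad` on to the `w`-bit query from `kd` on by the
recorded answer, if this query is recorded. -/
def lookupCode (n w kd ad z : ℕ) : List Entry → List Instr
  | [] => []
  | e :: es => lookupCode n w kd ad z es ++
      if e.1 = w then eqCode e.2.1 kd z w ++ copyIfCode e.2.2 ad z n else []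

theorem read_succ (m : Mem) (src w : ℕ) : m.read src (w + 1) = m.read src w ++ [m (src + w)] := by
  simp [Mem.read, List.range_succ]

theorem write_singleton_self (m : Mem) (d : ℕ) (b : Bool) : m.write d [b] d = b := by
  simp [Mem.write]

theorem write_singleton_of_ne (m : Mem) {d i : ℕ} (b : Bool) (h : i ≠ d) :
    m.write d [b] i = m i := by
  simp only [Mem.write, List.length_singleton]
  rw [if_neg]
  omega

theorem read_congr {m m' : Mem} {src w : ℕ} (h : ∀ i < w, m (src + i) = m' (src + i)) :
    m.read src w = m'.read src w :=
  List.map_congr_left fun i hi => h i (List.mem_range.1 hi)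

section

variable {n' : ℕ} (O' : RO n')

theorem execAll_eqCode (a b z w : ℕ) (ha : a + w ≤ z) (hb : b + w ≤ z) (T : Mem) :
    ∃ T' : Mem, execAll O' (eqCode a b z w) T = PMF.pure T' ∧ (∀ i < z, T' i = T i) ∧
      T' z = decide (T.read a w = T.read b w) := by
  induction w with
  | zero =>
    refine ⟨T.write z [true], by simp [eqCode, execAll, Instr.exec], fun i hi => ?_, ?_⟩
    · exact write_singleton_of_ne _ _ (by omega)
    · rw [write_singleton_self]; simp [Mem.read]
  | succ w ih =>
    obtain ⟨T₁, h1, h2, h3⟩ := ih (by omega) (by omega)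
    set T₂ := T₁.write (z + 1) [T₁ (a + w) == T₁ (b + w)] with hT₂
    refine ⟨T₂.write z [T₂ z && T₂ (z + 1)], ?_, fun i hi => ?_, ?_⟩
    · simp only [eqCode, execAll_append, h1, PMF.pure_bind, execAll, Instr.exec]
      rfl
    · rw [write_singleton_of_ne _ _ (by omega), hT₂, write_singleton_of_ne _ _ (by omega), h2 i hi]
    · rw [write_singleton_self, hT₂, write_singleton_self, write_singleton_of_ne _ _ (by omega), h3,
        h2 _ (by omega), h2 _ (by omega), read_succ, read_succ, Bool.eq_iff_iff]
      simp only [Bool.and_eq_true, decide_eq_true_eq, beq_iff_eq]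
      constructor
      · rintro ⟨h, h'⟩; rw [h, h']
      · intro h
        have := List.append_inj h (by simp [Mem.length_read])
        simpa using this

theorem execAll_copyIfCode (a b z k : ℕ) (ha : a + k ≤ b) (hb : b + k ≤ z) (T : Mem) :
    ∃ T' : Mem, execAll O' (copyIfCode a b z k) T = PMF.pure T' ∧ (∀ i < b, T' i = T i) ∧
      (∀ i, b + k ≤ i → i ≤ z → T' i = T i) ∧
      ∀ i < k, T' (b + i) = if T z then T (a + i) else T (b + i) := by
  induction k with
  | zero => exact ⟨T, by simp [copyIfCode, execAll], by simp, by simp, by simp⟩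
  | succ k ih =>
    obtain ⟨T₁, h1, h2, h3, h4⟩ := ih (by omega) (by omega)
    set T₂ := T₁.write (z + 1) [T₁ z && T₁ (a + k)] with hT₂
    set T₃ := T₂.write (z + 2) [!T₂ z && T₂ (b + k)] with hT₃
    refine ⟨T₃.write (b + k) [T₃ (z + 1) || T₃ (z + 2)], ?_, fun i hi => ?_, fun i hi hi' => ?_,
      fun i hi => ?_⟩
    · simp only [copyIfCode, execAll_append, h1, PMF.pure_bind, execAll, Instr.exec]
      rfl
    · rw [write_singleton_of_ne _ _ (by omega), hT₃, write_singleton_of_ne _ _ (by omega), hT₂,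
        write_singleton_of_ne _ _ (by omega), h2 i hi]
    · rw [write_singleton_of_ne _ _ (by omega), hT₃, write_singleton_of_ne _ _ (by omega), hT₂,
        write_singleton_of_ne _ _ (by omega), h3 i (by omega) hi']
    · rcases Nat.lt_succ_iff_lt_or_eq.1 hi with hi | rfl
      · rw [write_singleton_of_ne _ _ (by omega), hT₃, write_singleton_of_ne _ _ (by omega), hT₂,
          write_singleton_of_ne _ _ (by omega), h4 i hi]
      · rw [write_singleton_self, hT₃, write_singleton_of_ne _ _ (by omega), write_singleton_self,
          hT₂, write_singleton_self, write_singleton_of_ne _ _ (by omega),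
          write_singleton_of_ne _ _ (by omega), h3 z (by omega) le_rfl,
          h3 (b + i) le_rfl (by omega),
          h2 _ (by omega)]
        cases T z <;> simp

theorem execAll_lookupCode (n w kd ad z : ℕ) (hkd : kd + w ≤ ad) (hz : ad + n ≤ z)
    (es : List Entry) (hes : ∀ e ∈ es, e.2.1 + e.1 ≤ kd ∧ e.2.2 + n ≤ kd) (T : Mem) :
    ∃ T' : Mem, execAll O' (lookupCode n w kd ad z es) T = PMF.pure T' ∧ (∀ i < ad, T' i = T i) ∧
      ∀ i : Fin n, T' (ad + i) =
        overlay (fun _ (i : Fin n) => T (ad + i)) T es (T.read kd w) i := by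
  induction es with
  | nil => exact ⟨T, by simp [lookupCode, execAll], by simp, by simp [overlay]⟩
  | cons e es ih =>
    obtain ⟨T₁, h1, h2, h3⟩ := ih fun e' he' => hes e' (by simp [he'])
    have he := hes e (by simp)
    simp only [lookupCode, execAll_append, h1, PMF.pure_bind, overlay]
    by_cases hw : e.1 = w
    · obtain ⟨T₂, h4, h5, h6⟩ := execAll_eqCode O' e.2.1 kd z w (by omega) (by omega) T₁
      obtain ⟨T₃, h7, h8, -, h9⟩ :=
        execAll_copyIfCode O' e.2.2 ad z n (by omega) (by omega) T₂
      refine ⟨T₃, by rw [if_pos hw, execAll_append, h4, PMF.pure_bind, h7], fun i hi => ?_,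
        fun i => ?_⟩
      · rw [h8 i hi, h5 i (by omega), h2 i hi]
      · have hi := i.2
        rw [h9 i i.2, h6, h5 _ (by omega), h5 _ (by omega), h3, h2 _ (by omega),
          read_congr (m := T₁) (m' := T) (src := e.2.1) fun i hi => h2 _ (by omega),
          read_congr (m := T₁) (m' := T) (src := kd) fun i hi => h2 _ (by omega), ← hw]
        by_cases h : T.read e.2.1 e.1 = T.read kd e.1
        · rw [if_pos (decide_eq_true h), h, Function.update_self]
        · rw [if_neg (by simpa using h), Function.update_of_ne (Ne.symm h)]
    · refine ⟨T₁, by rw [if_neg hw]; rfl, h2, fun i => ?_⟩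
      rw [h3, Function.update_of_ne]
      intro h
      have := congrArg List.length h
      simp only [Mem.length_read] at this
      exact hw this.symm

end

/-- Resampling the oracle changes the overlaid oracle only at strings that are not in the table. -/
theorem overlay_update {n : ℕ} (O : RO n) (T : Mem) (es : List Entry) (q : List Bool)
    (a : Bits n) :
    overlay (Function.update O q a) T es =
      Function.update (overlay O T es) q (overlay (fun _ => a) T es q) := by
  induction es with
  | nil => rfl
  | cons e es ih =>
    simp only [overlay, ih]
    by_cases h : q = T.read e.2.1 e.1
    · rw [h, Function.update_idem, Function.update_self, Function.update_idem]
    · rw [Function.update_comm (Ne.symm h), Function.update_of_ne h]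

theorem overlay_congr {n : ℕ} (O : RO n) {T T' : Mem} {F : ℕ} (h : ∀ i < F, T' i = T i)
    (es : List Entry) (hes : ∀ e ∈ es, e.2.1 + e.1 ≤ F ∧ e.2.2 + n ≤ F) :
    overlay O T' es = overlay O T es := by
  induction es with
  | nil => rfl
  | cons e es ih =>
    have he := hes e (by simp)
    simp only [overlay]
    rw [ih fun e' he' => hes e' (by simp [he']),
      read_congr (m := T') (m' := T) fun i hi => h _ (by omega)]
    congr 1
    funext i
    exact h _ (by omega)

theorem dependsUpTo_overlay {n : ℕ} {α : Type*} {W : ℕ} {X : RO n → α} (hX : DependsUpTo W X)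
    (T : Mem) (es : List Entry) : DependsUpTo W fun O => X (overlay O T es) := by
  intro O O' h
  apply hX
  induction es with
  | nil => exact h
  | cons e es ih =>
    intro q hq
    simp only [overlay]
    by_cases hqe : q = T.read e.2.1 e.1
    · rw [hqe, Function.update_self, Function.update_self]
    · rw [Function.update_of_ne hqe, Function.update_of_ne hqe, ih q hq]

/-- The code that replaces a query. -/
def queryCode (n M w src dst : ℕ) (es : List Entry) (F : ℕ) : List Instr :=
  gateCode ((List.range w).map fun i => Gate.wire (src + i)) (F + M) ++
    ((coinCode (F + w) n ++ lookupCode n w F (F + w) (F + w + n) es).map (Instr.shift M) ++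
    gateCode ((List.range n).map fun i => Gate.wire (F + w + M + i)) dst)

/-- Code in which each query of the given code is replaced by fresh coins, or by an earlier answer
if the query is not new. The table of answers lies above the register `M`, with `F` registers
in use. -/
def lazyCode (n M : ℕ) : List Instr → List Entry → ℕ → List Instr
  | [], _, _ => []
  | .query w src dst :: l, es, F =>
      queryCode n M w src dst es F ++ lazyCode n M l ((w, F, F + w) :: es) (F + w + n)
  | i :: l, es, F => i :: lazyCode n M l es F

/-- The code for a query draws a fresh answer `a`, replaces it by the recorded answer if there is
one, and extends the table. -/
theorem execAll_queryCode {n n' M w src dst : ℕ} (O' : RO n') (hsrc : src + w ≤ M)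
    (hdst : dst + n ≤ M) (es : List Entry) (F : ℕ)
    (hes : ∀ e ∈ es, e.2.1 + e.1 ≤ F ∧ e.2.2 + n ≤ F) (m T : Mem) :
    ∃ T' : Bits n → Mem,
      execAll O' (queryCode n M w src dst es F) (Mem.splice M m T) =
        (PMF.uniformOfFintype (Bits n)).map (fun a => Mem.splice M
          (m.write dst (List.ofFn (overlay (fun _ => a) T es (m.read src w)))) (T' a)) ∧
      ∀ a, (∀ i < F, T' a i = T i) ∧ (T' a).read F w = m.read src w ∧
        ∀ i : Fin n, T' a (F + w + i) = overlay (fun _ => a) T es (m.read src w) i := by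
  set q := m.read src w with hq
  set T₁ := T.write F q with hT₁
  have hqw : q.length = w := Mem.length_read _ _ _
  have hT₁F : ∀ i < F, T₁ i = T i := fun i hi => Mem.write_of_lt _ _ _ hi
  have hT₁q : T₁.read F w = q := by
    have := Mem.read_write T F q
    rwa [hqw] at this
  choose T' h1 h2 h3 using fun a : Bits n => execAll_lookupCode O' n w F (F + w) (F + w + n) le_rfl
    le_rfl es hes (T₁.write (F + w) (List.ofFn a))
  have hlow : ∀ (a : Bits n), ∀ i < F, T₁.write (F + w) (List.ofFn a) i = T i := fun a i hi => by
    rw [Mem.write_of_lt _ _ _ (by omega), hT₁F i hi]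
  have hans : ∀ (a : Bits n) (i : Fin n),
      T' a (F + w + i) = overlay (fun _ => a) T es q i := by
    intro a i
    rw [h3, Mem.read_write_of_le _ _ _ _ _ le_rfl, hT₁q, overlay_congr _ (hlow a) es hes]
    congr 2
    funext _ i
    simp [Mem.write]
  refine ⟨T', ?_, fun a => ⟨fun i hi => ?_, ?_, hans a⟩⟩
  · simp only [queryCode, execAll_append]
    rw [execAll_gateCode _ (fun t ht => by
        simp only [List.mem_map, List.mem_range] at ht
        obtain ⟨i, hi, rfl⟩ := ht
        simp only [Gate.wire]; omega), Prog.map_wire_range, Mem.read_splice_lo _ _ hsrc,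
      PMF.pure_bind, Mem.write_splice_add, execAll_append, execAll_shift, execAll_append,
      execAll_coinCode,
      PMF.bind_map, PMF.bind_map, PMF.bind_bind, ← PMF.bind_pure_comp]
    congr 1
    funext a
    simp only [Function.comp_apply]
    rw [h1, PMF.pure_bind]
    simp only [Function.comp_apply]
    rw [execAll_gateCode_of_disjoint _ (fun t ht => by
        simp only [List.mem_map, List.mem_range] at ht
        obtain ⟨i, hi, rfl⟩ := ht
        simp only [Gate.wire, List.length_map, List.length_range]; omega), Prog.map_wire_range,
      Mem.read_splice_add, Mem.write_splice_lo _ _ (by rw [Mem.length_read]; omega)]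
    congr 3
    apply List.ext_getElem
    · simp [Mem.read]
    · intro i hi1 hi2
      simp only [List.length_ofFn] at hi2
      simpa [Mem.read] using hans a ⟨i, hi2⟩
  · rw [h2 a i (by omega), hlow a i hi]
  · rw [read_congr (m := T' a) (m' := T₁), hT₁q]
    intro i hi
    rw [h2 a _ (by omega), Mem.write_of_lt _ _ _ (by omega)]

/-- The invariant of lazy sampling: the memory `T` beyond the register `M` contains the table `es`
of the answers so far, and the remaining program runs with the oracle that agrees with this table.
-/
theorem map_execAll_lazyCode {n n' M out k : ℕ} (O' : RO n') (hout : out + k ≤ M) (o : List Bool)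
    (l : List Instr) (hl : ∀ i ∈ l, i.Below n M) (es : List Entry) (F : ℕ)
    (hes : ∀ e ∈ es, e.2.1 + e.1 ≤ F ∧ e.2.2 + n ≤ F) (m T : Mem) :
    ((execAll O' (lazyCode n M l es F) (Mem.splice M m T)).map fun m => m.read out k) o =
      ∫⁻ O, ((execAll (overlay O T es) l m).map fun m => m.read out k) o ∂roMeasure n := by
  induction l generalizing es F m T with
  | nil =>
    simp [lazyCode, execAll, PMF.pure_map, Mem.read_splice_lo _ _ hout]
  | cons i l ih =>
    have hl' : ∀ i ∈ l, i.Below n M := fun j hj => hl j (by simp [hj])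
    have hi := hl i (by simp)
    obtain ⟨W, hW⟩ := exists_dependsUpTo_execAll (i :: l)
    have hmeas : ∀ m : Mem, Measurable fun O : RO n =>
        ((execAll (overlay O T es) (i :: l) m).map fun m => m.read out k) o := fun m =>
      ((dependsUpTo_overlay (hW n m) T es).comp fun p => (p.map fun m => m.read out k) o).measurable
    obtain ⟨W', hW'⟩ := exists_dependsUpTo_execAll l
    have hmeas' : ∀ m : Mem, Measurable fun O : RO n =>
        ((execAll (overlay O T es) l m).map fun m => m.read out k) o := fun m =>
      ((dependsUpTo_overlay (hW' n m) T es).comp fun p =>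
        (p.map fun m => m.read out k) o).measurable
    by_cases hq : i.IsQuery
    · cases i with
      | query w src dst =>
        simp only [Instr.Below] at hi
        obtain ⟨T', hT', h⟩ := execAll_queryCode O' hi.1 hi.2 es F hes m T
        rw [lintegral_roMeasure_update (m.read src w) (hmeas m)]
        simp only [lazyCode, execAll_append]
        rw [hT', PMF.bind_map, PMF.map_bind, PMF.bind_apply, tsum_fintype]
        apply Finset.sum_congr rfl
        intro a _
        obtain ⟨h1, h2, h3⟩ := h a
        have hes' : ∀ e ∈ (w, F, F + w) :: es, e.2.1 + e.1 ≤ F + w + n ∧ e.2.2 + n ≤ F + w + n := by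
          intro e he
          rcases List.mem_cons.1 he with rfl | he
          · simp only; omega
          · have := hes e he; omega
        simp only [Function.comp_apply]
        rw [ih hl' _ _ hes']
        congr 2
        funext O
        have hO : overlay (Function.update O (m.read src w) a) T es =
            overlay O (T' a) ((w, F, F + w) :: es) := by
          rw [overlay_update]
          simp only [overlay]
          rw [h2, overlay_congr O h1 es hes]
          congr 1
          funext i
          exact (h3 i).symm
        rw [hO]
        simp only [execAll, Instr.exec, PMF.pure_bind]
        rw [← hO, overlay_update, Function.update_self]
      | _ => exact absurd hq id
    · have hlc : lazyCode n M (i :: l) es F = i :: lazyCode n M l es F := by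
        cases i with
        | query w src dst => exact absurd trivial hq
        | _ => rfl
      have hi' : i.Below n' M := by
        cases i with
        | query w src dst => exact absurd trivial hq
        | _ => exact hi
      obtain ⟨α, _, p, f, hp⟩ := i.exists_exec_eq_map hq m
      rw [hlc]
      simp only [execAll]
      rw [Instr.exec_splice O' T m hi', hp, PMF.map_comp, PMF.bind_map, PMF.map_bind]
      simp only [hp, PMF.bind_map, PMF.map_bind, Function.comp_apply]
      rw [lintegral_bind p o fun a => hmeas' (f a), PMF.bind_apply]
      congr 1
      funext a
      rw [ih hl' es F hes]

theorem isQuery_shift (F : ℕ) (i : Instr) : (i.shift F).IsQuery ↔ i.IsQuery := by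
  cases i <;> rfl

theorem not_isQuery_of_mem_gateCode {ts : List Gate} {dst : ℕ} {i : Instr}
    (h : i ∈ gateCode ts dst) : ¬ i.IsQuery := by
  induction ts generalizing dst with
  | nil => simp [gateCode] at h
  | cons t ts ih =>
    rcases List.mem_cons.1 h with rfl | h
    · exact id
    · exact ih h

theorem not_isQuery_of_mem_coinCode {dst k : ℕ} {i : Instr} (h : i ∈ coinCode dst k) :
    ¬ i.IsQuery := by
  induction k generalizing dst with
  | zero => simp [coinCode] at h
  | succ k ih =>
    rcases List.mem_cons.1 h with rfl | h
    · exact id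
    · exact ih h

theorem not_isQuery_of_mem_eqCode {a b z w : ℕ} {i : Instr} (h : i ∈ eqCode a b z w) :
    ¬ i.IsQuery := by
  induction w with
  | zero => simp only [eqCode, List.mem_singleton] at h; subst h; exact id
  | succ w ih =>
    rcases List.mem_append.1 h with h | h
    · exact ih h
    · simp only [List.mem_cons, List.not_mem_nil, or_false] at h
      rcases h with rfl | rfl <;> exact id

theorem not_isQuery_of_mem_copyIfCode {a b z k : ℕ} {i : Instr} (h : i ∈ copyIfCode a b z k) :
    ¬ i.IsQuery := by
  induction k with
  | zero => simp [copyIfCode] at h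
  | succ k ih =>
    rcases List.mem_append.1 h with h | h
    · exact ih h
    · simp only [List.mem_cons, List.not_mem_nil, or_false] at h
      rcases h with rfl | rfl | rfl <;> exact id

theorem not_isQuery_of_mem_lookupCode {n w kd ad z : ℕ} {es : List Entry} {i : Instr}
    (h : i ∈ lookupCode n w kd ad z es) : ¬ i.IsQuery := by
  induction es with
  | nil => simp [lookupCode] at h
  | cons e es ih =>
    rcases List.mem_append.1 h with h | h
    · exact ih h
    · split_ifs at h with hw
      · rcases List.mem_append.1 h with h | h
        · exact not_isQuery_of_mem_eqCode h
        · exact not_isQuery_of_mem_copyIfCode h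
      · simp at h

theorem not_isQuery_of_mem_lazyCode {n M : ℕ} {l : List Instr} {es : List Entry} {F : ℕ}
    {i : Instr} (h : i ∈ lazyCode n M l es F) : ¬ i.IsQuery := by
  induction l generalizing es F with
  | nil => simp [lazyCode] at h
  | cons j l ih =>
    by_cases hj : j.IsQuery
    · cases j with
      | query w src dst =>
        simp only [lazyCode, queryCode, List.mem_append, List.mem_map] at h
        rcases h with (h | ⟨j, h | h, rfl⟩ | h) | h
        · exact not_isQuery_of_mem_gateCode h
        · rw [isQuery_shift]; exact not_isQuery_of_mem_coinCode h
        · rw [isQuery_shift]; exact not_isQuery_of_mem_lookupCode h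
        · exact not_isQuery_of_mem_gateCode h
        · exact ih h
      | _ => exact absurd hj id
    · have hlc : lazyCode n M (j :: l) es F = j :: lazyCode n M l es F := by
        cases j with
        | query w src dst => exact absurd trivial hj
        | _ => rfl
      rw [hlc] at h
      rcases List.mem_cons.1 h with rfl | h
      · exact hj
      · exact ih h

theorem cost_eqCode (a b z w : ℕ) : ((eqCode a b z w).map Instr.cost).sum = 2 * w + 1 := by
  induction w with
  | zero => rfl
  | succ w ih => simp [eqCode, ih, Instr.cost]; omega

theorem cost_copyIfCode (a b z k : ℕ) : ((copyIfCode a b z k).map Instr.cost).sum = 3 * k := by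
  induction k with
  | zero => rfl
  | succ k ih => simp [copyIfCode, ih, Instr.cost]; omega

theorem cost_lookupCode_le (n w kd ad z : ℕ) (es : List Entry) :
    ((lookupCode n w kd ad z es).map Instr.cost).sum ≤ es.length * (2 * w + 1 + 3 * n) := by
  induction es with
  | nil => simp [lookupCode]
  | cons e es ih =>
    simp only [lookupCode, List.map_append, List.sum_append, List.length_cons, add_mul, one_mul]
    gcongr
    split_ifs
    · simp [cost_eqCode, cost_copyIfCode]
    · simp

theorem cost_lazyCode_le (n M Q : ℕ) (l : List Instr) (es : List Entry) (F : ℕ)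
    (hQ : es.length + l.length ≤ Q) :
    ((lazyCode n M l es F).map Instr.cost).sum ≤
      (l.map Instr.cost).sum * (3 * (n + 1) * (Q + 1)) := by
  induction l generalizing es F with
  | nil => simp [lazyCode]
  | cons i l ih =>
    rw [List.length_cons] at hQ
    simp only [List.map_cons, List.sum_cons, add_mul]
    by_cases hi : i.IsQuery
    · cases i with
      | query w src dst =>
        simp only [lazyCode, queryCode, List.map_append, List.sum_append, cost_gateCode,
          cost_map_shift, cost_coinCode, List.length_map, List.length_range, ← add_assoc,
          Instr.cost]
        refine add_le_add ?_ (ih _ _ (by simp; omega))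
        have h1 := cost_lookupCode_le n w F (F + w) (F + w + n) es
        have h2 : es.length * (2 * w + 1 + 3 * n) ≤ Q * (2 * w + 1 + 3 * n) :=
          Nat.mul_le_mul_right _ (by omega)
        have h3 : (w + 1) * (3 * (n + 1) * (Q + 1)) = w + n + n + Q * (2 * w + 1 + 3 * n) +
          (3 * w * n * Q + 3 * w * n + w * Q + 2 * w + n + 2 * Q + 3) := by ring
        omega
      | _ => exact absurd hi id
    · have hlc : lazyCode n M (i :: l) es F = i :: lazyCode n M l es F := by
        cases i with
        | query w src dst => exact absurd trivial hi
        | _ => rfl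
      rw [hlc, List.map_cons, List.sum_cons]
      exact add_le_add (Nat.le_mul_of_pos_right _ (by positivity)) (ih _ _ (by omega))

end LazySampling

/-- An oracle program can be simulated without an oracle, in polynomial time: the simulating program
samples the answers to new queries as they come up. -/
theorem Prog.exists_lazy (n : ℕ) (A : Prog) : ∃ A' : Prog, A'.NoQuery ∧
    A'.size ≤ 3 * (n + 1) * (A.size + 1) ^ 2 ∧
    ∀ (n' : ℕ) (O' : RO n') (s o : List Bool),
      A'.run O' s o = ∫⁻ O, A.run O s o ∂roMeasure n := by
  obtain ⟨M, hM⟩ := exists_below n A.code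
  set M' := M + A.out + A.outLen with hM'
  refine ⟨⟨LazySampling.lazyCode n M' A.code [] 0, A.out, A.outLen⟩,
    fun i hi => LazySampling.not_isQuery_of_mem_lazyCode hi, ?_, fun n' O' s o => ?_⟩
  · have h := LazySampling.cost_lazyCode_le n M' A.size A.code [] 0 (by
      have := length_le_cost A.code
      simp [size]; omega)
    simp only [size] at h ⊢
    set c := (A.code.map Instr.cost).sum
    calc _ ≤ c * (3 * (n + 1) * (c + A.outLen + 1)) +
          A.outLen * (3 * (n + 1) * (c + A.outLen + 1)) :=
        add_le_add h (Nat.le_mul_of_pos_right _ (by positivity))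
      _ ≤ 3 * (n + 1) * (c + A.outLen + 1) ^ 2 := by nlinarith [Nat.zero_le n]
  · rw [run_eq]
    have h : Mem.ofInput s = Mem.splice M' (Mem.ofInput s) fun i => Mem.ofInput s (i + M') := by
      funext i
      unfold Mem.splice
      split_ifs with hi
      · rfl
      · simp only
        rw [Nat.sub_add_cancel (by omega)]
    dsimp only
    rw [h, LazySampling.map_execAll_lazyCode O' (by omega) o A.code
      (fun i hi => (hM i hi).mono (by omega)) [] 0 (by simp)]
    rfl

/-! ### Polynomial bounds -/

namespace PolyBounded

theorem mono {f g : ℕ → ℕ} (hg : PolyBounded g) (h : ∀ lam, f lam ≤ g lam) : PolyBounded f := by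
  obtain ⟨q, hq⟩ := hg
  exact ⟨q, fun lam => (h lam).trans (hq lam)⟩

theorem const (c : ℕ) : PolyBounded fun _ => c := ⟨Polynomial.C c, by simp⟩

theorem id : PolyBounded _root_.id := ⟨Polynomial.X, by simp⟩

theorem add {f g : ℕ → ℕ} (hf : PolyBounded f) (hg : PolyBounded g) :
    PolyBounded fun lam => f lam + g lam := by
  obtain ⟨p, hp⟩ := hf
  obtain ⟨q, hq⟩ := hg
  exact ⟨p + q, fun lam => by rw [Polynomial.eval_add]; exact add_le_add (hp lam) (hq lam)⟩

theorem mul {f g : ℕ → ℕ} (hf : PolyBounded f) (hg : PolyBounded g) :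
    PolyBounded fun lam => f lam * g lam := by
  obtain ⟨p, hp⟩ := hf
  obtain ⟨q, hq⟩ := hg
  exact ⟨p * q, fun lam => by rw [Polynomial.eval_mul]; exact Nat.mul_le_mul (hp lam) (hq lam)⟩

theorem ordLen : PolyBounded ordLen :=
  ((const 2).add id).mono fun lam => by simp only [_root_.ordLen, _root_.id]; omega

end PolyBounded

theorem PolySize.outLen {A : ℕ → Prog} (hA : PolySize A) : PolyBounded fun lam => (A lam).outLen :=
  hA.mono fun _ => Nat.le_add_left _ _

/-! ### Programs without queries -/

theorem Instr.exec_eq_of_not_isQuery {n n' : ℕ} (O : RO n) (O' : RO n') {i : Instr}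
    (hi : ¬ i.IsQuery) (m : Mem) : i.exec O m = i.exec O' m := by
  obtain ⟨α, _, p, f, hp⟩ := i.exists_exec_eq_map hi m
  rw [hp, hp]

theorem execAll_eq_of_not_isQuery {n n' : ℕ} (O : RO n) (O' : RO n') {l : List Instr}
    (hl : ∀ i ∈ l, ¬ i.IsQuery) (m : Mem) : execAll O l m = execAll O' l m := by
  induction l generalizing m with
  | nil => rfl
  | cons i l ih =>
    simp only [execAll]
    rw [Instr.exec_eq_of_not_isQuery O O' (hl i (by simp))]
    congr 1
    funext m'
    exact ih (fun j hj => hl j (by simp [hj])) m'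

theorem Prog.NoQuery.run_eq_runPlain {n : ℕ} {A : Prog} (hA : A.NoQuery) (O : RO n)
    (s : List Bool) : A.run O s = A.runPlain s := by
  unfold Prog.runPlain Prog.run
  rw [execAll_eq_of_not_isQuery O _ hA]

/-! ### Families of strings, and their polynomial-time computation -/

/-- A family of strings, of polynomial length, that depend on the oracle and on an index `i`. -/
structure Fld (n : ℕ → ℕ) (ι : ℕ → Type) where
  val : ∀ lam, RO (n lam) → ι lam → List Bool
  len : ℕ → ℕ
  length_val : ∀ lam O i, (val lam O i).length = len lam
  poly : PolyBounded len

namespace Fld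

variable {n : ℕ → ℕ} {ι ι' : ℕ → Type}

/-- The empty string. -/
def nil : Fld n ι := ⟨fun _ _ _ => [], fun _ => 0, by simp, .const 0⟩

/-- Concatenation. -/
def append (f g : Fld n ι) : Fld n ι where
  val lam O i := f.val lam O i ++ g.val lam O i
  len lam := f.len lam + g.len lam
  length_val lam O i := by rw [List.length_append, f.length_val, g.length_val]
  poly := f.poly.add g.poly

/-- Concatenation of a list of families. -/
def cat : List (Fld n ι) → Fld n ι
  | [] => nil
  | f :: l => f.append (cat l)

/-- Reindexing. -/
def comap (φ : ∀ lam, ι' lam → ι lam) (f : Fld n ι) : Fld n ι' where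
  val lam O i := f.val lam O (φ lam i)
  len := f.len
  length_val _ _ _ := f.length_val _ _ _
  poly := f.poly

/-- A single bit. -/
def bit (b : ∀ lam, ι lam → Bool) : Fld n ι :=
  ⟨fun lam _ i => [b lam i], fun _ => 1, by simp, .const 1⟩

/-- A string that does not depend on the index. -/
def fixed (c : ℕ → List Bool) (hc : PolyBounded fun lam => (c lam).length) : Fld n ι :=
  ⟨fun lam _ _ => c lam, fun lam => (c lam).length, by simp, hc⟩

/-- The binary digits of a number, as many as the group order has. -/
def digits (e : ∀ lam, ι lam → ℕ) : Fld n ι :=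
  ⟨fun lam _ i => natBits (ordLen lam) (e lam i), ordLen, by simp [natBits], .ordLen⟩

/-- The bit string of a function on `Fin (k lam)`. -/
def bits {k : ℕ → ℕ} (hk : PolyBounded k) (b : ∀ lam, RO (n lam) → ι lam → Bits (k lam)) :
    Fld n ι :=
  ⟨fun lam O i => List.ofFn (b lam O i), k, by simp, hk⟩

/-- The answer of the oracle. -/
def answer (hn : PolyBounded n) (f : Fld n ι) : Fld n ι :=
  bits hn fun lam O i => O (f.val lam O i)

end Fld

/-- Polynomial-size programs with output law `K`, on inputs from the family `src`. -/
def Impl {n : ℕ → ℕ} {ι : ℕ → Type} (src : Fld n ι)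
    (K : ∀ lam, RO (n lam) → ι lam → PMF (List Bool)) : Prop :=
  ∃ A : ℕ → Prog, PolySize A ∧ ∀ lam O i, (A lam).run O (src.val lam O i) = K lam O i

/-- The family `f` can be computed from the family `src` in polynomial time. -/
def Det {n : ℕ → ℕ} {ι : ℕ → Type} (src f : Fld n ι) : Prop :=
  Impl src fun lam O i => PMF.pure (f.val lam O i)

section

variable {n : ℕ → ℕ} {ι ι' : ℕ → Type} {src f g : Fld n ι}
  {K : ∀ lam, RO (n lam) → ι lam → PMF (List Bool)}

theorem Impl.congr {K' : ∀ lam, RO (n lam) → ι lam → PMF (List Bool)} (h : Impl src K)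
    (hK : ∀ lam O i, K' lam O i = K lam O i) : Impl src K' := by
  obtain ⟨A, hA, hAr⟩ := h
  exact ⟨A, hA, fun lam O i => by rw [hK, hAr]⟩

theorem Det.congr (h : Det src f) (hf : ∀ lam O i, g.val lam O i = f.val lam O i) : Det src g :=
  Impl.congr h fun lam O i => by rw [hf]

theorem Impl.comap (h : Impl src K) (φ : ∀ lam, ι' lam → ι lam) :
    Impl (src.comap φ) fun lam O i => K lam O (φ lam i) := by
  obtain ⟨A, hA, hAr⟩ := h
  exact ⟨A, hA, fun lam O _ => hAr lam O _⟩

theorem Impl.post {M : ℕ → Prog} (h : Impl src K) (hM : PolySize M) :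
    Impl src fun lam O i => (K lam O i).bind ((M lam).run O) := by
  obtain ⟨A, hA, hAr⟩ := h
  choose C hC hCr using fun lam => Prog.exists_comp (n lam) (src.len lam) (A lam) (M lam)
  refine ⟨C, (hA.add hM).mono fun lam => (hC lam).le, fun lam O i => ?_⟩
  rw [hCr lam O _ (src.length_val lam O i).le, hAr]

/-- Sampling in two stages; the second stage depends on the outcome of the first. -/
theorem Impl.bind {τ : ∀ lam, ι lam → Type} {Q : ∀ lam, RO (n lam) → (i : ι lam) → PMF (τ lam i)}
    {src' : Fld n fun lam => Σ i : ι lam, τ lam i}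
    {K' : ∀ lam, RO (n lam) → (Σ i : ι lam, τ lam i) → PMF (List Bool)}
    (h : Impl src fun lam O i => (Q lam O i).map fun q => src'.val lam O ⟨i, q⟩)
    (h' : Impl src' K') :
    Impl src fun lam O i => (Q lam O i).bind fun q => K' lam O ⟨i, q⟩ := by
  obtain ⟨M, hM, hMr⟩ := h'
  refine (h.post hM).congr fun lam O i => ?_
  rw [PMF.bind_map]
  congr 1
  funext q
  exact (hMr lam O ⟨i, q⟩).symm

theorem Det.impl (h : Det src f) (h' : Impl f K) : Impl src K := by
  obtain ⟨M, hM, hMr⟩ := h'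
  refine (h.post hM).congr fun lam O i => ?_
  rw [PMF.pure_bind, hMr]

theorem Det.trans (h : Det src f) (h' : Det f g) : Det src g := h.impl h'

theorem Impl.par {K' : ∀ lam, RO (n lam) → ι lam → PMF (List Bool)} (h : Impl src K)
    (h' : Impl src K') :
    Impl src fun lam O i => (K lam O i).bind fun a => (K' lam O i).map fun b => a ++ b := by
  obtain ⟨A, hA, hAr⟩ := h
  obtain ⟨B, hB, hBr⟩ := h'
  choose C hC hCr using fun lam => Prog.exists_par (n lam) (src.len lam) (A lam) (B lam)
  refine ⟨C, ((PolyBounded.const 10).mul ((src.poly.add hA).add hB)).mono hC, fun lam O i => ?_⟩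
  rw [hCr lam O _ (src.length_val lam O i), hAr, hBr]

theorem Impl.indep {τ τ' : ∀ lam, ι lam → Type}
    {Q : ∀ lam, RO (n lam) → (i : ι lam) → PMF (τ lam i)}
    {Q' : ∀ lam, RO (n lam) → (i : ι lam) → PMF (τ' lam i)}
    {e : ∀ lam, RO (n lam) → (i : ι lam) → τ lam i → List Bool}
    {e' : ∀ lam, RO (n lam) → (i : ι lam) → τ' lam i → List Bool}
    (h : Impl src fun lam O i => (Q lam O i).map (e lam O i))
    (h' : Impl src fun lam O i => (Q' lam O i).map (e' lam O i)) :
    Impl src fun lam O i => ((Q lam O i).indep (Q' lam O i)).map fun x =>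
      e lam O i x.1 ++ e' lam O i x.2 := by
  refine (h.par h').congr fun lam O i => ?_
  rw [PMF.indep, PMF.map_bind, PMF.bind_map]
  simp only [PMF.map_comp]
  rfl

/-- Gates evaluate to any string each of whose bits depends on at most two input bits. -/
theorem Det.gates (ts : ℕ → List Gate) (hlt : ∀ lam, ∀ t ∈ ts lam,
      t.2.1 < src.len lam ∧ t.2.2 < src.len lam)
    (h : ∀ lam O i, (ts lam).map (fun t => t.eval (Mem.ofInput (src.val lam O i))) =
      f.val lam O i) (hlen : ∀ lam, (ts lam).length = f.len lam) : Det src f := by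
  choose A hA hAr using fun lam => Prog.exists_gates (n lam) (src.len lam) (ts lam) (hlt lam)
  refine ⟨A, ((PolyBounded.const 2).mul f.poly).mono fun lam => ?_, fun lam O i => ?_⟩
  · rw [hA, hlen]
  · rw [hAr, h]

theorem map_wire_ofInput {s a t b : List Bool} (h : s = a ++ t ++ b) :
    (((List.range t.length).map fun i => Gate.wire (a.length + i)).map
      fun g => g.eval (Mem.ofInput s)) = t := by
  rw [Prog.map_wire_range]
  apply List.ext_getElem
  · simp [Mem.read]
  · intro i h1 h2
    subst h
    simp only [Mem.read, List.getElem_map, List.getElem_range]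
    rw [Prog.ofInput_eq_getElem (by simp; omega), List.getElem_append_left (by simp; omega),
      List.getElem_append_right (by omega)]
    simp

theorem Det.slice (a b : Fld n ι) (hl : ∀ lam, src.len lam = a.len lam + f.len lam + b.len lam)
    (h : ∀ lam O i, src.val lam O i = a.val lam O i ++ f.val lam O i ++ b.val lam O i) :
    Det src f := by
  refine Det.gates (fun lam => (List.range (f.len lam)).map fun j => Gate.wire (a.len lam + j))
    (fun lam t ht => ?_) (fun lam O i => ?_) (fun lam => by simp)
  · simp only [List.mem_map, List.mem_range] at ht
    obtain ⟨j, hj, rfl⟩ := ht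
    have := hl lam
    simp only [Gate.wire]; omega
  · have := map_wire_ofInput (h lam O i)
    rwa [Fld.length_val, Fld.length_val] at this

theorem Det.refl : Det f f := Det.slice Fld.nil Fld.nil (by simp [Fld.nil]) (by simp [Fld.nil])

theorem Det.fst : Det (f.append g) f :=
  Det.slice Fld.nil g (by simp [Fld.nil, Fld.append]) (by simp [Fld.nil, Fld.append])

theorem Det.snd : Det (f.append g) g :=
  Det.slice f Fld.nil (by simp [Fld.nil, Fld.append]) (by simp [Fld.nil, Fld.append])

theorem Det.nil : Det f Fld.nil := Det.slice Fld.nil f (by simp [Fld.nil]) (by simp [Fld.nil])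

theorem Det.append (hf : Det src f) (hg : Det src g) : Det src (f.append g) := by
  refine (hf.par hg).congr fun lam O i => ?_
  rw [PMF.pure_bind, PMF.pure_map]
  rfl

theorem Det.of_mem {l : List (Fld n ι)} (h : f ∈ l) : Det (Fld.cat l) f := by
  induction l with
  | nil => simp at h
  | cons g l ih =>
    rcases List.mem_cons.1 h with rfl | h
    · exact Det.fst
    · exact Det.snd.trans (ih h)

theorem Det.comap (h : Det src f) (φ : ∀ lam, ι' lam → ι lam) :
    Det (src.comap φ) (f.comap φ) :=
  Impl.comap h φ

theorem Det.fixed {c : ℕ → List Bool} {hc : PolyBounded fun lam => (c lam).length} :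
    Det src (Fld.fixed c hc) := by
  have h : Det (Fld.nil : Fld n ι) (Fld.fixed c hc) := by
    choose A hA hAr using fun lam => Prog.exists_gates (n lam) 1
      ((c lam).map fun b => ((fun _ _ => b, 0, 0) : Gate)) (fun t ht => by
        obtain ⟨b, -, rfl⟩ := List.mem_map.1 ht
        simp)
    refine ⟨A, ((PolyBounded.const 2).mul hc).mono fun lam => ?_, fun lam O i => ?_⟩
    · rw [hA, List.length_map]
    · rw [hAr, List.map_map]
      exact congrArg _ (List.map_id _)
  exact Det.nil.trans h

/-- Bitwise application of a gate to two strings of the same length. -/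
theorem Det.zipWith (op : Bool → Bool → Bool) (hf : Det src f) (hg : Det src g) {r : Fld n ι}
    (hlen : ∀ lam, f.len lam = g.len lam) (hr : ∀ lam, r.len lam = g.len lam)
    (h : ∀ lam O i, r.val lam O i = List.zipWith op (f.val lam O i) (g.val lam O i)) :
    Det src r := by
  refine (hf.append hg).trans (Det.gates (fun lam => (List.range (g.len lam)).map fun j =>
    ((op, j, f.len lam + j) : Gate)) (fun lam t ht => ?_) (fun lam O i => ?_)
    (fun lam => by simp [hr]))
  · simp only [List.mem_map, List.mem_range] at ht
    obtain ⟨j, hj, rfl⟩ := ht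
    simp only [Fld.append, hlen]; omega
  · have hfl := f.length_val lam O i
    have hgl := g.length_val lam O i
    have := hlen lam
    rw [h]
    apply List.ext_getElem
    · simp [hfl, hgl, this]
    · intro j h1 h2
      simp only [List.length_map, List.length_range] at h1
      simp only [List.getElem_map, List.getElem_range, Gate.eval, Fld.append, List.getElem_zipWith]
      rw [Prog.ofInput_eq_getElem (by simp; omega), Prog.ofInput_eq_getElem (by simp; omega),
        List.getElem_append_left (by omega), List.getElem_append_right (by omega)]
      congr 2
      omega

/-- Application of a gate to a fixed bit and each bit of a string. -/
theorem Det.scale (op : Bool → Bool → Bool) {b : ∀ lam, ι lam → Bool} (hb : Det src (Fld.bit b))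
    (hg : Det src g) {r : Fld n ι} (hr : ∀ lam, r.len lam = g.len lam)
    (h : ∀ lam O i, r.val lam O i = (g.val lam O i).map (op (b lam i))) : Det src r := by
  refine (hb.append hg).trans (Det.gates (fun lam => (List.range (g.len lam)).map fun j =>
    ((op, 0, 1 + j) : Gate)) (fun lam t ht => ?_) (fun lam O i => ?_) (fun lam => by simp [hr]))
  · simp only [List.mem_map, List.mem_range] at ht
    obtain ⟨j, hj, rfl⟩ := ht
    simp only [Fld.append, Fld.bit]; omega
  · have hgl := g.length_val lam O i
    rw [h]
    apply List.ext_getElem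
    · simp [hgl]
    · intro j h1 h2
      simp only [List.length_map, List.length_range] at h1
      simp only [List.getElem_map, List.getElem_range, Gate.eval, Fld.append, Fld.bit]
      rw [Prog.ofInput_eq_getElem (by simp), Prog.ofInput_eq_getElem (by simp; omega),
        List.getElem_append_left (by simp), List.getElem_append_right (by simp)]
      simp

/-- Selection between two strings. -/
theorem Det.ite {b : ∀ lam, ι lam → Bool} (hb : Det src (Fld.bit b)) (hf : Det src f)
    (hg : Det src g) (hlen : ∀ lam, f.len lam = g.len lam) {r : Fld n ι}
    (hr : ∀ lam, r.len lam = g.len lam)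
    (h : ∀ lam O i, r.val lam O i = if b lam i then f.val lam O i else g.val lam O i) :
    Det src r := by
  let u : Fld n ι := ⟨fun lam O i => (f.val lam O i).map (b lam i && ·), f.len,
    by simp [f.length_val], f.poly⟩
  let v : Fld n ι := ⟨fun lam O i => (g.val lam O i).map (!b lam i && ·), g.len,
    by simp [g.length_val], g.poly⟩
  have hu : Det src u := Det.scale (fun x y => x && y) hb hf (fun _ => rfl) fun _ _ _ => rfl
  have hv : Det src v := Det.scale (fun x y => !x && y) hb hg (fun _ => rfl) fun _ _ _ => rfl
  refine Det.zipWith (fun x y => x || y) hu hv hlen hr fun lam O i => ?_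
  rw [h]
  have hl : (f.val lam O i).length = (g.val lam O i).length := by
    rw [f.length_val, g.length_val, hlen]
  apply List.ext_getElem
  · split_ifs <;> simp [u, v, hl]
  · intro j h1 h2
    simp only [u, v, List.getElem_zipWith, List.getElem_map]
    split_ifs with hb <;> simp [hb]

theorem Det.xor {k : ℕ → ℕ} {hk : PolyBounded k} {x y : ∀ lam, RO (n lam) → ι lam → Bits (k lam)}
    (hx : Det src (Fld.bits hk x)) (hy : Det src (Fld.bits hk y)) :
    Det src (Fld.bits hk fun lam O i => xorBits (x lam O i) (y lam O i)) := by
  refine Det.zipWith (fun a b => a ^^ b) hx hy (fun _ => rfl) (fun _ => rfl) fun lam O i => ?_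
  apply List.ext_getElem
  · simp [Fld.bits]
  · intro j h1 h2
    simp [Fld.bits, xorBits]

theorem Det.answer (hn : PolyBounded n) (hf : Det src f) : Det src (Fld.answer hn f) := by
  refine hf.trans ⟨fun lam => ⟨[.query (f.len lam) 0 0], 0, n lam⟩,
    (((f.poly.add (.const 1)).add hn)).mono fun lam => by simp [Prog.size, Instr.cost],
    fun lam O i => ?_⟩
  rw [Prog.run_eq]
  simp only [execAll, Instr.exec, PMF.pure_bind, PMF.pure_map]
  have h : (Mem.ofInput (f.val lam O i)).read 0 (f.len lam) = f.val lam O i := by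
    have := Mem.read_write (fun _ => false) 0 (f.val lam O i)
    rwa [Mem.write_zero_eq_ofInput, f.length_val] at this
  rw [h]
  have := Mem.read_write (Mem.ofInput (f.val lam O i)) 0 (List.ofFn (O (f.val lam O i)))
  rw [List.length_ofFn] at this
  rw [this]
  rfl

/-- Applying a polynomial-time map on indices polynomially often. -/
theorem Det.iterate {φ : ∀ lam, ι lam → ι lam} (h : Det f (f.comap φ)) {k : ℕ → ℕ}
    (hk : PolyBounded k) : Det f (f.comap fun lam => (φ lam)^[k lam]) := by
  obtain ⟨A, hA, hAr⟩ := h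
  obtain ⟨B, hB, hBr⟩ := Det.refl (f := f)
  have key : ∀ lam j, ∃ C : Prog, C.size ≤ (B lam).size + j * (A lam).size ∧
      ∀ O i, C.run O (f.val lam O i) = PMF.pure (f.val lam O ((φ lam)^[j] i)) := by
    intro lam j
    induction j with
    | zero => exact ⟨B lam, by simp, fun O i => hBr lam O i⟩
    | succ j ih =>
      obtain ⟨C, hC, hCr⟩ := ih
      obtain ⟨C', hC', hC'r⟩ := Prog.exists_comp (n lam) (f.len lam) C (A lam)
      refine ⟨C', by rw [hC', add_mul, one_mul]; omega, fun O i => ?_⟩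
      rw [hC'r O _ (f.length_val lam O i).le, hCr, PMF.pure_bind, hAr, Function.iterate_succ_apply']
      rfl
  choose C hC hCr using fun lam => key lam (k lam)
  exact ⟨C, (hB.add (hk.mul hA)).mono hC, hCr⟩

/-! ### Sampling -/

theorem Impl.coins {k : ℕ → ℕ} (hk : PolyBounded k) :
    Impl src fun lam _ _ => (PMF.uniformOfFintype (Bits (k lam))).map fun a => List.ofFn a := by
  refine ⟨fun lam => ⟨coinCode 0 (k lam), 0, k lam⟩, (hk.add hk).mono fun lam => by
    simp [Prog.size, cost_coinCode], fun lam O i => ?_⟩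
  rw [Prog.run_eq]
  dsimp only
  rw [execAll_coinCode, PMF.map_comp]
  congr 1
  funext a
  have := Mem.read_write (Mem.ofInput (src.val lam O i)) 0 (List.ofFn a)
  rwa [List.length_ofFn] at this

theorem Impl.coin :
    Impl src fun _ _ _ => (PMF.uniformOfFintype Bool).map fun b => [b] := by
  refine ⟨fun lam => ⟨[.coin 0], 0, 1⟩, (PolyBounded.const 2).mono fun lam => by
    simp [Prog.size, Instr.cost], fun lam O i => ?_⟩
  rw [Prog.run_eq]
  simp only [execAll, Instr.exec, PMF.bind_map, Function.comp_def]
  rw [PMF.map_bind, ← PMF.bind_pure_comp]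
  congr 1
  funext b
  rw [PMF.pure_map]
  exact congrArg _ (Mem.read_write (Mem.ofInput (src.val lam O i)) 0 [b])

theorem map_val_uniformOfFintype {N : ℕ} [NeZero N] (h : (Finset.range N).Nonempty) :
    (PMF.uniformOfFintype (ZMod N)).map ZMod.val = PMF.uniformOfFinset (Finset.range N) h := by
  ext a
  rw [PMF.map_apply, PMF.uniformOfFinset_apply]
  split_ifs with ha
  · rw [Finset.mem_range] at ha
    rw [tsum_eq_single (a : ZMod N)]
    · simp [ZMod.val_natCast, Nat.mod_eq_of_lt ha, ZMod.card]
    · intro b hb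
      rw [if_neg]
      rintro rfl
      simp at hb
  · rw [Finset.mem_range] at ha
    rw [ENNReal.tsum_eq_zero]
    intro b
    rw [if_neg]
    rintro rfl
    exact ha (ZMod.val_lt b)

theorem Instr.exec_unif {n : ℕ} (O : RO n) {m : Mem} {w src N : ℕ} [NeZero N] (hN : N < 2 ^ w)
    (h : m.read src w = natBits w N) (dst : ℕ) :
    (Instr.unif w src dst).exec O m =
      (PMF.uniformOfFintype (ZMod N)).map fun r => m.write dst (natBits w r.val) := by
  have h1 : (Nat.ofBits fun j : Fin w => m (src + j)) = N := by
    rw [← Nat.mod_eq_of_lt hN, ← Nat.ofBits_testBit]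
    congr 1
    funext j
    exact List.map_inj_left.1 h j (List.mem_range.2 j.2)
  simp only [Instr.exec, h1]
  rw [dif_pos (Finset.nonempty_range_iff.2 (NeZero.ne _)), ← map_val_uniformOfFintype,
    PMF.map_comp]
  rfl

/-- Choosing a uniform residue modulo a number that is given by its digits. -/
theorem Impl.unif {p : ∀ lam, ι lam → ℕ} [hp : ∀ lam i, NeZero (p lam i)]
    (hlt : ∀ lam i, p lam i < 2 ^ ordLen lam) (h : Det src (Fld.digits p)) :
    Impl src fun lam _ i => (PMF.uniformOfFintype (ZMod (p lam i))).map fun r =>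
      natBits (ordLen lam) r.val := by
  refine h.impl ⟨fun lam => ⟨[.unif (ordLen lam) 0 0], 0, ordLen lam⟩,
    ((PolyBounded.ordLen.add (.const 1)).add .ordLen).mono fun lam => by
      simp [Prog.size, Instr.cost], fun lam O i => ?_⟩
  rw [Prog.run_eq]
  have hr : (Mem.ofInput ((Fld.digits p).val lam O i)).read 0 (ordLen lam) =
      natBits (ordLen lam) (p lam i) :=
    List.map_congr_left fun j hj => by
      simp [Fld.digits, natBits, Mem.ofInput, List.mem_range.1 hj]
  simp only [execAll, Instr.exec_unif O (hlt lam i) hr]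
  change PMF.map _ (PMF.bind _ PMF.pure) = _
  rw [PMF.bind_pure, PMF.map_comp]
  congr 1
  funext r
  have := Mem.read_write (Mem.ofInput ((Fld.digits p).val lam O i)) 0 (natBits (ordLen lam) r.val)
  rwa [show (natBits (ordLen lam) r.val).length = ordLen lam by simp [natBits]] at this

end

namespace PMF

/-- A distribution, as a distribution on its support. -/
noncomputable def onSupport {α : Type*} (p : PMF α) : PMF p.support :=
  ⟨fun a => p a, (hasSum_subtype_iff_of_support_subset (s := p.support) (fun _ ha => ha)).2 p.2⟩

theorem onSupport_map_val {α : Type*} (p : PMF α) : p.onSupport.map Subtype.val = p := by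
  ext a
  rw [map_apply]
  by_cases ha : a ∈ p.support
  · rw [tsum_eq_single ⟨a, ha⟩]
    · simp [onSupport, DFunLike.coe]
    · intro b hb
      rw [if_neg]
      rintro rfl
      simp at hb
  · rw [(p.apply_eq_zero_iff a).2 ha, ENNReal.tsum_eq_zero]
    intro b
    rw [if_neg]
    rintro rfl
    exact ha b.2

theorem onSupport_bind {α β : Type*} (p : PMF α) (f : α → PMF β) :
    p.onSupport.bind (fun a => f a) = p.bind f := by
  conv_rhs => rw [← p.onSupport_map_val]
  rw [bind_map]
  rfl

end PMF

/-! ### Group operations -/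

namespace GroupScheme

variable (𝒢 : GroupScheme)

/-- The random choices that a group-generation scheme can make. -/
abbrev Idx (lam : ℕ) : Type := (𝒢.rand lam).support

/-- The group for these random choices. -/
abbrev At {lam : ℕ} (γ : 𝒢.Idx lam) : Type := (𝒢.grp lam γ.1).Carrier

theorem polyBounded_elemLen : PolyBounded 𝒢.elemLen := by
  obtain ⟨A, hA, -, hAr⟩ := 𝒢.mul_efficient
  refine hA.outLen.mono fun lam => ?_
  obtain ⟨ω, hω⟩ := (𝒢.rand lam).support_nonempty
  have h := hAr lam ω hω 1 1
  have := (A lam).length_of_mem_run _ _ _ (show (𝒢.inst lam (𝒢.desc lam ω)).str (1 * 1) ∈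
    ((A lam).runPlain _).support by rw [h]; simp)
  rw [← this]
  simp [GroupInst.str]

theorem length_setup (lam : ℕ) (ω : Bits (𝒢.coinLen lam)) :
    (𝒢.setup lam ω).length = 𝒢.descLen lam + ordLen lam + 𝒢.elemLen lam := by
  simp [setup, GroupInst.setup, natBits, GroupInst.str, add_assoc]

theorem polyBounded_gen : PolyBounded fun lam =>
    𝒢.coinLen lam + (𝒢.descLen lam + ordLen lam + 𝒢.elemLen lam) := by
  obtain ⟨A, hA, -, hAr⟩ := 𝒢.gen_efficient
  refine hA.outLen.mono fun lam => ?_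
  obtain ⟨ω, hω⟩ := (𝒢.rand lam).support_nonempty
  have := (A lam).length_of_mem_run _ _ _ (show List.ofFn ω ++ 𝒢.setup lam ω ∈
    ((A lam).runPlain []).support by rw [hAr, PMF.mem_support_map_iff]; exact ⟨ω, hω, rfl⟩)
  rw [← this, List.length_append, length_setup, List.length_ofFn]

variable {𝒢} in
theorem p_lt {lam : ℕ} (γ : 𝒢.Idx lam) : (𝒢.grp lam γ.1).p < 2 ^ ordLen lam := by
  have := Nat.lt_size_self (𝒢.grp lam γ.1).p
  rwa [𝒢.order_digits lam γ.1 γ.2] at this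

end GroupScheme

section

variable {𝒢 : GroupScheme} {n : ℕ → ℕ} {ι ι' : ℕ → Type}

namespace Fld

/-- The string `(𝔾, p, g)`. -/
def setup (γ : ∀ lam, ι lam → 𝒢.Idx lam) : Fld n ι where
  val lam _ i := 𝒢.setup lam (γ lam i).1
  len lam := 𝒢.descLen lam + ordLen lam + 𝒢.elemLen lam
  length_val _ _ _ := 𝒢.length_setup _ _
  poly := 𝒢.polyBounded_gen.mono fun _ => Nat.le_add_left _ _

/-- The random choices of the group-generation scheme. -/
def genCoins (γ : ∀ lam, ι lam → 𝒢.Idx lam) : Fld n ι where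
  val lam _ i := List.ofFn (γ lam i).1
  len := 𝒢.coinLen
  length_val _ _ _ := List.length_ofFn
  poly := 𝒢.polyBounded_gen.mono fun _ => Nat.le_add_right _ _

/-- A group element. -/
def elem {γ : ∀ lam, ι lam → 𝒢.Idx lam} (X : ∀ lam (i : ι lam), 𝒢.At (γ lam i)) : Fld n ι where
  val lam _ i := (𝒢.grp lam (γ lam i).1).str (X lam i)
  len := 𝒢.elemLen
  length_val _ _ _ := List.length_ofFn
  poly := 𝒢.polyBounded_elemLen

/-- An exponent. -/
def exp {γ : ∀ lam, ι lam → 𝒢.Idx lam} (r : ∀ lam (i : ι lam), ZMod (𝒢.grp lam (γ lam i).1).p) :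
    Fld n ι :=
  digits fun lam i => (r lam i).val

end Fld

variable {src : Fld n ι} {γ : ∀ lam, ι lam → 𝒢.Idx lam}

namespace Det

theorem mul {X Y : ∀ lam (i : ι lam), 𝒢.At (γ lam i)} (hs : Det src (Fld.setup γ))
    (hX : Det src (Fld.elem X)) (hY : Det src (Fld.elem Y)) :
    Det src (Fld.elem fun lam i => X lam i * Y lam i) := by
  obtain ⟨A, hA, hq, hAr⟩ := 𝒢.mul_efficient
  refine ((hs.append hX).append hY).trans ⟨A, hA, fun lam O i => ?_⟩
  rw [(hq lam).run_eq_runPlain]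
  exact hAr lam _ (γ lam i).2 _ _

theorem inv {X : ∀ lam (i : ι lam), 𝒢.At (γ lam i)} (hs : Det src (Fld.setup γ))
    (hX : Det src (Fld.elem X)) : Det src (Fld.elem fun lam i => (X lam i)⁻¹) := by
  obtain ⟨A, hA, hq, hAr⟩ := 𝒢.inv_efficient
  refine (hs.append hX).trans ⟨A, hA, fun lam O i => ?_⟩
  rw [(hq lam).run_eq_runPlain]
  exact hAr lam _ (γ lam i).2 _

theorem generator (hs : Det src (Fld.setup γ)) :
    Det src (Fld.elem (γ := γ) fun lam i => (𝒢.grp lam (γ lam i).1).g) := by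
  refine hs.trans (Det.slice ⟨fun lam _ i => List.ofFn (𝒢.desc lam (γ lam i).1) ++
    natBits (ordLen lam) (𝒢.grp lam (γ lam i).1).p, fun lam => 𝒢.descLen lam + ordLen lam,
    by simp [natBits], 𝒢.polyBounded_gen.mono fun _ => by omega⟩ Fld.nil
    (fun _ => rfl) fun lam O i => ?_)
  simp [Fld.nil, Fld.setup, Fld.elem, GroupScheme.setup, GroupInst.setup]

theorem order (hs : Det src (Fld.setup γ)) :
    Det src (Fld.digits fun lam i => (𝒢.grp lam (γ lam i).1).p) := by
  refine hs.trans (Det.slice ⟨fun lam _ i => List.ofFn (𝒢.desc lam (γ lam i).1), 𝒢.descLen,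
    by simp, 𝒢.polyBounded_gen.mono fun _ => by omega⟩
    (Fld.elem (γ := γ) fun lam i => (𝒢.grp lam (γ lam i).1).g) (fun _ => rfl) fun lam O i => ?_)
  simp [Fld.setup, Fld.elem, GroupScheme.setup, GroupInst.setup, Fld.digits]

/-- Selection between two group elements. -/
theorem elem_ite {b : ∀ lam, ι lam → Bool} {X Y : ∀ lam (i : ι lam), 𝒢.At (γ lam i)}
    (hb : Det src (Fld.bit b)) (hX : Det src (Fld.elem X)) (hY : Det src (Fld.elem Y)) :
    Det src (Fld.elem fun lam i => if b lam i then X lam i else Y lam i) :=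
  Det.ite hb hX hY (fun _ => rfl) (fun _ => rfl) fun lam O i => by
    simp only [Fld.elem]; split_ifs <;> rfl

theorem lowest_bit {e : ∀ lam, ι lam → ℕ} (h : Det src (Fld.digits e)) :
    Det src (Fld.bit fun lam i => (e lam i).testBit 0) := by
  refine h.trans (Det.slice Fld.nil ⟨fun lam _ i => (natBits (ordLen lam) (e lam i)).tail,
    fun lam => ordLen lam - 1, by simp [natBits], PolyBounded.ordLen.mono fun _ => Nat.sub_le _ _⟩
    (fun lam => ?_) fun lam O i => ?_)
  · have : 2 ≤ ordLen lam := le_max_left _ _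
    simp only [Fld.digits, Fld.nil, Fld.bit]; omega
  · obtain ⟨k, hk⟩ : ∃ k, ordLen lam = k + 1 :=
      ⟨ordLen lam - 1, by have : 2 ≤ ordLen lam := le_max_left _ _; omega⟩
    simp [Fld.digits, Fld.nil, Fld.bit, natBits, hk, List.range_succ_eq_map]

theorem half {e : ∀ lam, ι lam → ℕ} (he : ∀ lam i, e lam i < 2 ^ ordLen lam)
    (h : Det src (Fld.digits e)) : Det src (Fld.digits fun lam i => e lam i / 2) := by
  have h0 : Det src (Fld.bit fun _ _ => false) :=
    (Det.fixed (c := fun _ => [false]) (hc := .const 1)).congr fun _ _ _ => rfl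
  refine (h.append h0).trans (Det.slice (Fld.bit fun lam i => (e lam i).testBit 0) Fld.nil
    (fun lam => ?_) fun lam O i => ?_)
  · simp only [Fld.digits, Fld.nil, Fld.bit, Fld.append]; omega
  · have h1 : (e lam i).testBit (ordLen lam) = false := Nat.testBit_lt_two_pow (he lam i)
    simp only [Fld.append, Fld.digits, Fld.nil, Fld.bit, natBits, List.append_nil]
    have h2 : [(e lam i).testBit 0] ++ (List.range (ordLen lam)).map (e lam i / 2).testBit =
        (List.range (ordLen lam + 1)).map (e lam i).testBit := by
      rw [List.range_succ_eq_map]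
      simp [Function.comp_def, Nat.testBit_succ]
    rw [h2, List.range_succ]
    simp [h1]

end Det

namespace SquareMultiply

/-- The state of the square-and-multiply algorithm: the accumulated product, the current square,
and the remaining exponent. -/
abbrev State (𝒢 : GroupScheme) (lam : ℕ) : Type :=
  Σ γ : 𝒢.Idx lam, 𝒢.At γ × 𝒢.At γ × Fin (2 ^ ordLen lam)

/-- One step of the algorithm. -/
def step (lam : ℕ) (x : State 𝒢 lam) : State 𝒢 lam :=
  ⟨x.1, if (x.2.2.2 : ℕ).testBit 0 then x.2.1 * x.2.2.1 else x.2.1, x.2.2.1 * x.2.2.1,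
    ⟨x.2.2.2 / 2, (Nat.div_le_self _ _).trans_lt x.2.2.2.2⟩⟩

theorem iterate_step {lam : ℕ} (γ : 𝒢.Idx lam) (k : ℕ) (acc cur : 𝒢.At γ)
    (e : Fin (2 ^ ordLen lam)) (he : (e : ℕ) < 2 ^ k) :
    ∃ cur' e', (step lam)^[k] ⟨γ, acc, cur, e⟩ = ⟨γ, acc * cur ^ (e : ℕ), cur', e'⟩ := by
  induction k generalizing acc cur e with
  | zero =>
    have : (e : ℕ) = 0 := by simpa using he
    exact ⟨cur, e, by simp [this]⟩
  | succ k ih =>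
    rw [Function.iterate_succ_apply]
    obtain ⟨cur', e', h⟩ := ih (if (e : ℕ).testBit 0 then acc * cur else acc) (cur * cur)
      ⟨e / 2, (Nat.div_le_self _ _).trans_lt e.2⟩ (by
        show (e : ℕ) / 2 < 2 ^ k
        rw [pow_succ] at he; omega)
    refine ⟨cur', e', ?_⟩
    rw [step, h]
    congr 2
    show _ * (cur * cur) ^ ((e : ℕ) / 2) = _
    rw [← pow_two, ← pow_mul]
    simp only [Nat.testBit_zero, decide_eq_true_eq]
    split_ifs with h1
    · rw [mul_assoc, ← pow_succ', show 2 * ((e : ℕ) / 2) + 1 = e by omega]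
    · rw [show 2 * ((e : ℕ) / 2) = e by omega]

/-- The string that represents the state. -/
def fld : Fld n (State 𝒢) :=
  Fld.cat [Fld.setup fun _ x => x.1, Fld.elem (γ := fun _ x => x.1) fun _ x => x.2.1,
    Fld.elem (γ := fun _ x => x.1) fun _ x => x.2.2.1, Fld.digits fun _ x => x.2.2.2]

theorem det_step : Det (fld : Fld n (State 𝒢)) (fld.comap step) := by
  have hs : Det (fld : Fld n (State 𝒢)) (Fld.setup fun _ x => x.1) := Det.of_mem (by simp)
  have ha : Det (fld : Fld n (State 𝒢)) (Fld.elem (γ := fun _ x => x.1) fun _ x => x.2.1) :=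
    Det.of_mem (by simp)
  have hc : Det (fld : Fld n (State 𝒢)) (Fld.elem (γ := fun _ x => x.1) fun _ x => x.2.2.1) :=
    Det.of_mem (by simp)
  have he : Det (fld : Fld n (State 𝒢)) (Fld.digits fun _ x => x.2.2.2) :=
    Det.of_mem (by simp)
  exact (hs.append ((Det.elem_ite he.lowest_bit (hs.mul ha hc) ha).append
    ((hs.mul hc hc).append ((he.half fun _ x => x.2.2.2.2).append Det.nil)))).congr
      fun _ _ _ => rfl

end SquareMultiply

theorem Det.pow {X : ∀ lam (i : ι lam), 𝒢.At (γ lam i)}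
    {r : ∀ lam (i : ι lam), ZMod (𝒢.grp lam (γ lam i).1).p} (hs : Det src (Fld.setup γ))
    (hX : Det src (Fld.elem X)) (hr : Det src (Fld.exp r)) :
    Det src (Fld.elem fun lam i => (𝒢.grp lam (γ lam i).1).pow (X lam i) (r lam i)) := by
  have h1 : Det src (Fld.elem (γ := γ) fun _ _ => 1) := by
    have h := hs.mul hX (hs.inv hX)
    simpa only [mul_inv_cancel] using h
  have hlt : ∀ lam i, (r lam i).val < 2 ^ ordLen lam := fun lam i =>
    (ZMod.val_lt _).trans (GroupScheme.p_lt (γ lam i))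
  let ψ : ∀ lam, ι lam → SquareMultiply.State 𝒢 lam := fun lam i =>
    ⟨γ lam i, 1, X lam i, ⟨(r lam i).val, hlt lam i⟩⟩
  have hψ : Det src (SquareMultiply.fld.comap ψ) :=
    (hs.append (h1.append (hX.append (hr.append Det.nil)))).congr fun _ _ _ => rfl
  have hit := (SquareMultiply.det_step (𝒢 := 𝒢) (n := n)).iterate PolyBounded.ordLen
  have hacc : Det (SquareMultiply.fld : Fld n (SquareMultiply.State 𝒢))
      (Fld.elem (γ := fun _ x => x.1) fun _ x => x.2.1) := Det.of_mem (by simp)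
  refine (hψ.trans ((hit.trans (hacc.comap _)).comap ψ)).congr fun lam O i => ?_
  obtain ⟨cur', e', h⟩ := SquareMultiply.iterate_step (γ lam i) (ordLen lam) 1 (X lam i)
    ⟨(r lam i).val, hlt lam i⟩ (hlt lam i)
  simp only [Fld.comap, Fld.elem, ψ]
  rw [h, one_mul]
  rfl

/-- Choosing a uniform exponent. -/
theorem Impl.exponent (hs : Det src (Fld.setup γ)) : Impl src fun lam _ i =>
    (PMF.uniformOfFintype (ZMod (𝒢.grp lam (γ lam i).1).p)).map
      ((𝒢.grp lam (γ lam i).1).expStr lam) :=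
  Impl.unif (p := fun lam i => (𝒢.grp lam (γ lam i).1).p)
    (hp := fun lam i => ⟨(𝒢.grp lam (γ lam i).1).prime_card.ne_zero⟩)
    (fun lam i => GroupScheme.p_lt (γ lam i)) hs.order

/-- Choosing a group. -/
theorem Impl.gen : Impl src fun lam _ _ => (𝒢.rand lam).onSupport.map fun γ =>
    List.ofFn γ.1 ++ 𝒢.setup lam γ.1 := by
  obtain ⟨A, hA, hq, hAr⟩ := 𝒢.gen_efficient
  refine (Det.nil (f := src)).impl ⟨A, hA, fun lam O i => ?_⟩
  rw [(hq lam).run_eq_runPlain]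
  refine (hAr lam).trans ?_
  rw [← PMF.bind_pure_comp, ← PMF.onSupport_bind]
  rfl

/-- Sampling, where the input is kept for the second stage. -/
theorem Impl.bind_keep {τ : ∀ lam, ι lam → Type}
    {Q : ∀ lam, RO (n lam) → (i : ι lam) → PMF (τ lam i)}
    (E : Fld n fun lam => Σ i : ι lam, τ lam i)
    {K' : ∀ lam, RO (n lam) → (Σ i : ι lam, τ lam i) → PMF (List Bool)}
    (h : Impl src fun lam O i => (Q lam O i).map fun q => E.val lam O ⟨i, q⟩)
    (h' : Impl ((src.comap fun _ x => x.1).append E) K') :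
    Impl src fun lam O i => (Q lam O i).bind fun q => K' lam O ⟨i, q⟩ := by
  refine Impl.bind ((Det.refl.par h).congr fun lam O i => ?_) h'
  rw [PMF.pure_bind, PMF.map_comp]
  rfl

end

namespace PMF

theorem bind_uniformOfFintype_equiv {α β δ : Type*} [Fintype α] [Nonempty α] [Fintype β]
    [Nonempty β] (e : α ≃ β) (f : β → PMF δ) :
    (uniformOfFintype α).bind (fun a => f (e a)) = (uniformOfFintype β).bind f := by
  rw [← uniformOfFintype_map_equiv e, bind_map]
  rfl

end PMF

/-! ### Exponentiation in the groups -/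

namespace GroupInst

variable {ℓ : ℕ} (I : GroupInst ℓ)

theorem pow_natCast (x : I.Carrier) (k : ℕ) : I.pow x (k : ZMod I.p) = x ^ k := by
  rw [pow, ZMod.val_natCast, p, pow_mod_card]

theorem pow_add (x : I.Carrier) (r s : ZMod I.p) : I.pow x (r + s) = I.pow x r * I.pow x s := by
  rw [← ZMod.natCast_zmod_val r, ← ZMod.natCast_zmod_val s, ← Nat.cast_add, pow_natCast,
    pow_natCast, pow_natCast, _root_.pow_add]

theorem pow_zero (x : I.Carrier) : I.pow x 0 = 1 := by
  have := I.pow_natCast x 0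
  rwa [Nat.cast_zero, _root_.pow_zero] at this

theorem pow_neg (x : I.Carrier) (r : ZMod I.p) : I.pow x (-r) = (I.pow x r)⁻¹ := by
  rw [eq_inv_iff_mul_eq_one, ← pow_add, neg_add_cancel, pow_zero]

theorem pow_sub (x : I.Carrier) (r s : ZMod I.p) : I.pow x (r - s) = I.pow x r / I.pow x s := by
  rw [sub_eq_add_neg, pow_add, pow_neg, div_eq_mul_inv]

theorem pow_mul (x : I.Carrier) (r s : ZMod I.p) : I.pow x (r * s) = I.pow (I.pow x r) s := by
  rw [← ZMod.natCast_zmod_val r, ← ZMod.natCast_zmod_val s, ← Nat.cast_mul, pow_natCast,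
    pow_natCast, pow_natCast, _root_.pow_mul]

theorem pow_comm (x : I.Carrier) (r s : ZMod I.p) :
    I.pow (I.pow x r) s = I.pow (I.pow x s) r := by
  rw [← pow_mul, ← pow_mul, mul_comm]

theorem pow_g_bijective : Function.Bijective (I.pow I.g) := by
  rw [Fintype.bijective_iff_injective_and_card]
  refine ⟨fun a b hab => ?_, ZMod.card _⟩
  have ho : orderOf I.g = I.p := by
    rw [orderOf_eq_card_of_forall_mem_zpowers I.g_generates, Nat.card_eq_fintype_card]
    rfl
  have := pow_injOn_Iio_orderOf (x := I.g) (by simpa [ho] using ZMod.val_lt a)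
    (by simpa [ho] using ZMod.val_lt b) hab
  exact ZMod.val_injective _ this

/-- Exponents modulo the order of the group correspond to group elements. -/
noncomputable def expEquiv : ZMod I.p ≃ I.Carrier := Equiv.ofBijective _ I.pow_g_bijective

theorem bind_uniform_carrier {δ : Type*} (f : I.Carrier → PMF δ) :
    (PMF.uniformOfFintype I.Carrier).bind f =
      (PMF.uniformOfFintype (ZMod I.p)).bind fun c => f (I.pow I.g c) :=
  (PMF.bind_uniformOfFintype_equiv I.expEquiv f).symm

end GroupInst

/-! ### The laws of the views -/

namespace DUQOT

section

variable {ℓ : ℕ} (I : GroupInst ℓ)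

/-- The two keys `β` have the same form as the `δ`, with the index `s` in place of its share. -/
theorem genQuery₁_genQuery₂ (C : I.Carrier) (s s₁ : Bool) (r₁ r₂ : ZMod I.p) :
    genQuery₁ I (genQuery₂ I C (share₂ s s₁) r₂) s₁ r₁ =
      genQuery₂ I C s (r₂ + r₁ * (-1) ^ (share₂ s s₁).toNat) := by
  funext b
  cases s <;> cases s₁ <;> cases b <;>
    simp [genQuery₁, genQuery₂, share₂, I.pow_add, I.pow_neg, div_eq_mul_inv, mul_comm,
      mul_left_comm]

/-- Whichever position holds `g ^ r`, the pair consists of a uniform element and its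
complement. -/
theorem bind_genQuery₂ {δ : Type*} (C : I.Carrier) (s : Bool) (F : (Bool → I.Carrier) → PMF δ) :
    (PMF.uniformOfFintype (ZMod I.p)).bind (fun r => F (genQuery₂ I C s r)) =
      (PMF.uniformOfFintype (ZMod I.p)).bind fun r => F (genQuery₂ I C false r) := by
  cases s
  · rfl
  · obtain ⟨c, rfl⟩ := I.pow_g_bijective.2 C
    rw [← PMF.bind_uniformOfFintype_equiv (Equiv.subLeft c)]
    congr 1
    funext r
    congr 1
    funext b
    cases b <;> simp [genQuery₂, I.pow_sub]

theorem bind_genQuery₁ {δ : Type*} (C : I.Carrier) (s s₁ : Bool) (r₁ : ZMod I.p)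
    (F : (Bool → I.Carrier) → PMF δ) :
    (PMF.uniformOfFintype (ZMod I.p)).bind
        (fun r₂ => F (genQuery₁ I (genQuery₂ I C (share₂ s s₁) r₂) s₁ r₁)) =
      (PMF.uniformOfFintype (ZMod I.p)).bind fun r => F (genQuery₂ I C false r) := by
  simp only [genQuery₁_genQuery₂]
  rw [← bind_genQuery₂ I C s F]
  exact PMF.bind_uniformOfFintype_equiv (Equiv.addRight (r₁ * (-1) ^ (share₂ s s₁).toNat))
    fun r => F (genQuery₂ I C s r)

theorem genQuery₂_mul (C : I.Carrier) (s : Bool) (r : ZMod I.p) :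
    genQuery₂ I C s r false * genQuery₂ I C s r true = C := by
  cases s <;> simp [genQuery₂]

end

variable (𝒢 : GroupScheme) {σ : ℕ → ℕ} (π : ℕ → PMF (Equiv.Perm Bool))

theorem protocol_map (lam : ℕ) (O : RO (σ lam + lam)) (x : Inputs (σ lam)) {δ : Type*}
    (F : Execution → δ) :
    (protocol 𝒢 σ π lam O x).map F =
      (𝒢.rand lam).onSupport.bind fun γ =>
      (PMF.uniformOfFintype (ZMod (𝒢.grp lam γ.1).p)).bind fun c =>
      (PMF.uniformOfFintype (ZMod (𝒢.grp lam γ.1).p)).bind fun y₀ =>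
      (PMF.uniformOfFintype (ZMod (𝒢.grp lam γ.1).p)).bind fun y₁ =>
      (π lam).bind fun τ =>
      (PMF.uniformOfFintype (ZMod (𝒢.grp lam γ.1).p)).bind fun r₁ =>
      (PMF.uniformOfFintype (ZMod (𝒢.grp lam γ.1).p)).bind fun r₂ =>
      (PMF.uniformOfFintype Bool).bind fun s₁ =>
      (PMF.uniformOfFintype (Bits lam)).map fun r₃ =>
        F (execution 𝒢 lam O x ⟨γ.1, (𝒢.grp lam γ.1).pow (𝒢.grp lam γ.1).g c,
          fun b => if b then y₁ else y₀, τ⟩ r₁ r₂ s₁ r₃) := by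
  simp only [protocol, senderCoins, request, PMF.map_bind, PMF.bind_bind, PMF.pure_bind,
    PMF.map_comp, PMF.bind_map, GroupInst.bind_uniform_carrier, Function.comp_def]
  rw [← PMF.onSupport_bind]

section Views

variable (lam : ℕ) (O : RO (σ lam + lam)) (x : Inputs (σ lam)) (c : SenderCoins 𝒢 lam)
  (r₁ r₂ : ZMod (𝒢.grp lam c.ω).p) (s₁ : Bool) (r₃ : Bits lam)

theorem view_P2 : (execution 𝒢 lam O x c r₁ r₂ s₁ r₃).view x .P2 =
    pk 𝒢 lam c.ω c.C ++ (𝒢.grp lam c.ω).expStr lam r₂ ++ [share₂ x.s s₁] := by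
  simp only [Execution.view, execution]
  split <;> simp [Inputs.ofParty]

theorem view_P1 : (execution 𝒢 lam O x c r₁ r₂ s₁ r₃).view x .P1 =
    pk 𝒢 lam c.ω c.C ++ (𝒢.grp lam c.ω).expStr lam r₁ ++ [s₁] ++
      (𝒢.grp lam c.ω).str (genQuery₂ (𝒢.grp lam c.ω) c.C (share₂ x.s s₁) r₂ false) ++
      (𝒢.grp lam c.ω).str (genQuery₂ (𝒢.grp lam c.ω) c.C (share₂ x.s s₁) r₂ true) := by
  simp only [Execution.view, execution]
  split <;> simp [Inputs.ofParty]

theorem view_T : (execution 𝒢 lam O x c r₁ r₂ s₁ r₃).view x .T =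
    [x.s] ++ [s₁] ++ List.ofFn r₃ ++ pk 𝒢 lam c.ω c.C := by
  simp only [Execution.view, execution]
  split <;> simp [Inputs.ofParty]

theorem view_S : (execution 𝒢 lam O x c r₁ r₂ s₁ r₃).view x .S =
    x.ofParty .S ++ List.ofFn c.ω ++ (𝒢.grp lam c.ω).str c.C ++
      (𝒢.grp lam c.ω).expStr lam (c.y false) ++ (𝒢.grp lam c.ω).expStr lam (c.y true) ++
      [c.τ false] ++ pk 𝒢 lam c.ω c.C ++ List.ofFn r₃ ++
      (𝒢.grp lam c.ω).str (genQuery₁ (𝒢.grp lam c.ω) (genQuery₂ (𝒢.grp lam c.ω) c.C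
        (share₂ x.s s₁) r₂) s₁ r₁ false) ++
      (𝒢.grp lam c.ω).str (genQuery₁ (𝒢.grp lam c.ω) (genQuery₂ (𝒢.grp lam c.ω) c.C
        (share₂ x.s s₁) r₂) s₁ r₁ true) := by
  simp only [Execution.view, execution]
  split <;> rename_i h <;> simp [h]

end Views

/-! ### Perfect simulation -/

/-- A secure permutation of two positions flips them with probability `1/2`. -/
theorem bind_of_securePermutation {ρ : PMF (Equiv.Perm Bool)} (hρ : SecurePermutation ρ)
    {δ : Type*} (f : Equiv.Perm Bool → PMF δ) :
    ρ.bind f = (PMF.uniformOfFintype Bool).bind fun j =>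
      f (if j then Equiv.boolNot else Equiv.refl Bool) := by
  have h1 : ρ.map (fun τ => τ false) = PMF.uniformOfFintype Bool := by
    ext j
    rw [hρ, PMF.uniformOfFintype_apply]
  rw [← h1, PMF.bind_map]
  congr 1
  funext τ
  simp only [Function.comp_apply]
  congr 1
  revert τ
  decide

/-- The index of a simulated run: the index `i`, the group, and further random choices. -/
abbrev SimIdx (ι : ℕ → Type) (κ : ∀ lam, 𝒢.Idx lam → Type) (lam : ℕ) : Type :=
  Σ y : (Σ _ : ι lam, 𝒢.Idx lam), κ lam y.2

variable {𝒢} {π}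

/-- A simulator: it generates a group, makes further random choices, and computes. -/
theorem Impl.of_gen {n : ℕ → ℕ} {ι : ℕ → Type} {src : Fld n ι} {κ : ∀ lam, 𝒢.Idx lam → Type}
    {Q : ∀ lam (γ : 𝒢.Idx lam), PMF (κ lam γ)} (E V : Fld n (SimIdx 𝒢 ι κ))
    (hE : Impl (Fld.setup (n := n) fun lam (y : Σ _ : ι lam, 𝒢.Idx lam) => y.2)
      fun lam O y => (Q lam y.2).map fun q => E.val lam O ⟨y, q⟩)
    (hV : ∀ src' : Fld n (SimIdx 𝒢 ι κ), Det src' (src.comap fun _ y => y.1.1) →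
      Det src' (Fld.genCoins fun _ y => y.1.2) → Det src' (Fld.setup fun _ y => y.1.2) →
      Det src' E → Det src' V) :
    Impl src fun lam O i => (𝒢.rand lam).onSupport.bind fun γ =>
      (Q lam γ).map fun q => V.val lam O ⟨⟨i, γ⟩, q⟩ := by
  refine Impl.bind_keep ((Fld.genCoins fun _ y => y.2).append (Fld.setup fun _ y => y.2))
    (K' := fun lam O (y : Σ _ : ι lam, 𝒢.Idx lam) =>
      (Q lam y.2).map fun q => V.val lam O ⟨y, q⟩) Impl.gen ?_
  refine (Impl.bind_keep E (K' := fun lam O y => PMF.pure (V.val lam O y))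
    ((Det.snd.trans Det.snd).impl hE) ?_).congr fun lam O i => (PMF.bind_pure_comp _ _).symm
  have h := Det.fst (f := ((src.comap fun _ (y : Σ _, 𝒢.Idx _) => y.1).append
    ((Fld.genCoins fun _ y => y.2).append (Fld.setup fun _ y => y.2))).comap
      fun _ (y : SimIdx 𝒢 ι κ _) => y.1) (g := E)
  exact hV _ (h.trans (Det.fst.comap _)) (h.trans ((Det.snd.trans Det.fst).comap _))
    (h.trans ((Det.snd.trans Det.snd).comap _)) Det.snd

/-- The input and the output of a party. -/
def partyFld {n : ℕ → ℕ} (hσ : PolyBounded σ) (P : Party) : Fld n fun lam => Inputs (σ lam) where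
  val _ _ x := x.ofParty P ++ x.functionality P
  len lam := match P with
    | .S => σ lam + σ lam
    | .R => σ lam
    | .T => 1
    | _ => 0
  length_val lam O x := by cases P <;> simp [Inputs.ofParty, Inputs.functionality]
  poly := by
    cases P
    · exact hσ.add hσ
    · exact hσ
    · exact .const 1
    · exact .const 0
    · exact .const 0

theorem negligible_zero : Negligible fun _ => 0 :=
  Asymptotics.superpolynomialDecay_zero _ _

/-- A program that generates exactly the law of the view is a simulator. -/
theorem simulatable_of_impl {n : ℕ → ℕ} {Γ : Protocol σ n} {P : Party} (hσ : PolyBounded σ)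
    (h : Impl (partyFld hσ P) fun lam O x => (Γ lam O x).map fun e => e.view x P) :
    Γ.Simulatable P := by
  obtain ⟨Sim, hS, hSr⟩ := h
  refine ⟨Sim, hS, fun D _ => ⟨fun _ => 0, negligible_zero, fun lam x => ?_⟩⟩
  have : (fun O : RO (n lam) => (Sim lam).run O (x.ofParty P ++ x.functionality P)) =
      fun O => (Γ lam O x).map fun e => e.view x P := funext fun O => hSr lam O x
  simp only [this, sub_self, abs_zero, le_refl]

theorem bind_xor {δ : Type*} (s : Bool) (f : Bool → PMF δ) :
    (PMF.uniformOfFintype Bool).bind (fun a => f (a ^^ s)) =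
      (PMF.uniformOfFintype Bool).bind f :=
  PMF.bind_uniformOfFintype_equiv (Function.Involutive.toPerm (· ^^ s) fun a => by simp) f

open Fld in
/-- The share that the second server sees is a uniform bit. -/
theorem simulatable_P2 (hσ : PolyBounded σ) : (protocol 𝒢 σ π).Simulatable .P2 := by
  refine simulatable_of_impl hσ ?_
  let κ : ∀ lam, 𝒢.Idx lam → Type := fun lam γ =>
    ZMod (𝒢.grp lam γ.1).p × ZMod (𝒢.grp lam γ.1).p × Bool
  let ec : Fld (fun lam => σ lam + lam) (SimIdx 𝒢 (fun lam => Inputs (σ lam)) κ) :=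
    exp (γ := fun _ y => y.1.2) fun _ y => y.2.1
  let er : Fld (fun lam => σ lam + lam) (SimIdx 𝒢 (fun lam => Inputs (σ lam)) κ) :=
    exp (γ := fun _ y => y.1.2) fun _ y => y.2.2.1
  let eb : Fld (fun lam => σ lam + lam) (SimIdx 𝒢 (fun lam => Inputs (σ lam)) κ) :=
    bit fun _ y => y.2.2.2
  refine (Impl.of_gen (κ := κ) (Q := fun _ _ => (PMF.uniformOfFintype _).indep
    ((PMF.uniformOfFintype _).indep (PMF.uniformOfFintype _))) (ec.append (er.append eb))
    (((setup fun _ y => y.1.2).append (elem (γ := fun _ y => y.1.2)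
      fun lam y => (𝒢.grp lam y.1.2.1).pow (𝒢.grp lam y.1.2.1).g y.2.1)).append (er.append eb))
    ?_ ?_).congr ?_
  · exact (Impl.exponent Det.refl).indep ((Impl.exponent Det.refl).indep Impl.coin)
  · intro src' _ _ hs hE
    exact (hs.append (hs.pow hs.generator (hE.trans Det.fst))).append (hE.trans Det.snd)
  · intro lam O x
    rw [protocol_map]
    congr 1
    funext γ
    simp only [κ, PMF.bind_const, view_P2, ← PMF.bind_pure_comp, PMF.bind_indep,
      Function.comp_def]
    congr 1
    funext c
    congr 1
    funext r
    rw [← bind_xor x.s]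
    congr 1
    funext s₁
    have hs : share₂ x.s (s₁ ^^ x.s) = s₁ := by simp [share₂]
    rw [List.append_assoc, hs]
    rfl

open Fld in
/-- The first server sees a uniform share, and a uniform group element with its complement. -/
theorem simulatable_P1 (hσ : PolyBounded σ) : (protocol 𝒢 σ π).Simulatable .P1 := by
  refine simulatable_of_impl hσ ?_
  let κ : ∀ lam, 𝒢.Idx lam → Type := fun lam γ =>
    ZMod (𝒢.grp lam γ.1).p × (ZMod (𝒢.grp lam γ.1).p × Bool) × ZMod (𝒢.grp lam γ.1).p
  let ec : Fld (fun lam => σ lam + lam) (SimIdx 𝒢 (fun lam => Inputs (σ lam)) κ) :=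
    exp (γ := fun _ y => y.1.2) fun _ y => y.2.1
  let er : Fld (fun lam => σ lam + lam) (SimIdx 𝒢 (fun lam => Inputs (σ lam)) κ) :=
    exp (γ := fun _ y => y.1.2) fun _ y => y.2.2.1.1
  let es : Fld (fun lam => σ lam + lam) (SimIdx 𝒢 (fun lam => Inputs (σ lam)) κ) :=
    bit fun _ y => y.2.2.1.2
  let eb : Fld (fun lam => σ lam + lam) (SimIdx 𝒢 (fun lam => Inputs (σ lam)) κ) :=
    exp (γ := fun _ y => y.1.2) fun _ y => y.2.2.2
  let C : ∀ lam, (y : SimIdx 𝒢 (fun lam => Inputs (σ lam)) κ lam) → 𝒢.At y.1.2 :=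
    fun lam y => (𝒢.grp lam y.1.2.1).pow (𝒢.grp lam y.1.2.1).g y.2.1
  let D : ∀ lam, (y : SimIdx 𝒢 (fun lam => Inputs (σ lam)) κ lam) → 𝒢.At y.1.2 :=
    fun lam y => (𝒢.grp lam y.1.2.1).pow (𝒢.grp lam y.1.2.1).g y.2.2.2
  refine (Impl.of_gen (κ := κ) (Q := fun _ _ => (PMF.uniformOfFintype _).indep
    (((PMF.uniformOfFintype _).indep (PMF.uniformOfFintype _)).indep (PMF.uniformOfFintype _)))
    (ec.append ((er.append es).append eb))
    (((setup fun _ y => y.1.2).append (elem C)).append ((er.append es).append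
      ((elem D).append (elem fun lam y => C lam y * (D lam y)⁻¹))))
    ?_ ?_).congr ?_
  · exact (Impl.exponent Det.refl).indep
      (((Impl.exponent Det.refl).indep Impl.coin).indep (Impl.exponent Det.refl))
  · intro src' _ _ hs hE
    have hC : Det src' (elem C) := hs.pow hs.generator (hE.trans Det.fst)
    have hD : Det src' (elem D) := hs.pow hs.generator (hE.trans (Det.snd.trans Det.snd))
    exact (hs.append hC).append ((hE.trans (Det.snd.trans Det.fst)).append
      (hD.append (hs.mul hC (hs.inv hD))))
  · intro lam O x
    rw [protocol_map]
    congr 1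
    funext γ
    simp only [κ, PMF.bind_const, view_P1, ← PMF.bind_pure_comp, PMF.bind_indep,
      Function.comp_def]
    congr 1
    funext c
    congr 1
    funext r
    rw [PMF.bind_comm]
    congr 1
    funext s₁
    rw [bind_genQuery₂ _ _ _ fun δ => PMF.pure (pk 𝒢 lam _ _ ++ _ ++ _ ++
      (𝒢.grp lam γ.1).str (δ false) ++ (𝒢.grp lam γ.1).str (δ true))]
    congr 1
    funext b
    simp [genQuery₂, append, C, D, pk, er, es, elem, setup, exp, digits, bit, GroupInst.expStr,
      div_eq_mul_inv]

open Fld in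
/-- The query issuer receives only the public key. -/
theorem simulatable_T (hσ : PolyBounded σ) : (protocol 𝒢 σ π).Simulatable .T := by
  refine simulatable_of_impl hσ ?_
  let κ : ∀ lam, 𝒢.Idx lam → Type := fun lam γ => ZMod (𝒢.grp lam γ.1).p × Bool × Bits lam
  let ec : Fld (fun lam => σ lam + lam) (SimIdx 𝒢 (fun lam => Inputs (σ lam)) κ) :=
    exp (γ := fun _ y => y.1.2) fun _ y => y.2.1
  let es : Fld (fun lam => σ lam + lam) (SimIdx 𝒢 (fun lam => Inputs (σ lam)) κ) :=
    bit fun _ y => y.2.2.1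
  let eb : Fld (fun lam => σ lam + lam) (SimIdx 𝒢 (fun lam => Inputs (σ lam)) κ) :=
    bits .id fun _ _ y => y.2.2.2
  refine (Impl.of_gen (κ := κ) (Q := fun _ _ => (PMF.uniformOfFintype _).indep
    ((PMF.uniformOfFintype _).indep (PMF.uniformOfFintype _))) (ec.append (es.append eb))
    (((partyFld hσ .T).comap fun _ y => y.1.1).append ((es.append eb).append
      ((setup fun _ y => y.1.2).append (elem (γ := fun _ y => y.1.2)
      fun lam y => (𝒢.grp lam y.1.2.1).pow (𝒢.grp lam y.1.2.1).g y.2.1))))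
    ?_ ?_).congr ?_
  · exact (Impl.exponent Det.refl).indep (Impl.coin.indep (Impl.coins .id))
  · intro src' hx _ hs hE
    exact hx.append ((hE.trans Det.snd).append
      (hs.append (hs.pow hs.generator (hE.trans Det.fst))))
  · intro lam O x
    rw [protocol_map]
    congr 1
    funext γ
    simp only [κ, PMF.bind_const, view_T, ← PMF.bind_pure_comp, PMF.bind_indep, Function.comp_def]
    rfl

open Fld in
/-- The two keys that the sender receives are a uniform group element and its complement. -/
theorem simulatable_S (hσ : PolyBounded σ) (hπ : ∀ lam, SecurePermutation (π lam)) :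
    (protocol 𝒢 σ π).Simulatable .S := by
  refine simulatable_of_impl hσ ?_
  let κ : ∀ lam, 𝒢.Idx lam → Type := fun lam γ => ZMod (𝒢.grp lam γ.1).p ×
    ((ZMod (𝒢.grp lam γ.1).p × ZMod (𝒢.grp lam γ.1).p × Bool) ×
      Bits lam × ZMod (𝒢.grp lam γ.1).p)
  let ec : Fld (fun lam => σ lam + lam) (SimIdx 𝒢 (fun lam => Inputs (σ lam)) κ) :=
    exp (γ := fun _ y => y.1.2) fun _ y => y.2.1
  let ey : Fld (fun lam => σ lam + lam) (SimIdx 𝒢 (fun lam => Inputs (σ lam)) κ) :=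
    (exp (γ := fun _ y => y.1.2) fun _ y => y.2.2.1.1).append
      ((exp (γ := fun _ y => y.1.2) fun _ y => y.2.2.1.2.1).append (bit fun _ y => y.2.2.1.2.2))
  let er : Fld (fun lam => σ lam + lam) (SimIdx 𝒢 (fun lam => Inputs (σ lam)) κ) :=
    bits .id fun _ _ y => y.2.2.2.1
  let eb : Fld (fun lam => σ lam + lam) (SimIdx 𝒢 (fun lam => Inputs (σ lam)) κ) :=
    exp (γ := fun _ y => y.1.2) fun _ y => y.2.2.2.2
  let C : ∀ lam, (y : SimIdx 𝒢 (fun lam => Inputs (σ lam)) κ lam) → 𝒢.At y.1.2 :=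
    fun lam y => (𝒢.grp lam y.1.2.1).pow (𝒢.grp lam y.1.2.1).g y.2.1
  let D : ∀ lam, (y : SimIdx 𝒢 (fun lam => Inputs (σ lam)) κ lam) → 𝒢.At y.1.2 :=
    fun lam y => (𝒢.grp lam y.1.2.1).pow (𝒢.grp lam y.1.2.1).g y.2.2.2.2
  refine (Impl.of_gen (κ := κ) (Q := fun _ _ => (PMF.uniformOfFintype _).indep
    (((PMF.uniformOfFintype _).indep ((PMF.uniformOfFintype _).indep
      (PMF.uniformOfFintype _))).indep ((PMF.uniformOfFintype _).indep (PMF.uniformOfFintype _))))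
    (ec.append (ey.append (er.append eb)))
    (((partyFld hσ .S).comap fun _ y => y.1.1).append ((genCoins fun _ y => y.1.2).append
      ((elem C).append (ey.append (((setup fun _ y => y.1.2).append (elem C)).append
        (er.append ((elem D).append (elem fun lam y => C lam y * (D lam y)⁻¹))))))))
    ?_ ?_).congr ?_
  · exact (Impl.exponent Det.refl).indep (((Impl.exponent Det.refl).indep
      ((Impl.exponent Det.refl).indep Impl.coin)).indep
        ((Impl.coins .id).indep (Impl.exponent Det.refl)))
  · intro src' hx hω hs hE
    have hC : Det src' (elem C) := hs.pow hs.generator (hE.trans Det.fst)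
    have hD : Det src' (elem D) :=
      hs.pow hs.generator (hE.trans (Det.snd.trans (Det.snd.trans Det.snd)))
    exact hx.append (hω.append (hC.append ((hE.trans (Det.snd.trans Det.fst)).append
      ((hs.append hC).append ((hE.trans (Det.snd.trans (Det.snd.trans Det.fst))).append
        (hD.append (hs.mul hC (hs.inv hD))))))))
  · intro lam O x
    rw [protocol_map]
    congr 1
    funext γ
    simp only [κ, bind_of_securePermutation (hπ lam), view_S, ← PMF.bind_pure_comp, PMF.bind_indep,
      Function.comp_def]
    congr 1
    funext c
    congr 1
    funext y₀
    congr 1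
    funext y₁
    congr 1
    funext j
    -- The two keys are uniform and complementary for all fixed `r₁`, `s₁` and `r₃`.
    have h : ∀ (r₁ : ZMod (𝒢.grp lam γ.1).p) (s₁ : Bool) (F : Bits lam →
        (Bool → (𝒢.grp lam γ.1).Carrier) → PMF (List Bool)),
        ((PMF.uniformOfFintype (ZMod (𝒢.grp lam γ.1).p)).bind fun r₂ =>
          (PMF.uniformOfFintype (Bits lam)).bind fun r₃ => F r₃ (genQuery₁ (𝒢.grp lam γ.1)
            (genQuery₂ (𝒢.grp lam γ.1) ((𝒢.grp lam γ.1).pow (𝒢.grp lam γ.1).g c)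
              (share₂ x.s s₁) r₂) s₁ r₁)) =
        (PMF.uniformOfFintype (Bits lam)).bind fun r₃ =>
          (PMF.uniformOfFintype (ZMod (𝒢.grp lam γ.1).p)).bind fun b => F r₃
            (genQuery₂ (𝒢.grp lam γ.1) ((𝒢.grp lam γ.1).pow (𝒢.grp lam γ.1).g c) false b) := by
      intro r₁ s₁ F
      rw [PMF.bind_comm]
      congr 1
      funext r₃
      exact bind_genQuery₁ _ _ _ _ _ _
    have h' : ∀ r₁ : ZMod (𝒢.grp lam γ.1).p, _ := fun r₁ => PMF.bind_comm
      (PMF.uniformOfFintype (ZMod (𝒢.grp lam γ.1).p)) (PMF.uniformOfFintype Bool) fun r₂ s₁ =>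
        (PMF.uniformOfFintype (Bits lam)).bind fun r₃ => PMF.pure (x.ofParty .S ++ List.ofFn γ.1 ++
          (𝒢.grp lam γ.1).str ((𝒢.grp lam γ.1).pow (𝒢.grp lam γ.1).g c) ++
          (𝒢.grp lam γ.1).expStr lam y₀ ++ (𝒢.grp lam γ.1).expStr lam y₁ ++ [j] ++
          pk 𝒢 lam γ.1 ((𝒢.grp lam γ.1).pow (𝒢.grp lam γ.1).g c) ++ List.ofFn r₃ ++
          (𝒢.grp lam γ.1).str (genQuery₁ (𝒢.grp lam γ.1) (genQuery₂ (𝒢.grp lam γ.1)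
            ((𝒢.grp lam γ.1).pow (𝒢.grp lam γ.1).g c) (share₂ x.s s₁) r₂) s₁ r₁ false) ++
          (𝒢.grp lam γ.1).str (genQuery₁ (𝒢.grp lam γ.1) (genQuery₂ (𝒢.grp lam γ.1)
            ((𝒢.grp lam γ.1).pow (𝒢.grp lam γ.1).g c) (share₂ x.s s₁) r₂) s₁ r₁ true))
    have hj : (if j then Equiv.boolNot else Equiv.refl Bool) false = j := by cases j <;> rfl
    simp only [hj, if_true, Bool.false_eq_true, if_false]
    simp only [h']
    simp only [h _ _ fun r₃ β => PMF.pure (x.ofParty .S ++ List.ofFn γ.1 ++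
          (𝒢.grp lam γ.1).str ((𝒢.grp lam γ.1).pow (𝒢.grp lam γ.1).g c) ++
          (𝒢.grp lam γ.1).expStr lam y₀ ++ (𝒢.grp lam γ.1).expStr lam y₁ ++ [j] ++
          pk 𝒢 lam γ.1 ((𝒢.grp lam γ.1).pow (𝒢.grp lam γ.1).g c) ++ List.ofFn r₃ ++
          (𝒢.grp lam γ.1).str (β false) ++ (𝒢.grp lam γ.1).str (β true)), PMF.bind_const]
    congr 1
    funext r₃
    congr 1
    funext b
    simp [genQuery₂, append, C, D, pk, er, ey, elem, setup, exp, digits, bit, bits, genCoins,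
      partyFld, comap, GroupInst.expStr, Inputs.functionality, div_eq_mul_inv]

end DUQOT

/-! ### Expectations -/

namespace PMF

variable {α β δ : Type*}

/-- The expectation of a nonnegative function. -/
noncomputable def mean (p : PMF α) (f : α → ℝ≥0∞) : ℝ≥0∞ := ∑' a, p a * f a

theorem bind_apply_eq_mean (p : PMF α) (f : α → PMF β) (b : β) :
    (p.bind f) b = p.mean fun a => f a b := rfl

theorem mean_mono (p : PMF α) {f g : α → ℝ≥0∞} (h : ∀ a, f a ≤ g a) : p.mean f ≤ p.mean g :=
  ENNReal.tsum_le_tsum fun a => mul_le_mul_right (h a) _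

theorem mean_add (p : PMF α) (f g : α → ℝ≥0∞) :
    (p.mean fun a => f a + g a) = p.mean f + p.mean g := by
  simp only [mean, mul_add]
  exact ENNReal.tsum_add

theorem mean_const (p : PMF α) (c : ℝ≥0∞) : (p.mean fun _ => c) = c := by
  rw [mean, ENNReal.tsum_mul_right, p.tsum_coe, one_mul]

theorem mean_sum {ι : Type*} (p : PMF α) (s : Finset ι) (f : ι → α → ℝ≥0∞) :
    (p.mean fun a => ∑ i ∈ s, f i a) = ∑ i ∈ s, p.mean (f i) := by
  simp only [mean, Finset.mul_sum]
  exact Summable.tsum_finsetSum fun _ _ => ENNReal.summable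

theorem mean_comm (p : PMF α) (q : PMF β) (f : α → β → ℝ≥0∞) :
    (p.mean fun a => q.mean (f a)) = q.mean fun b => p.mean fun a => f a b := by
  simp only [mean, ← ENNReal.tsum_mul_left]
  rw [ENNReal.tsum_comm]
  congr 1; funext b; congr 1; funext a
  ring

theorem mean_indep (p : PMF α) (q : PMF β) (f : α × β → ℝ≥0∞) :
    (p.indep q).mean f = p.mean fun a => q.mean fun b => f (a, b) := by
  simp only [mean, indep_apply, ← ENNReal.tsum_mul_left, mul_assoc]
  exact ENNReal.tsum_prod'

theorem mean_uniformOfFintype_equiv [Fintype α] [Nonempty α] [Fintype β] [Nonempty β] (e : α ≃ β)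
    (f : β → ℝ≥0∞) :
    ((uniformOfFintype α).mean fun a => f (e a)) = (uniformOfFintype β).mean f := by
  simp only [mean, uniformOfFintype_apply, Fintype.card_congr e]
  exact e.tsum_eq fun b => (Fintype.card β : ℝ≥0∞)⁻¹ * f b

theorem mean_uniformOfFintype_prod [Fintype α] [Nonempty α] [Fintype β] [Nonempty β]
    (f : α × β → ℝ≥0∞) : (uniformOfFintype (α × β)).mean f =
      (uniformOfFintype α).mean fun a => (uniformOfFintype β).mean fun b => f (a, b) := by
  rw [← indep_uniformOfFintype, mean_indep]

theorem mean_uniformOfFintype_eq [Fintype α] [Nonempty α] [DecidableEq α] (a₀ : α) :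
    ((uniformOfFintype α).mean fun a => if a = a₀ then 1 else 0) =
      (Fintype.card α : ℝ≥0∞)⁻¹ := by
  rw [mean, tsum_eq_single a₀]
  · simp
  · intro a ha
    simp [ha]

theorem lintegral_mean {n : ℕ} [Countable α] (p : PMF α) {f : α → RO n → ℝ≥0∞}
    (hf : ∀ a, Measurable (f a)) :
    ∫⁻ O, p.mean (fun a => f a O) ∂roMeasure n = p.mean fun a => ∫⁻ O, f a O ∂roMeasure n := by
  simp only [mean]
  rw [lintegral_tsum fun a => ((hf a).const_mul _).aemeasurable]
  congr 1
  funext a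
  rw [lintegral_const_mul _ (hf a)]

end PMF

/-! ### Reprogramming the oracle at one string -/

/-- The program that outputs the query at the instruction with index `j`. -/
def Prog.probe (A : Prog) (j : ℕ) : Prog :=
  match A.code[j]? with
  | some (.query w src _) => ⟨A.code.take j, src, w⟩
  | _ => ⟨[], 0, 0⟩

theorem Prog.size_probe_le (A : Prog) (j : ℕ) : (A.probe j).size ≤ A.size := by
  unfold probe
  split
  · rename_i w src dst h
    obtain ⟨hj, h⟩ := List.getElem?_eq_some_iff.1 h
    simp only [size]
    conv_rhs => rw [← List.take_append_drop j A.code, List.drop_eq_getElem_cons hj, h]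
    simp only [List.map_append, List.sum_append, List.map_cons, List.sum_cons, Instr.cost]
    omega
  · simp [size]

/-- The probability that the instruction with index `j` queries `k`. -/
noncomputable def hitProb {n : ℕ} (O : RO n) (k : List Bool) (l : List Instr) (j : ℕ) (m : Mem) :
    ℝ≥0∞ :=
  match l[j]? with
  | some (.query w src _) => ((execAll O (l.take j) m).map fun m => m.read src w) k
  | _ => 0

theorem hitProb_succ {n : ℕ} (O : RO n) (k : List Bool) (i : Instr) (l : List Instr) (j : ℕ)
    (m : Mem) : hitProb O k (i :: l) (j + 1) m =
      (i.exec O m).mean fun m' => hitProb O k l j m' := by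
  unfold hitProb
  rw [List.getElem?_cons_succ]
  split
  · rw [List.take_succ_cons, execAll, PMF.map_bind]
    rfl
  · rw [PMF.mean_const]

theorem hitProb_eq_probe_run_le {n : ℕ} (O : RO n) (k s : List Bool) (A : Prog) (j : ℕ) :
    hitProb O k A.code j (Mem.ofInput s) ≤ (A.probe j).run O s k := by
  unfold hitProb Prog.probe
  split
  · exact le_rfl
  · exact zero_le

/-- Up to the first query of `k`, the runs with both oracles agree. -/
theorem map_execAll_le_add {n : ℕ} {O O' : RO n} {k : List Bool} (h : ∀ q, q ≠ k → O q = O' q)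
    {β : Type*} (g : Mem → β) (o : β) (l : List Instr) (m : Mem) :
    ((execAll O l m).map g) o ≤ ((execAll O' l m).map g) o +
        ∑ j ∈ Finset.range l.length, hitProb O k l j m ∧
    ((execAll O' l m).map g) o ≤ ((execAll O l m).map g) o +
        ∑ j ∈ Finset.range l.length, hitProb O k l j m := by
  induction l generalizing m with
  | nil => exact ⟨le_self_add, le_self_add⟩
  | cons i l ih =>
    rw [List.length_cons, Finset.sum_range_succ']
    simp only [hitProb_succ]
    by_cases hi : i.exec O m = i.exec O' m
    · simp only [execAll, PMF.map_bind, ← hi, PMF.bind_apply_eq_mean]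
      rw [← PMF.mean_sum, ← add_assoc, ← PMF.mean_add, ← add_assoc, ← PMF.mean_add]
      exact ⟨(PMF.mean_mono _ fun m' => (ih m').1).trans le_self_add,
        (PMF.mean_mono _ fun m' => (ih m').2).trans le_self_add⟩
    · have h1 : hitProb O k (i :: l) 0 m = 1 := by
        cases i with
        | query w src dst =>
          have hk : m.read src w = k := by
            by_contra hk
            exact hi (by simp only [Instr.exec]; rw [h _ hk])
          simp [hitProb, execAll, PMF.pure_map, hk]
        | _ => exact absurd rfl hi
      rw [h1]
      have h2 : ∀ (p : PMF β) (a b : ℝ≥0∞), p o ≤ a + (b + 1) := fun p a b =>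
        (p.coe_le_one o).trans (le_add_left (le_add_left le_rfl))
      exact ⟨h2 _ _ _, h2 _ _ _⟩

/-- Identical until bad: a program notices that the oracle is changed at `k` only if it
queries `k`. -/
theorem Prog.run_le_add_probe {n : ℕ} {O O' : RO n} {k : List Bool}
    (h : ∀ q, q ≠ k → O q = O' q) (A : Prog) (s o : List Bool) :
    A.run O s o ≤ A.run O' s o + ∑ j ∈ Finset.range A.code.length, (A.probe j).run O s k ∧
    A.run O' s o ≤ A.run O s o + ∑ j ∈ Finset.range A.code.length, (A.probe j).run O s k := by
  obtain ⟨h1, h2⟩ := map_execAll_le_add h (fun m => m.read A.out A.outLen) o A.code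
    (Mem.ofInput s)
  have h3 := Finset.sum_le_sum fun j (_ : j ∈ Finset.range A.code.length) =>
    hitProb_eq_probe_run_le O k s A j
  exact ⟨h1.trans (add_le_add_right h3 _), h2.trans (add_le_add_right h3 _)⟩

/-! ### Negligible functions -/

namespace Negligible

theorem mono {f g : ℕ → ℝ} (hg : Negligible g) (h0 : ∀ lam, 0 ≤ f lam)
    (h : ∀ lam, f lam ≤ g lam) : Negligible f :=
  Asymptotics.SuperpolynomialDecay.trans_abs_le hg fun lam => by
    simp only [abs_of_nonneg (h0 lam)]
    exact (h lam).trans (le_abs_self _)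

theorem add {f g : ℕ → ℝ} (hf : Negligible f) (hg : Negligible g) :
    Negligible fun lam => f lam + g lam :=
  Asymptotics.SuperpolynomialDecay.add hf hg

theorem const_mul {f : ℕ → ℝ} (hf : Negligible f) (c : ℝ) : Negligible fun lam => c * f lam :=
  Asymptotics.SuperpolynomialDecay.const_mul hf c

theorem polyBounded_mul {f : ℕ → ℝ} {N : ℕ → ℕ} (hN : PolyBounded N) (hf : Negligible f)
    (h0 : ∀ lam, 0 ≤ f lam) : Negligible fun lam => N lam * f lam := by
  obtain ⟨q, hq⟩ := hN
  have h := Asymptotics.SuperpolynomialDecay.polynomial_mul hf (q.map (Nat.castRingHom ℝ))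
  refine mono h (fun lam => mul_nonneg (Nat.cast_nonneg _) (h0 lam)) fun lam =>
    mul_le_mul_of_nonneg_right ?_ (h0 lam)
  have : (q.map (Nat.castRingHom ℝ)).eval (lam : ℝ) = ((q.eval lam : ℕ) : ℝ) := by
    rw [Polynomial.eval_natCast_map]
    rfl
  rw [this]
  exact_mod_cast hq lam

theorem two_pow : Negligible fun lam => (2 ^ lam : ℝ)⁻¹ := by
  intro k
  have := tendsto_pow_const_div_const_pow_of_one_lt k (one_lt_two (α := ℝ))
  simpa only [div_eq_mul_inv] using this

end Negligible

namespace DUQOT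

/-! ### The run of the protocol from the point of view of the receiver -/

/-- The exponent with which the receiver decrypts. -/
def secretExp {p : ℕ} (r₁ r₂ : ZMod p) (s₂ : Bool) : ZMod p := r₂ + r₁ * (-1) ^ s₂.toNat

/-- The random choices behind the view of the receiver, apart from `C`, and the exponent
of the ciphertext that the receiver cannot decrypt: `r₁`, `r₂`, the exponent `y` of the other
ciphertext, the share `s₂`, the position `t` of this other ciphertext, and the tag `r₃`. -/
abbrev Choices (p lam : ℕ) : Type := (ZMod p × ZMod p × ZMod p) × Bool × Bool × Bits lam

/-- All random choices of a run: an exponent of `C`, the exponent of the ciphertext that the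
receiver cannot decrypt, and the others. -/
abbrev AllChoices (p lam : ℕ) : Type := ZMod p × ZMod p × Choices p lam

/-- The tag part of a string. -/
def tag {σ lam : ℕ} (a : Bits (σ + lam)) : Bits lam := fun j => a (Fin.natAdd σ j)

section

variable {ℓ : ℕ} (I : GroupInst ℓ) {lam : ℕ}

/-- The key `g ^ x` that belongs to the message that the receiver obtains. -/
def openKey (ρ : Choices I.p lam) : I.Carrier := I.pow I.g (secretExp ρ.1.1 ρ.1.2.1 ρ.2.1)

/-- The oracle query that opens the message of the receiver. -/
def openQuery (ρ : Choices I.p lam) : List Bool := I.str (I.pow (openKey I ρ) ρ.1.2.2)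

/-- The oracle query that opens the message that the receiver must not obtain. -/
def hiddenQuery (C : I.Carrier) (z : ZMod I.p) (ρ : Choices I.p lam) : List Bool :=
  I.str (I.pow (C / openKey I ρ) z)

/-- The oracle query by which the receiver tries to open the hidden message. -/
def wrongQuery (z : ZMod I.p) (ρ : Choices I.p lam) : List Bool := I.str (I.pow (openKey I ρ) z)

variable {σ : ℕ}

/-- The payload of the ciphertext that the receiver can open. -/
def openCipher (G : RO (σ + lam)) (m : Bits σ) (ρ : Choices I.p lam) : Bits (σ + lam) :=
  xorBits (G (openQuery I ρ)) (Fin.append m ρ.2.2.2)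

/-- The two ciphertexts: `(Y, u)` in position `t`, and `(Z, v)` in the other one. -/
def pairAt {α β : Type} (t : Bool) (Y Z : α) (u v : β) : Bool → α × β := fun i =>
  if i = t then (Y, u) else (Z, v)

theorem xorBits_xorBits {k : ℕ} (a b : Bits k) : xorBits a (xorBits a b) = b := by
  funext i
  simp [xorBits]

/-- The receiver finds its message, unless a wrong decryption ends with the tag. -/
theorem retrieve_pairAt (G : RO (σ + lam)) (m : Bits σ) (z : ZMod I.p) (ρ : Choices I.p lam)
    (v : Bits (σ + lam)) (hv : tag (xorBits (G (wrongQuery I z ρ)) v) ≠ ρ.2.2.2) :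
    retrieve I G (pairAt ρ.2.2.1 (I.pow I.g ρ.1.2.2) (I.pow I.g z) (openCipher I G m ρ) v)
      ρ.1.1 ρ.1.2.1 ρ.2.1 ρ.2.2.2 = some m := by
  have h1 : I.pow (I.pow I.g ρ.1.2.2) (ρ.1.2.1 + ρ.1.1 * (-1) ^ ρ.2.1.toNat) =
      I.pow (openKey I ρ) ρ.1.2.2 := I.pow_comm _ _ _
  have h2 : I.pow (I.pow I.g z) (ρ.1.2.1 + ρ.1.1 * (-1) ^ ρ.2.1.toNat) =
      I.pow (openKey I ρ) z := I.pow_comm _ _ _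
  have h3 : ¬ (fun j => xorBits (G (I.str (I.pow (openKey I ρ) z))) v (Fin.natAdd σ j)) =
      ρ.2.2.2 := hv
  have h4 : xorBits (G (I.str (I.pow (openKey I ρ) ρ.1.2.2))) (openCipher I G m ρ) =
      Fin.append m ρ.2.2.2 := xorBits_xorBits _ _
  cases ht : ρ.2.2.1 <;>
    simp only [retrieve, List.foldl, pairAt, if_true, Bool.false_eq_true, Bool.true_eq_false,
      if_false, h1, h2, h4, Fin.append_left, Fin.append_right, if_neg h3]

/-- With permutation bit `s ⊕ t`, the response has the ciphertext of `m_s` in position `t`. -/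
theorem genRes_eq (G : RO (σ + lam)) (C : I.Carrier) (m : Bool → Bits σ) (s : Bool)
    (z : ZMod I.p) (ρ : Choices I.p lam) :
    genRes I G C m ρ.2.2.2 (fun b => if b = s then ρ.1.2.2 else z)
        (if s ^^ ρ.2.2.1 then Equiv.boolNot else Equiv.refl Bool)
        (genQuery₁ I (genQuery₂ I C (share₂ s (ρ.2.1 ^^ s)) ρ.1.2.1) (ρ.2.1 ^^ s) ρ.1.1) =
      some (pairAt ρ.2.2.1 (I.pow I.g ρ.1.2.2) (I.pow I.g z) (openCipher I G (m s) ρ)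
        (xorBits (G (hiddenQuery I C z ρ)) (Fin.append (m !s) ρ.2.2.2))) := by
  have hs : share₂ s (ρ.2.1 ^^ s) = ρ.2.1 := by simp [share₂]
  rw [genQuery₁_genQuery₂, hs, genRes, if_neg (by rw [genQuery₂_mul]; simp)]
  refine congrArg some (funext fun i => ?_)
  cases hs : s <;> cases ht : ρ.2.2.1 <;> cases i <;>
    simp [pairAt, genQuery₂, openCipher, openQuery, hiddenQuery, openKey, secretExp]

end

variable (𝒢 : GroupScheme) {σ : ℕ → ℕ} {π : ℕ → PMF (Equiv.Perm Bool)} (lam : ℕ)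

/-- The string that represents the view of the receiver. -/
def receiverView {k : ℕ} (ω : Bits (𝒢.coinLen lam)) (C Z : (𝒢.grp lam ω).Carrier)
    (ρ : Choices (𝒢.grp lam ω).p lam) (u v : Bits k) (out : List Bool) : List Bool :=
  (𝒢.grp lam ω).expStr lam ρ.1.1 ++ (𝒢.grp lam ω).expStr lam ρ.1.2.1 ++ pk 𝒢 lam ω C ++
    ρ.2.1 :: List.ofFn ρ.2.2.2 ++
    (𝒢.grp lam ω).str (pairAt ρ.2.2.1 ((𝒢.grp lam ω).pow (𝒢.grp lam ω).g ρ.1.2.2) Z u v false).1 ++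
    List.ofFn (pairAt ρ.2.2.1 ((𝒢.grp lam ω).pow (𝒢.grp lam ω).g ρ.1.2.2) Z u v false).2 ++
    (𝒢.grp lam ω).str (pairAt ρ.2.2.1 ((𝒢.grp lam ω).pow (𝒢.grp lam ω).g ρ.1.2.2) Z u v true).1 ++
    List.ofFn (pairAt ρ.2.2.1 ((𝒢.grp lam ω).pow (𝒢.grp lam ω).g ρ.1.2.2) Z u v true).2 ++ out

/-- The run of the protocol with given choices. -/
noncomputable def runOf (G : RO (σ lam + lam)) (x : Inputs (σ lam)) (γ : 𝒢.Idx lam)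
    (q : AllChoices (𝒢.grp lam γ.1).p lam) : Execution :=
  execution 𝒢 lam G x ⟨γ.1, (𝒢.grp lam γ.1).pow (𝒢.grp lam γ.1).g q.1,
    fun b => if b = x.s then q.2.2.1.2.2 else q.2.1,
    if x.s ^^ q.2.2.2.2.1 then Equiv.boolNot else Equiv.refl Bool⟩ q.2.2.1.1 q.2.2.1.2.1
    (q.2.2.2.1 ^^ x.s) q.2.2.2.2.2

/-- The law of a run in terms of the relabelled choices: `s₂` instead of `s₁`, the exponents
ordered by the index of the message, and the position of `m_s` instead of the permutation. -/
theorem protocol_map_eq_runOf (hπ : ∀ lam, SecurePermutation (π lam)) (O : RO (σ lam + lam))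
    (x : Inputs (σ lam)) {δ : Type*} (F : Execution → δ) :
    (protocol 𝒢 σ π lam O x).map F = (𝒢.rand lam).onSupport.bind fun γ =>
      (PMF.uniformOfFintype (AllChoices (𝒢.grp lam γ.1).p lam)).bind fun q =>
        PMF.pure (F (runOf 𝒢 lam O x γ q)) := by
  rw [protocol_map]
  congr 1
  funext γ
  simp only [bind_of_securePermutation (hπ lam), ← PMF.bind_pure_comp]
  let Z := ZMod (𝒢.grp lam γ.1).p
  let e : AllChoices (𝒢.grp lam γ.1).p lam ≃ Z × Z × Z × Bool × Z × Z × Bool × Bits lam :=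
    { toFun := fun q => (q.1, if false = x.s then q.2.2.1.2.2 else q.2.1,
        if true = x.s then q.2.2.1.2.2 else q.2.1, x.s ^^ q.2.2.2.2.1, q.2.2.1.1, q.2.2.1.2.1,
        q.2.2.2.1 ^^ x.s, q.2.2.2.2.2)
      invFun := fun w => (w.1, if x.s then w.2.1 else w.2.2.1, (w.2.2.2.2.1, w.2.2.2.2.2.1,
        if x.s then w.2.2.1 else w.2.1), w.2.2.2.2.2.2.1 ^^ x.s, x.s ^^ w.2.2.2.1,
        w.2.2.2.2.2.2.2)
      left_inv := fun q => by cases x.s <;> simp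
      right_inv := fun w => by cases x.s <;> simp }
  have h := PMF.bind_uniformOfFintype_equiv e fun w => PMF.pure (F (execution 𝒢 lam O x
    ⟨γ.1, (𝒢.grp lam γ.1).pow (𝒢.grp lam γ.1).g w.1, fun b => if b then w.2.2.1 else w.2.1,
      if w.2.2.2.1 then Equiv.boolNot else Equiv.refl Bool⟩ w.2.2.2.2.1 w.2.2.2.2.2.1
      w.2.2.2.2.2.2.1 w.2.2.2.2.2.2.2))
  have h' : ∀ q : AllChoices (𝒢.grp lam γ.1).p lam, execution 𝒢 lam O x
      ⟨γ.1, (𝒢.grp lam γ.1).pow (𝒢.grp lam γ.1).g (e q).1,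
        fun b => if b then (e q).2.2.1 else (e q).2.1,
        if (e q).2.2.2.1 then Equiv.boolNot else Equiv.refl Bool⟩ (e q).2.2.2.2.1
        (e q).2.2.2.2.2.1 (e q).2.2.2.2.2.2.1 (e q).2.2.2.2.2.2.2 = runOf 𝒢 lam O x γ q := by
    intro q
    have : (fun b : Bool => if b then (e q).2.2.1 else (e q).2.1) =
        fun b => if b = x.s then q.2.2.1.2.2 else q.2.1 := by
      funext b
      cases b <;> simp [e]
    rw [this]
    rfl
  simp only [h'] at h
  rw [h]
  simp only [Z, ← PMF.indep_uniformOfFintype, PMF.bind_indep]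
  rfl

section

variable {lam} (O : RO (σ lam + lam)) (x : Inputs (σ lam)) (γ : 𝒢.Idx lam)
  (q : AllChoices (𝒢.grp lam γ.1).p lam)

/-- The key of the hidden message. -/
abbrev hiddenQueryOf : List Bool :=
  hiddenQuery (𝒢.grp lam γ.1) ((𝒢.grp lam γ.1).pow (𝒢.grp lam γ.1).g q.1) q.2.1 q.2.2

/-- The query by which the receiver tries to open the hidden message. -/
abbrev wrongQueryOf : List Bool := wrongQuery (𝒢.grp lam γ.1) q.2.1 q.2.2

/-- The view of the receiver, with the payload `a` of the hidden ciphertext, and the correct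
output. -/
def idealView (m : Bits (σ lam)) (a : Bits (σ lam + lam)) : List Bool :=
  receiverView 𝒢 lam γ.1 ((𝒢.grp lam γ.1).pow (𝒢.grp lam γ.1).g q.1)
    ((𝒢.grp lam γ.1).pow (𝒢.grp lam γ.1).g q.2.1) q.2.2
    (openCipher (𝒢.grp lam γ.1) O m q.2.2) a (List.ofFn m)

variable {O x γ q}

/-- All parties have the right output, unless the decryption of the hidden ciphertext with the
wrong key has the right tag, i.e. unless the oracle gives the same tag at two strings. -/
theorem output_runOf (h : tag (O (wrongQueryOf 𝒢 γ q)) ≠ tag (O (hiddenQueryOf 𝒢 γ q)))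
    (P : Party) : (runOf 𝒢 lam O x γ q).output P = some (x.functionality P) := by
  have hres := genRes_eq (𝒢.grp lam γ.1) O ((𝒢.grp lam γ.1).pow (𝒢.grp lam γ.1).g q.1) x.m x.s
    q.2.1 q.2.2
  have hret := retrieve_pairAt (𝒢.grp lam γ.1) O (x.m x.s) q.2.1 q.2.2
    (xorBits (O (hiddenQueryOf 𝒢 γ q)) (Fin.append (x.m !x.s) q.2.2.2.2.2)) fun h' => h (by
      funext j
      have := congrFun h' j
      simp only [tag, xorBits, Fin.append_right] at this ⊢
      revert this
      cases O (wrongQueryOf 𝒢 γ q) (Fin.natAdd (σ lam) j) <;>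
        cases O (hiddenQueryOf 𝒢 γ q) (Fin.natAdd (σ lam) j) <;> simp)
  have hs : share₂ x.s (q.2.2.2.1 ^^ x.s) = q.2.2.2.1 := by simp [share₂]
  cases P with
  | R =>
    simp only [runOf, execution, hres, Option.bind_some]
    rw [hs, hret]
    rfl
  | S => simp only [runOf, execution, hres]; rfl
  | _ => rfl

theorem view_runOf (h : tag (O (wrongQueryOf 𝒢 γ q)) ≠ tag (O (hiddenQueryOf 𝒢 γ q))) :
    (runOf 𝒢 lam O x γ q).view x .R = idealView 𝒢 O γ q (x.m x.s)
      (xorBits (O (hiddenQueryOf 𝒢 γ q)) (Fin.append (x.m !x.s) q.2.2.2.2.2)) := by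
  have hout := output_runOf 𝒢 h (x := x) .R
  have hres := genRes_eq (𝒢.grp lam γ.1) O ((𝒢.grp lam γ.1).pow (𝒢.grp lam γ.1).g q.1) x.m x.s
    q.2.1 q.2.2
  have hs : share₂ x.s (q.2.2.2.1 ^^ x.s) = q.2.2.2.1 := by simp [share₂]
  rw [Execution.view, hout]
  simp only [runOf, execution, hres]
  simp [Inputs.ofParty, idealView, receiverView, hs, Inputs.functionality]

end

end DUQOT

/-! ### From the real view to the ideal view -/

theorem lintegral_roMeasure_update_mean {n : ℕ} (k : List Bool) {F : RO n → ℝ≥0∞}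
    (hF : Measurable F) :
    ∫⁻ O, F O ∂roMeasure n = (PMF.uniformOfFintype (Bits n)).mean fun a =>
      ∫⁻ O, F (Function.update O k a) ∂roMeasure n := by
  rw [lintegral_roMeasure_update k hF, PMF.mean, tsum_fintype]

theorem measurable_run {n W : ℕ} {V : RO n → List Bool} (hV : DependsUpTo W V) (A : Prog)
    (o : List Bool) : Measurable fun O => A.run O (V O) o := by
  obtain ⟨W', hA⟩ := A.exists_dependsUpTo_run
  refine DependsUpTo.measurable (W := W + W') fun O O' h => ?_
  have h1 : V O = V O' := hV _ _ fun q hq => h q (by omega)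
  have h2 : A.run O (V O') = A.run O' (V O') := hA n _ _ _ fun q hq => h q (by omega)
  simp only [h1, h2]

theorem lintegral_run_le_one {n : ℕ} (V : RO n → List Bool) (A : Prog) (o : List Bool) :
    ∫⁻ O, A.run O (V O) o ∂roMeasure n ≤ 1 :=
  (lintegral_mono fun O => PMF.coe_le_one _ _).trans (by simp)

namespace DUQOT

open Classical in
/-- A uniform string has a given tag with probability `2 ^ (-lam)`. -/
theorem mean_tag {σ lam : ℕ} (b : Bits lam) :
    ((PMF.uniformOfFintype (Bits (σ + lam))).mean fun a => if b = tag a then 1 else 0) =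
      (2 ^ lam : ℝ≥0∞)⁻¹ := by
  rw [← PMF.mean_uniformOfFintype_equiv (Fin.appendEquiv σ lam), PMF.mean_uniformOfFintype_prod]
  have : ∀ (u : Fin σ → Bool) (v : Fin lam → Bool),
      (if b = tag (Fin.appendEquiv σ lam (u, v)) then (1 : ℝ≥0∞) else 0) =
        if v = b then 1 else 0 := by
    intro u v
    have : tag (Fin.appendEquiv σ lam (u, v)) = v := by
      funext j
      simp [tag, Fin.appendEquiv]
    rw [this]
    simp only [eq_comm]
  simp only [this]
  rw [PMF.mean_const, PMF.mean_uniformOfFintype_eq]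
  simp

section

variable {σ lam : ℕ}

theorem measurableSet_tag_eq (k l : List Bool) :
    MeasurableSet {O : RO (σ + lam) | tag (O l) = tag (O k)} :=
  measurableSet_eq_fun (f := fun O : RO (σ + lam) => tag (O l)) (g := fun O => tag (O k))
    ((Measurable.of_discrete (f := tag)).comp (measurable_pi_apply l))
    ((Measurable.of_discrete (f := tag)).comp (measurable_pi_apply k))

open Classical in
theorem measurable_tag_eq (l : List Bool) (a : Bits (σ + lam)) :
    Measurable fun O : RO (σ + lam) => if tag (O l) = tag a then (1 : ℝ≥0∞) else 0 :=
  Measurable.of_discrete (f := fun b : Bits (σ + lam) => if tag b = tag a then (1 : ℝ≥0∞) else 0)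
    |>.comp (measurable_pi_apply l)

open Classical in
theorem mean_lintegral_tag_eq (l : List Bool) :
    ((PMF.uniformOfFintype (Bits (σ + lam))).mean fun a =>
      ∫⁻ O, (if tag (O l) = tag a then 1 else 0) ∂roMeasure (σ + lam)) = (2 ^ lam : ℝ≥0∞)⁻¹ := by
  rw [← PMF.lintegral_mean _ fun a => measurable_tag_eq l a]
  simp only [mean_tag, lintegral_const, measure_univ, mul_one]

open Classical in
/-- The oracle gives the same tag at two strings with probability `2 ^ (-lam)`. -/
theorem lintegral_tag_eq {k l : List Bool} (h : l ≠ k) :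
    ∫⁻ O, (if tag (O l) = tag (O k) then 1 else 0) ∂roMeasure (σ + lam) =
      (2 ^ lam : ℝ≥0∞)⁻¹ := by
  rw [lintegral_roMeasure_update_mean k
    (Measurable.ite (measurableSet_tag_eq k l) measurable_const measurable_const),
    ← mean_lintegral_tag_eq (σ := σ) l]
  simp only [Function.update_self, Function.update_of_ne h]

end

variable (𝒢 : GroupScheme) {σ : ℕ → ℕ} {lam : ℕ}

theorem dependsUpTo_runOf (x : Inputs (σ lam)) (γ : 𝒢.Idx lam)
    (q : AllChoices (𝒢.grp lam γ.1).p lam) :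
    DependsUpTo (𝒢.elemLen lam) fun O => runOf 𝒢 lam O x γ q := by
  intro O O' h
  have hstr : ∀ X : (𝒢.grp lam γ.1).Carrier,
      O ((𝒢.grp lam γ.1).str X) = O' ((𝒢.grp lam γ.1).str X) := fun X =>
    h _ (by simp [GroupInst.str])
  simp only [runOf, execution, genRes, retrieve, hstr]

theorem dependsUpTo_idealView (γ : 𝒢.Idx lam) (q : AllChoices (𝒢.grp lam γ.1).p lam)
    (m : Bits (σ lam)) (a : Bits (σ lam + lam)) :
    DependsUpTo (𝒢.elemLen lam) fun O => idealView 𝒢 O γ q m a := by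
  intro O O' h
  have : O (openQuery (𝒢.grp lam γ.1) q.2.2) = O' (openQuery (𝒢.grp lam γ.1) q.2.2) :=
    h _ (by simp [openQuery, GroupInst.str])
  simp only [idealView, openCipher, this]

/-- Choices of the protocol for which the key of the hidden message occurs elsewhere. -/
def Degenerate (γ : 𝒢.Idx lam) (q : AllChoices (𝒢.grp lam γ.1).p lam) : Prop :=
  openQuery (𝒢.grp lam γ.1) q.2.2 = hiddenQueryOf 𝒢 γ q ∨
    wrongQueryOf 𝒢 γ q = hiddenQueryOf 𝒢 γ q

/-- The probability that `D` accepts the view of the receiver, for given choices. -/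
noncomputable def realProb (D : Prog) (x : Inputs (σ lam)) (γ : 𝒢.Idx lam)
    (q : AllChoices (𝒢.grp lam γ.1).p lam) : ℝ≥0∞ :=
  ∫⁻ O, D.run O ((runOf 𝒢 lam O x γ q).view x .R) [true] ∂roMeasure (σ lam + lam)

/-- The probability that `A` outputs `o` on the ideal view, for given choices. -/
noncomputable def idealProb (A : Prog) (m : Bits (σ lam)) (γ : 𝒢.Idx lam)
    (q : AllChoices (𝒢.grp lam γ.1).p lam) (o : List Bool) : ℝ≥0∞ :=
  (PMF.uniformOfFintype (Bits (σ lam + lam))).mean fun a =>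
    ∫⁻ O, A.run O (idealView 𝒢 O γ q m a) o ∂roMeasure (σ lam + lam)

/-- The bound on the difference of the two probabilities, for given choices. -/
noncomputable def distance (D : Prog) (m : Bits (σ lam)) (γ : 𝒢.Idx lam)
    (q : AllChoices (𝒢.grp lam γ.1).p lam) : ℝ≥0∞ :=
  ∑ j ∈ Finset.range D.code.length, idealProb 𝒢 (D.probe j) m γ q (hiddenQueryOf 𝒢 γ q) +
    (2 ^ lam : ℝ≥0∞)⁻¹

variable {𝒢}

/-- The value at the hidden query of the oracle only matters for the payload of the hidden
ciphertext, unless the distinguisher makes this query. -/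
theorem realProb_idealProb_le (D : Prog) (x : Inputs (σ lam)) {γ : 𝒢.Idx lam}
    {q : AllChoices (𝒢.grp lam γ.1).p lam} (hq : ¬ Degenerate 𝒢 γ q) :
    realProb 𝒢 D x γ q ≤ idealProb 𝒢 D (x.m x.s) γ q [true] + distance 𝒢 D (x.m x.s) γ q ∧
    idealProb 𝒢 D (x.m x.s) γ q [true] ≤
      realProb 𝒢 D x γ q + distance 𝒢 D (x.m x.s) γ q := by
  classical
  obtain ⟨h1, h2⟩ := not_or.1 hq
  set k := hiddenQueryOf 𝒢 γ q with hk
  set l := wrongQueryOf 𝒢 γ q with hl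
  set m := x.m x.s with hm
  let n := σ lam + lam
  let V : RO n → List Bool := fun O => (runOf 𝒢 lam O x γ q).view x .R
  let c : Bits n := Fin.append (x.m !x.s) q.2.2.2.2.2
  have hreal : realProb 𝒢 D x γ q = (PMF.uniformOfFintype (Bits n)).mean fun a =>
      ∫⁻ O, D.run (Function.update O k a) (V (Function.update O k a)) [true] ∂roMeasure n :=
    lintegral_roMeasure_update_mean k (measurable_run
      ((dependsUpTo_runOf 𝒢 x γ q).comp fun e => e.view x .R) D [true])
  -- A uniform oracle value masks the other message.
  let e : Bits n ≃ Bits n := Function.Involutive.toPerm (fun a => xorBits a c) fun a => by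
    funext i; simp [xorBits]
  have hideal : ∀ (A : Prog) (o : List Bool), idealProb 𝒢 A m γ q o =
      (PMF.uniformOfFintype (Bits n)).mean fun a =>
        ∫⁻ O, A.run O (idealView 𝒢 O γ q m (e a)) o ∂roMeasure n := fun A o =>
    (PMF.mean_uniformOfFintype_equiv e fun a => ∫⁻ O, A.run O (idealView 𝒢 O γ q m a) o
      ∂roMeasure n).symm
  have hmeas : ∀ (A : Prog) (a : Bits n) (o : List Bool), Measurable fun O : RO n =>
      A.run O (idealView 𝒢 O γ q m a) o := fun A a o =>
    measurable_run (dependsUpTo_idealView 𝒢 γ q m a) A o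
  -- The comparison for one oracle, reprogrammed at the hidden query.
  have hone : ∀ (a : Bits n) (O : RO n),
      D.run (Function.update O k a) (V (Function.update O k a)) [true] ≤
        D.run O (idealView 𝒢 O γ q m (e a)) [true] +
          (∑ j ∈ Finset.range D.code.length, (D.probe j).run O (idealView 𝒢 O γ q m (e a)) k +
            if tag (O l) = tag a then 1 else 0) ∧
      D.run O (idealView 𝒢 O γ q m (e a)) [true] ≤
        D.run (Function.update O k a) (V (Function.update O k a)) [true] +
          (∑ j ∈ Finset.range D.code.length, (D.probe j).run O (idealView 𝒢 O γ q m (e a)) k +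
            if tag (O l) = tag a then 1 else 0) := by
    intro a O
    split_ifs with ht
    · exact ⟨(PMF.coe_le_one _ _).trans (le_add_left (le_add_left le_rfl)),
        (PMF.coe_le_one _ _).trans (le_add_left (le_add_left le_rfl))⟩
    · have hV : V (Function.update O k a) = idealView 𝒢 O γ q m (e a) := by
        have := view_runOf 𝒢 (O := Function.update O k a) (x := x) (γ := γ) (q := q) (by
          rw [← hk, ← hl, Function.update_self, Function.update_of_ne h2]
          exact ht)
        refine this.trans ?_
        rw [← hk, Function.update_self]
        simp only [idealView, openCipher, Function.update_of_ne h1]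
        rfl
      rw [hV, add_zero]
      exact (D.run_le_add_probe (O := O) (O' := Function.update O k a) (k := k)
        (fun q hq => (Function.update_of_ne hq _ _).symm) _ _).symm
  -- The same, integrated over the oracle and averaged over its value at the hidden query.
  have hdist : (PMF.uniformOfFintype (Bits n)).mean (fun a => ∫⁻ O,
      (∑ j ∈ Finset.range D.code.length, (D.probe j).run O (idealView 𝒢 O γ q m (e a)) k +
        if tag (O l) = tag a then 1 else 0) ∂roMeasure n) = distance 𝒢 D m γ q := by
    have : ∀ a, ∫⁻ O, (∑ j ∈ Finset.range D.code.length,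
        (D.probe j).run O (idealView 𝒢 O γ q m (e a)) k + if tag (O l) = tag a then 1 else 0)
          ∂roMeasure n = ∑ j ∈ Finset.range D.code.length,
            ∫⁻ O, (D.probe j).run O (idealView 𝒢 O γ q m (e a)) k ∂roMeasure n +
          ∫⁻ O, (if tag (O l) = tag a then 1 else 0) ∂roMeasure n := fun a => by
      rw [lintegral_add_right _ (measurable_tag_eq l a), lintegral_finsetSum _ fun j _ =>
        hmeas _ _ _]
    simp only [this]
    rw [PMF.mean_add, PMF.mean_sum, mean_lintegral_tag_eq, distance]
    simp only [hideal]
    rfl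
  have hmeas' : ∀ a, Measurable fun O : RO n => D.run (Function.update O k a)
      (V (Function.update O k a)) [true] := fun a =>
    (measurable_run ((dependsUpTo_runOf 𝒢 x γ q).comp fun e => e.view x .R) D [true]).comp
      (measurable_update_left)
  rw [hreal, hideal, ← hdist, ← PMF.mean_add, ← PMF.mean_add]
  refine ⟨PMF.mean_mono _ fun a => ?_, PMF.mean_mono _ fun a => ?_⟩
  · rw [← lintegral_add_left (hmeas _ _ _)]
    exact lintegral_mono fun O => (hone a O).1
  · rw [← lintegral_add_left (hmeas' a)]
    exact lintegral_mono fun O => (hone a O).2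

/-- The group has at least `2 ^ (lam - 1)` elements. -/
theorem inv_p_le (γ : 𝒢.Idx lam) :
    ((𝒢.grp lam γ.1).p : ℝ≥0∞)⁻¹ ≤ 2 * (2 ^ lam : ℝ≥0∞)⁻¹ := by
  have h := 𝒢.order_digits lam γ.1 γ.2
  have h2 : 2 ≤ ordLen lam := le_max_left _ _
  have h3 : 2 ^ (ordLen lam - 1) ≤ (𝒢.grp lam γ.1).p := Nat.lt_size.1 (by rw [h]; omega)
  have h4 : 2 ^ lam ≤ 2 ^ (ordLen lam - 1) * 2 := by
    rw [← pow_succ]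
    exact Nat.pow_le_pow_right two_pos (by have : lam ≤ ordLen lam := le_max_right _ _; omega)
  have h5 : (2 ^ lam : ℝ≥0∞) ≤ (𝒢.grp lam γ.1).p * 2 := by
    exact_mod_cast h4.trans (Nat.mul_le_mul_right 2 h3)
  rw [← div_eq_mul_inv, ENNReal.le_div_iff_mul_le (by simp) (by simp), mul_comm,
    ← div_eq_mul_inv]
  exact ENNReal.div_le_of_le_mul (by rwa [mul_comm])

/-- A degenerate choice satisfies one of three equations, each of probability at most `1 / p`. -/
theorem eq_of_degenerate {γ : 𝒢.Idx lam} {q : AllChoices (𝒢.grp lam γ.1).p lam}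
    (h : Degenerate 𝒢 γ q) {x : ZMod (𝒢.grp lam γ.1).p}
    (hx : x = secretExp q.2.2.1.1 q.2.2.1.2.1 q.2.2.2.1) :
    q.2.1 = 0 ∨ q.1 = x * q.2.2.1.2.2 / q.2.1 + x ∨ q.1 = x + x := by
  obtain ⟨c, z, ρ⟩ := q
  simp only at hx ⊢
  refine or_iff_not_imp_left.2 fun hz => ?_
  have hinj : ∀ {a b}, (𝒢.grp lam γ.1).str ((𝒢.grp lam γ.1).pow (𝒢.grp lam γ.1).g a) =
      (𝒢.grp lam γ.1).str ((𝒢.grp lam γ.1).pow (𝒢.grp lam γ.1).g b) → a = b := fun hab =>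
    (𝒢.grp lam γ.1).pow_g_bijective.1 ((𝒢.grp lam γ.1).enc_injective (List.ofFn_injective hab))
  have hh : hiddenQueryOf 𝒢 γ (c, z, ρ) = (𝒢.grp lam γ.1).str
      ((𝒢.grp lam γ.1).pow (𝒢.grp lam γ.1).g ((c - x) * z)) := by
    rw [GroupInst.pow_mul, GroupInst.pow_sub, hx]
    rfl
  rcases h with h | h
  · left
    rw [hh, openQuery, openKey, ← GroupInst.pow_mul, ← hx] at h
    rw [← sub_eq_iff_eq_add, eq_div_iff hz]
    exact (hinj h).symm
  · right
    have hw : wrongQueryOf 𝒢 γ (c, z, ρ) = (𝒢.grp lam γ.1).str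
        ((𝒢.grp lam γ.1).pow (𝒢.grp lam γ.1).g (x * z)) := by
      rw [GroupInst.pow_mul, hx]
      rfl
    rw [hh, hw] at h
    rw [← sub_eq_iff_eq_add]
    exact (mul_right_cancel₀ hz (hinj h)).symm

open Classical in
theorem mean_degenerate_le (γ : 𝒢.Idx lam) :
    ((PMF.uniformOfFintype (AllChoices (𝒢.grp lam γ.1).p lam)).mean fun q =>
      if Degenerate 𝒢 γ q then 1 else 0) ≤ 6 * (2 ^ lam : ℝ≥0∞)⁻¹ := by
  let Z := ZMod (𝒢.grp lam γ.1).p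
  let u : Choices (𝒢.grp lam γ.1).p lam → Z := fun ρ => secretExp ρ.1.1 ρ.1.2.1 ρ.2.1
  have hle : ∀ q : AllChoices (𝒢.grp lam γ.1).p lam, (if Degenerate 𝒢 γ q then (1 : ℝ≥0∞) else 0) ≤
      (if q.2.1 = 0 then 1 else 0) + ((if q.1 = u q.2.2 * q.2.2.1.2.2 / q.2.1 + u q.2.2 then 1
        else 0) + if q.1 = u q.2.2 + u q.2.2 then 1 else 0) := by
    intro q
    by_cases h : Degenerate 𝒢 γ q
    · rcases eq_of_degenerate h (x := u q.2.2) rfl with h' | h' | h'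
      · rw [if_pos h, if_pos h']
        exact le_self_add
      · rw [if_pos h, if_pos h']
        exact le_add_left le_self_add
      · rw [if_pos h, if_pos h']
        exact le_add_left (le_add_left le_rfl)
    · simp [h]
  have hc : ∀ f : Z × Choices (𝒢.grp lam γ.1).p lam → Z,
      ((PMF.uniformOfFintype (AllChoices (𝒢.grp lam γ.1).p lam)).mean fun q =>
        if q.1 = f q.2 then 1 else 0) = ((𝒢.grp lam γ.1).p : ℝ≥0∞)⁻¹ := fun f => by
    rw [PMF.mean_uniformOfFintype_prod, PMF.mean_comm]
    simp only [PMF.mean_uniformOfFintype_eq, PMF.mean_const, ZMod.card]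
  have hz : ((PMF.uniformOfFintype (AllChoices (𝒢.grp lam γ.1).p lam)).mean fun q =>
      if q.2.1 = 0 then 1 else 0) = ((𝒢.grp lam γ.1).p : ℝ≥0∞)⁻¹ := by
    rw [PMF.mean_uniformOfFintype_prod]
    change ((PMF.uniformOfFintype Z).mean fun _ => (PMF.uniformOfFintype
      (Z × Choices (𝒢.grp lam γ.1).p lam)).mean fun w => if w.1 = 0 then 1 else 0) = _
    rw [PMF.mean_const, PMF.mean_uniformOfFintype_prod]
    change ((PMF.uniformOfFintype Z).mean fun z => (PMF.uniformOfFintype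
      (Choices (𝒢.grp lam γ.1).p lam)).mean fun _ => if z = 0 then 1 else 0) = _
    simp only [PMF.mean_const, PMF.mean_uniformOfFintype_eq, Z, ZMod.card]
  refine (PMF.mean_mono _ hle).trans ?_
  rw [PMF.mean_add, PMF.mean_add, hz, hc fun w => u w.2 * w.2.1.2.2 / w.1 + u w.2,
    hc fun w => u w.2 + u w.2]
  calc _ ≤ 2 * (2 ^ lam : ℝ≥0∞)⁻¹ + (2 * (2 ^ lam : ℝ≥0∞)⁻¹ + 2 * (2 ^ lam : ℝ≥0∞)⁻¹) :=
        add_le_add (inv_p_le γ) (add_le_add (inv_p_le γ) (inv_p_le γ))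
    _ = _ := by ring

end DUQOT

/-! ### Computing the ideal view -/

namespace PMF

theorem map_decide_eq {α : Type*} [DecidableEq α] (p : PMF α) (a : α) :
    (p.map fun o => decide (o = a)) true = p a := by
  rw [map_apply, tsum_eq_single a]
  · simp
  · intro b hb
    simp [hb]

theorem le_bind_apply {α β : Type*} (p : PMF α) (f : α → PMF β) {a : α} {b : β}
    (h : f a = pure b) : p a ≤ (p.bind f) b := by
  rw [bind_apply]
  refine le_trans ?_ (ENNReal.le_tsum a)
  simp [h]

end PMF

namespace DUQOT

/-- Exponentiation with the secret exponent needs no arithmetic of exponents. -/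
theorem pow_secretExp {ℓ : ℕ} (I : GroupInst ℓ) (X : I.Carrier) (r₁ r₂ : ZMod I.p) (s₂ : Bool) :
    I.pow X (secretExp r₁ r₂ s₂) =
      I.pow X r₂ * if s₂ then (I.pow X r₁)⁻¹ else I.pow X r₁ := by
  cases s₂ <;> simp [secretExp, I.pow_add, I.pow_neg]

section

variable {𝒢 : GroupScheme} {σ n : ℕ → ℕ} {ι : ℕ → Type} {γ : ∀ lam, ι lam → 𝒢.Idx lam}

open Fld in
/-- The string that represents the choices behind the view of the receiver. -/
def choicesFld (ρ : ∀ lam (i : ι lam), Choices (𝒢.grp lam (γ lam i).1).p lam) : Fld n ι :=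
  (((exp (γ := γ) fun lam i => (ρ lam i).1.1).append ((exp (γ := γ) fun lam i =>
    (ρ lam i).1.2.1).append (exp (γ := γ) fun lam i => (ρ lam i).1.2.2))).append
    ((bit fun lam i => (ρ lam i).2.1).append ((bit fun lam i => (ρ lam i).2.2.1).append
      (bits .id fun lam _ i => (ρ lam i).2.2.2))))

theorem Impl.choices {src : Fld n ι} (hs : Det src (Fld.setup γ)) :
    Impl src fun lam _ i =>
      (PMF.uniformOfFintype (Choices (𝒢.grp lam (γ lam i).1).p lam)).map fun ρ =>
        ((𝒢.grp lam (γ lam i).1).expStr lam ρ.1.1 ++ ((𝒢.grp lam (γ lam i).1).expStr lam ρ.1.2.1 ++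
          (𝒢.grp lam (γ lam i).1).expStr lam ρ.1.2.2)) ++
            ([ρ.2.1] ++ ([ρ.2.2.1] ++ List.ofFn ρ.2.2.2)) := by
  simp only [← PMF.indep_uniformOfFintype]
  exact ((Impl.exponent hs).indep ((Impl.exponent hs).indep (Impl.exponent hs))).indep
    (Impl.coin.indep (Impl.coin.indep (Impl.coins .id)))

variable {src : Fld n ι} {C Z X : ∀ lam (i : ι lam), 𝒢.At (γ lam i)}
  {ρ : ∀ lam (i : ι lam), Choices (𝒢.grp lam (γ lam i).1).p lam}

theorem Det.pow_secretExp (hs : Det src (Fld.setup γ)) (hX : Det src (Fld.elem X))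
    (hρ : Det src (choicesFld ρ)) :
    Det src (Fld.elem fun lam i => (𝒢.grp lam (γ lam i).1).pow (X lam i)
      (secretExp (ρ lam i).1.1 (ρ lam i).1.2.1 (ρ lam i).2.1)) := by
  simp only [DUQOT.pow_secretExp]
  have h1 := hs.pow hX (hρ.trans (Det.fst.trans Det.fst))
  exact hs.mul (hs.pow hX (hρ.trans (Det.fst.trans (Det.snd.trans Det.fst))))
    (Det.elem_ite (hρ.trans (Det.snd.trans Det.fst)) (hs.inv h1) h1)

open Fld in
/-- The view of the receiver, for an oracle with values of `σ lam + lam` bits. -/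
noncomputable def viewFld {ι : ℕ → Type} {γ : ∀ lam, ι lam → 𝒢.Idx lam} (hσ : PolyBounded σ)
    (C Z : ∀ lam (i : ι lam), 𝒢.At (γ lam i))
    (ρ : ∀ lam (i : ι lam), Choices (𝒢.grp lam (γ lam i).1).p lam)
    (m : ∀ lam, ι lam → Bits (σ lam)) (a : ∀ lam, ι lam → Bits (σ lam + lam)) :
    Fld (fun lam => σ lam + lam) ι where
  val lam O i := receiverView 𝒢 lam (γ lam i).1 (C lam i) (Z lam i) (ρ lam i)
    (openCipher (𝒢.grp lam (γ lam i).1) O (m lam i) (ρ lam i)) (a lam i) (List.ofFn (m lam i))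
  len lam := ordLen lam + ordLen lam + (𝒢.descLen lam + ordLen lam + 𝒢.elemLen lam +
    𝒢.elemLen lam) + (1 + lam) + 𝒢.elemLen lam + (σ lam + lam) + 𝒢.elemLen lam + (σ lam + lam) +
    σ lam
  length_val lam O i := by
    simp only [receiverView, pk, List.length_append, GroupScheme.length_setup, GroupInst.str,
      GroupInst.expStr, natBits, List.length_map, List.length_range, List.length_ofFn,
      List.length_cons]
    ring
  poly := ((((((((PolyBounded.ordLen.add .ordLen).add (𝒢.polyBounded_gen.mono fun _ =>
    Nat.le_add_left _ _)).add 𝒢.polyBounded_elemLen).add ((PolyBounded.const 1).add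
    .id)).add 𝒢.polyBounded_elemLen).add (hσ.add .id)).add 𝒢.polyBounded_elemLen).add
    (hσ.add .id)).add hσ |>.mono fun lam => by simp only [id]; omega

/-- The ideal view can be computed by one query of the oracle. -/
theorem Det.receiverView (hσ : PolyBounded σ) {ι : ℕ → Type} {γ : ∀ lam, ι lam → 𝒢.Idx lam}
    {src : Fld (fun lam => σ lam + lam) ι} {C Z : ∀ lam (i : ι lam), 𝒢.At (γ lam i)}
    {ρ : ∀ lam (i : ι lam), Choices (𝒢.grp lam (γ lam i).1).p lam}
    {m : ∀ lam, ι lam → Bits (σ lam)} {a : ∀ lam, ι lam → Bits (σ lam + lam)}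
    (hs : Det src (Fld.setup γ)) (hC : Det src (Fld.elem C)) (hZ : Det src (Fld.elem Z))
    (hρ : Det src (choicesFld ρ)) (hm : Det src (Fld.bits hσ fun lam _ => m lam))
    (ha : Det src (Fld.bits (hσ.add .id) fun lam _ => a lam)) :
    Det src (viewFld hσ C Z ρ m a) := by
  have hr₁ := hρ.trans (Det.fst.trans Det.fst)
  have hr₂ := hρ.trans (Det.fst.trans (Det.snd.trans Det.fst))
  have hy := hρ.trans (Det.fst.trans (Det.snd.trans Det.snd))
  have hs₂ := hρ.trans (Det.snd.trans Det.fst)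
  have ht := hρ.trans (Det.snd.trans (Det.snd.trans Det.fst))
  have hr₃ := hρ.trans (Det.snd.trans (Det.snd.trans Det.snd))
  have hY := hs.pow hs.generator hy
  have hk := Det.answer (hσ.add .id) (hs.pow (Det.pow_secretExp hs hs.generator hρ) hy)
  have hmr : Det src (Fld.bits (hσ.add .id) fun lam _ i =>
      Fin.append (m lam i) (ρ lam i).2.2.2) := (hm.append hr₃).congr fun lam O i => by
    simp [Fld.bits, Fld.append, List.ofFn_fin_append]
  have hu : Det src (Fld.bits (hσ.add .id) fun lam O i =>
      openCipher (𝒢.grp lam (γ lam i).1) O (m lam i) (ρ lam i)) := Det.xor hk hmr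
  let Y : ∀ lam (i : ι lam), 𝒢.At (γ lam i) := fun lam i =>
    (𝒢.grp lam (γ lam i).1).pow (𝒢.grp lam (γ lam i).1).g (ρ lam i).1.2.2
  -- The entry of the permuted pair in position `j`.
  have hpair : ∀ j : Bool, Det src (Fld.elem fun lam i =>
        (pairAt (ρ lam i).2.2.1 (Y lam i) (Z lam i) () () j).1) ∧
      Det src (Fld.bits (hσ.add .id) fun lam O i => (pairAt (ρ lam i).2.2.1 () ()
        (openCipher (𝒢.grp lam (γ lam i).1) O (m lam i) (ρ lam i)) (a lam i) j).2) := by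
    intro j
    cases j
    · refine ⟨Det.ite ht hZ hY (fun _ => rfl) (fun _ => rfl) fun lam O i => ?_,
        Det.ite ht ha hu (fun _ => rfl) (fun _ => rfl) fun lam O i => ?_⟩ <;>
      cases h : (ρ lam i).2.2.1 <;> simp [pairAt, h, Fld.elem, Fld.bits, Y]
    · refine ⟨Det.ite ht hY hZ (fun _ => rfl) (fun _ => rfl) fun lam O i => ?_,
        Det.ite ht hu ha (fun _ => rfl) (fun _ => rfl) fun lam O i => ?_⟩ <;>
      cases h : (ρ lam i).2.2.1 <;> simp [pairAt, h, Fld.elem, Fld.bits, Y]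
  refine (((((((((hr₁.append hr₂).append (hs.append hC)).append (hs₂.append hr₃)).append
    (hpair false).1).append (hpair false).2).append (hpair true).1).append
      (hpair true).2).append hm)).congr fun lam O i => ?_
  cases h : (ρ lam i).2.2.1 <;>
    simp [viewFld, Fld.append, DUQOT.receiverView, h, pairAt, Fld.elem, Fld.bits, Y, Fld.exp,
      Fld.bit, Fld.digits, Fld.setup, pk, GroupInst.expStr]

end

end DUQOT

namespace PMF

theorem measurable_mean {n : ℕ} {α : Type*} [Countable α] (p : PMF α) {f : α → RO n → ℝ≥0∞}
    (hf : ∀ a, Measurable (f a)) : Measurable fun O => p.mean fun a => f a O :=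
  Measurable.tsum fun a => (hf a).const_mul _

end PMF

namespace DUQOT

variable {𝒢 : GroupScheme} {σ : ℕ → ℕ} {π : ℕ → PMF (Equiv.Perm Bool)}

/-! ### The hidden query and Diffie-Hellman -/

variable (𝒢) in
/-- The expectation over the choice of the group and all other choices. -/
noncomputable def expect (lam : ℕ)
    (f : (γ : 𝒢.Idx lam) → AllChoices (𝒢.grp lam γ.1).p lam → ℝ≥0∞) : ℝ≥0∞ :=
  (𝒢.rand lam).onSupport.mean fun γ => (PMF.uniformOfFintype _).mean (f γ)

theorem expect_mono {lam : ℕ} {f g : (γ : 𝒢.Idx lam) → AllChoices (𝒢.grp lam γ.1).p lam → ℝ≥0∞}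
    (h : ∀ γ q, f γ q ≤ g γ q) : expect 𝒢 lam f ≤ expect 𝒢 lam g :=
  PMF.mean_mono _ fun γ => PMF.mean_mono _ (h γ)

theorem expect_add {lam : ℕ} (f g : (γ : 𝒢.Idx lam) → AllChoices (𝒢.grp lam γ.1).p lam → ℝ≥0∞) :
    (expect 𝒢 lam fun γ q => f γ q + g γ q) = expect 𝒢 lam f + expect 𝒢 lam g := by
  simp only [expect, PMF.mean_add]

theorem expect_const (lam : ℕ) (c : ℝ≥0∞) : (expect 𝒢 lam fun _ _ => c) = c := by
  simp only [expect, PMF.mean_const]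

variable (𝒢) in
/-- The probability that `A`, given an ideal view, outputs the hidden query. -/
noncomputable def hitExp (lam : ℕ) (A : Prog) (m : Bits (σ lam)) : ℝ≥0∞ :=
  expect 𝒢 lam fun γ q => idealProb 𝒢 A m γ q (hiddenQueryOf 𝒢 γ q)

theorem hiddenQueryOf_eq {lam : ℕ} (γ : 𝒢.Idx lam) (q : AllChoices (𝒢.grp lam γ.1).p lam) :
    hiddenQueryOf 𝒢 γ q = (𝒢.grp lam γ.1).str ((𝒢.grp lam γ.1).pow (𝒢.grp lam γ.1).g
      ((q.1 - secretExp q.2.2.1.1 q.2.2.1.2.1 q.2.2.2.1) * q.2.1)) := by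
  rw [GroupInst.pow_mul, GroupInst.pow_sub]
  rfl

/-- The index of the reduction: the group, and the exponents `c` and `z` of the two given
elements. -/
abbrev CDHIdx (𝒢 : GroupScheme) (lam : ℕ) : Type :=
  Σ γ : 𝒢.Idx lam, ZMod (𝒢.grp lam γ.1).p × ZMod (𝒢.grp lam γ.1).p

section

variable (𝒢 σ)

/-- The index of the reduction, with the choices that complete an ideal view. -/
abbrev ReductionIdx (lam : ℕ) : Type :=
  Σ i : CDHIdx 𝒢 lam, Choices (𝒢.grp lam i.1.1).p lam × Bits (σ lam + lam)

open Fld in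
/-- An instance of the Diffie-Hellman problem. -/
def cdhFld : Fld (fun lam => σ lam + lam) (CDHIdx 𝒢) :=
  ((setup fun _ i => i.1).append (elem (γ := fun _ i => i.1) fun lam i =>
    (𝒢.grp lam i.1.1).pow (𝒢.grp lam i.1.1).g i.2.1)).append (elem (γ := fun _ i => i.1)
      fun lam i => (𝒢.grp lam i.1.1).pow (𝒢.grp lam i.1.1).g i.2.2)

end

open Fld in
theorem Impl.reduction (hσ : PolyBounded σ) {A M : ℕ → Prog} (hA : PolySize A) (hM : PolySize M)
    (m : ∀ lam, Bits (σ lam)) : Impl (cdhFld 𝒢 σ) fun lam O i =>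
      ((PMF.uniformOfFintype (Choices (𝒢.grp lam i.1.1).p lam)).indep
        (PMF.uniformOfFintype (Bits (σ lam + lam)))).bind fun q =>
        ((A lam).run O (idealView 𝒢 O i.1 (i.2.1, i.2.2, q.1) (m lam) q.2)).bind fun k =>
          (M lam).run O (𝒢.setup lam i.1.1 ++ k ++ (𝒢.grp lam i.1.1).str
            ((𝒢.grp lam i.1.1).pow ((𝒢.grp lam i.1.1).pow (𝒢.grp lam i.1.1).g i.2.2)
              (secretExp q.1.1.1 q.1.1.2.1 q.1.2.1))) := by
  let γ : ∀ lam, ReductionIdx 𝒢 σ lam → 𝒢.Idx lam := fun _ j => j.1.1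
  let C : ∀ lam (j : ReductionIdx 𝒢 σ lam), 𝒢.At (γ lam j) := fun lam j =>
    (𝒢.grp lam j.1.1.1).pow (𝒢.grp lam j.1.1.1).g j.1.2.1
  let Z : ∀ lam (j : ReductionIdx 𝒢 σ lam), 𝒢.At (γ lam j) := fun lam j =>
    (𝒢.grp lam j.1.1.1).pow (𝒢.grp lam j.1.1.1).g j.1.2.2
  let ρ : ∀ lam (j : ReductionIdx 𝒢 σ lam), Choices (𝒢.grp lam (γ lam j).1).p lam :=
    fun _ j => j.2.1
  let E : Fld (fun lam => σ lam + lam) (ReductionIdx 𝒢 σ) :=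
    (choicesFld (γ := γ) ρ).append (bits (hσ.add .id) fun _ _ j => j.2.2)
  have hsetup : Det (cdhFld 𝒢 σ) (setup fun _ i => i.1) := Det.trans Det.fst Det.fst
  have hE : Impl (cdhFld 𝒢 σ) fun lam O i =>
      ((PMF.uniformOfFintype (Choices (𝒢.grp lam i.1.1).p lam)).indep
        (PMF.uniformOfFintype (Bits (σ lam + lam)))).map fun q => E.val lam O ⟨i, q⟩ :=
    (Impl.choices hsetup).indep (Impl.coins (k := fun lam => σ lam + lam) (hσ.add .id))
  refine Impl.bind_keep E (K' := fun lam O j => ((A lam).run O (idealView 𝒢 O j.1.1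
    (j.1.2.1, j.1.2.2, j.2.1) (m lam) j.2.2)).bind fun k => (M lam).run O
      (𝒢.setup lam j.1.1.1 ++ k ++ (𝒢.grp lam j.1.1.1).str ((𝒢.grp lam j.1.1.1).pow (Z lam j)
        (secretExp j.2.1.1.1 j.2.1.1.2.1 j.2.1.2.1)))) hE ?_
  have h0 : Det (((cdhFld 𝒢 σ).comap fun _ (j : ReductionIdx 𝒢 σ _) => j.1).append E)
    ((cdhFld 𝒢 σ).comap fun _ j => j.1) := Det.fst
  have h1 : Det (((cdhFld 𝒢 σ).comap fun _ (j : ReductionIdx 𝒢 σ _) => j.1).append E) E := Det.snd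
  generalize ((cdhFld 𝒢 σ).comap fun _ (j : ReductionIdx 𝒢 σ _) => j.1).append E = src at h0 h1
  have hs : Det src (setup γ) := h0.trans (hsetup.comap _)
  have hC : Det src (elem C) := h0.trans ((Det.fst.trans Det.snd).comap _)
  have hZ : Det src (elem Z) := h0.trans (Det.snd.comap _)
  have hρ : Det src (choicesFld (γ := γ) ρ) := h1.trans Det.fst
  have ha : Det src (bits (hσ.add .id) fun _ _ j => j.2.2) := h1.trans Det.snd
  have hm : Det src (bits hσ fun lam _ _ => m lam) :=
    (Det.fixed (c := fun lam => List.ofFn (m lam)) (hc := hσ.mono fun lam => by simp)).congr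
      fun _ _ _ => rfl
  have hV := Det.receiverView hσ hs hC hZ hρ hm ha
  have hAV : Impl src fun lam O j => (A lam).run O (idealView 𝒢 O j.1.1
      (j.1.2.1, j.1.2.2, j.2.1) (m lam) j.2.2) := hV.impl ⟨A, hA, fun lam O j => rfl⟩
  have hZx := Det.pow_secretExp hs hZ hρ
  refine (((Impl.par hs hAV).par hZx).post hM).congr fun lam O j => ?_
  simp only [PMF.pure_bind, PMF.bind_map, PMF.bind_bind, PMF.pure_map, Function.comp_def]
  rfl

/-- A program that finds the hidden query gives a program that solves the Diffie-Hellman problem: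
the hidden query is `g ^ ((c - x) z)` for a known exponent `x`, so that multiplication by
`(g ^ z) ^ x` turns it into `g ^ (c z)`. -/
theorem exists_reduction (hσ : PolyBounded σ) {A : ℕ → Prog} (hA : PolySize A)
    (m : ∀ lam, Bits (σ lam)) : ∃ B : ℕ → Prog, PolySize B ∧
      ∀ lam (γ : 𝒢.Idx lam) (c z : ZMod (𝒢.grp lam γ.1).p) (O : RO (σ lam + lam)),
        ((PMF.uniformOfFintype (Choices (𝒢.grp lam γ.1).p lam)).mean fun ρ =>
          (PMF.uniformOfFintype (Bits (σ lam + lam))).mean fun a =>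
            (A lam).run O (idealView 𝒢 O γ (c, z, ρ) (m lam) a)
              (hiddenQueryOf 𝒢 γ (c, z, ρ))) ≤
        (B lam).run O (𝒢.setup lam γ.1 ++
          (𝒢.grp lam γ.1).str ((𝒢.grp lam γ.1).pow (𝒢.grp lam γ.1).g c) ++
          (𝒢.grp lam γ.1).str ((𝒢.grp lam γ.1).pow (𝒢.grp lam γ.1).g z))
          ((𝒢.grp lam γ.1).str ((𝒢.grp lam γ.1).pow (𝒢.grp lam γ.1).g (c * z))) := by
  obtain ⟨M, hM, hMq, hMr⟩ := 𝒢.mul_efficient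
  obtain ⟨B, hB, hBr⟩ := Impl.reduction (𝒢 := 𝒢) hσ hA hM m
  refine ⟨B, hB, fun lam γ c z O => ?_⟩
  have h := hBr lam O ⟨γ, c, z⟩
  simp only [cdhFld, Fld.append, Fld.setup, Fld.elem] at h
  rw [h, PMF.bind_apply_eq_mean, PMF.mean_indep]
  refine PMF.mean_mono _ fun ρ' => PMF.mean_mono _ fun a => ?_
  refine PMF.le_bind_apply _ _ ?_
  rw [(hMq lam).run_eq_runPlain, hiddenQueryOf_eq]
  refine (hMr lam γ.1 γ.2 _ _).trans ?_
  rw [← GroupInst.pow_mul, ← GroupInst.pow_add]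
  congr 3
  ring

theorem negligible_hitExp (hCDH : 𝒢.CDH) (hσ : PolyBounded σ) {A : ℕ → Prog} (hA : PolySize A)
    (m : ∀ lam, Bits (σ lam)) : Negligible fun lam => (hitExp 𝒢 lam (A lam) (m lam)).toReal := by
  classical
  obtain ⟨B, hB, hBr⟩ := exists_reduction (𝒢 := 𝒢) hσ hA m
  choose B' hq hsize hrun using fun lam => Prog.exists_lazy (σ lam + lam) (B lam)
  have hB' : PolySize B' := by
    have h1 := hB.add (.const 1)
    refine (((PolyBounded.const 3).mul ((hσ.add .id).add (.const 1))).mul (h1.mul h1)).mono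
      fun lam => (hsize lam).trans_eq ?_
    simp only [id]
    ring
  refine (hCDH B' hB' hq).mono (fun _ => ENNReal.toReal_nonneg) fun lam =>
    ENNReal.toReal_mono (PMF.apply_ne_top _ _) ?_
  rw [GroupScheme.cdhExp, ← PMF.onSupport_bind]
  simp only [PMF.bind_apply_eq_mean, PMF.map_decide_eq]
  refine PMF.mean_mono _ fun γ => ?_
  rw [PMF.mean_uniformOfFintype_prod]
  refine PMF.mean_mono _ fun c => ?_
  rw [PMF.mean_uniformOfFintype_prod]
  refine PMF.mean_mono _ fun z => ?_
  rw [Prog.runPlain, hrun]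
  refine le_trans (le_of_eq ?_) (lintegral_mono fun O => hBr lam γ c z O)
  have hmeas : ∀ (ρ : Choices (𝒢.grp lam γ.1).p lam) (a : Bits (σ lam + lam)),
      Measurable fun O => (A lam).run O (idealView 𝒢 O γ (c, z, ρ) (m lam) a)
        (hiddenQueryOf 𝒢 γ (c, z, ρ)) := fun ρ a =>
    measurable_run (dependsUpTo_idealView 𝒢 γ (c, z, ρ) (m lam) a) (A lam) _
  rw [PMF.lintegral_mean _ fun ρ => PMF.measurable_mean _ (hmeas ρ)]
  congr 1
  funext ρ
  rw [PMF.lintegral_mean _ (hmeas ρ)]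
  rfl

end DUQOT

namespace DUQOT

variable {𝒢 : GroupScheme} {σ : ℕ → ℕ} {π : ℕ → PMF (Equiv.Perm Bool)}

/-! ### Privacy against the receiver -/

theorem lintegral_expect {lam n : ℕ}
    {f : (γ : 𝒢.Idx lam) → AllChoices (𝒢.grp lam γ.1).p lam → RO n → ℝ≥0∞}
    (hf : ∀ γ q, Measurable (f γ q)) :
    ∫⁻ O, expect 𝒢 lam (fun γ q => f γ q O) ∂roMeasure n =
      expect 𝒢 lam fun γ q => ∫⁻ O, f γ q O ∂roMeasure n := by
  simp only [expect]
  rw [PMF.lintegral_mean _ fun γ => PMF.measurable_mean _ (hf γ)]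
  congr 1
  funext γ
  exact PMF.lintegral_mean _ (hf γ)

/-- The probability that `D` accepts the view of the receiver, over all choices. -/
theorem lintegral_view_eq (hπ : ∀ lam, SecurePermutation (π lam)) (lam : ℕ) (D : Prog)
    (x : Inputs (σ lam)) :
    ∫⁻ O, (((protocol 𝒢 σ π lam O x).map fun e => e.view x .R).bind (D.run O)) [true]
      ∂roMeasure (σ lam + lam) = expect 𝒢 lam fun γ q => realProb 𝒢 D x γ q := by
  simp only [protocol_map_eq_runOf 𝒢 lam hπ, PMF.bind_bind, PMF.pure_bind,
    PMF.bind_apply_eq_mean]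
  exact lintegral_expect fun γ q =>
    measurable_run ((dependsUpTo_runOf 𝒢 x γ q).comp fun e => e.view x .R) D [true]

variable (𝒢) in
/-- The law of the ideal view. -/
noncomputable def idealLaw (lam : ℕ) (O : RO (σ lam + lam)) (m : Bits (σ lam)) : PMF (List Bool) :=
  (𝒢.rand lam).onSupport.bind fun γ =>
    ((PMF.uniformOfFintype (AllChoices (𝒢.grp lam γ.1).p lam)).indep
      (PMF.uniformOfFintype (Bits (σ lam + lam)))).map fun q => idealView 𝒢 O γ q.1 m q.2

theorem lintegral_idealLaw_eq (lam : ℕ) (D : Prog) (m : Bits (σ lam)) :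
    ∫⁻ O, ((idealLaw 𝒢 lam O m).bind (D.run O)) [true] ∂roMeasure (σ lam + lam) =
      expect 𝒢 lam fun γ q => idealProb 𝒢 D m γ q [true] := by
  simp only [idealLaw, PMF.bind_bind, PMF.bind_map, PMF.bind_indep, PMF.bind_apply_eq_mean,
    Function.comp_apply]
  have hmeas : ∀ (γ : 𝒢.Idx lam) (q : AllChoices (𝒢.grp lam γ.1).p lam)
      (a : Bits (σ lam + lam)), Measurable fun O : RO (σ lam + lam) =>
        D.run O (idealView 𝒢 O γ q m a) [true] := fun γ q a =>
    measurable_run (dependsUpTo_idealView 𝒢 γ q m a) D [true]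
  refine (lintegral_expect fun γ q => PMF.measurable_mean _ (hmeas γ q)).trans ?_
  congr 1
  funext γ q
  exact PMF.lintegral_mean _ (hmeas γ q)

open Fld in
theorem Impl.idealLaw (hσ : PolyBounded σ) :
    Impl (partyFld (n := fun lam => σ lam + lam) hσ .R) fun lam O x =>
      DUQOT.idealLaw 𝒢 lam O (x.m x.s) := by
  let κ : ∀ lam, 𝒢.Idx lam → Type := fun lam γ =>
    AllChoices (𝒢.grp lam γ.1).p lam × Bits (σ lam + lam)
  let γ : ∀ lam, SimIdx 𝒢 (fun lam => Inputs (σ lam)) κ lam → 𝒢.Idx lam := fun _ y => y.1.2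
  let C : ∀ lam (y : SimIdx 𝒢 (fun lam => Inputs (σ lam)) κ lam), 𝒢.At (γ lam y) :=
    fun lam y => (𝒢.grp lam y.1.2.1).pow (𝒢.grp lam y.1.2.1).g y.2.1.1
  let Z : ∀ lam (y : SimIdx 𝒢 (fun lam => Inputs (σ lam)) κ lam), 𝒢.At (γ lam y) :=
    fun lam y => (𝒢.grp lam y.1.2.1).pow (𝒢.grp lam y.1.2.1).g y.2.1.2.1
  let ρ : ∀ lam (y : SimIdx 𝒢 (fun lam => Inputs (σ lam)) κ lam),
    Choices (𝒢.grp lam (γ lam y).1).p lam := fun _ y => y.2.1.2.2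
  let E : Fld (fun lam => σ lam + lam) (SimIdx 𝒢 (fun lam => Inputs (σ lam)) κ) :=
    ((exp (γ := γ) fun _ y => y.2.1.1).append ((exp (γ := γ) fun _ y => y.2.1.2.1).append
      (choicesFld (γ := γ) ρ))).append (bits (hσ.add .id) fun _ _ y => y.2.2)
  refine Impl.of_gen (κ := κ) (Q := fun lam γ => (PMF.uniformOfFintype _).indep
    (PMF.uniformOfFintype _)) E (viewFld hσ C Z ρ (fun _ y => y.1.1.m y.1.1.s) fun _ y => y.2.2)
    ?_ ?_
  · have h0 : Det (setup (n := fun lam => σ lam + lam) fun lam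
        (y : Σ _ : Inputs (σ lam), 𝒢.Idx lam) => y.2) (setup fun _ y => y.2) := Det.refl
    have h := ((Impl.exponent h0).indep ((Impl.exponent h0).indep (Impl.choices h0))).indep
      (Impl.coins (k := fun lam => σ lam + lam) (hσ.add .id))
    simp only [PMF.indep_uniformOfFintype] at h ⊢
    exact h
  · intro src' hx _ hs hE
    have hc : Det src' (exp (γ := γ) fun _ y => y.2.1.1) := hE.trans (Det.trans Det.fst Det.fst)
    have hz : Det src' (exp (γ := γ) fun _ y => y.2.1.2.1) :=
      hE.trans (Det.trans Det.fst (Det.trans Det.snd Det.fst))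
    have hρ : Det src' (choicesFld (γ := γ) ρ) :=
      hE.trans (Det.trans Det.fst (Det.trans Det.snd Det.snd))
    exact Det.receiverView hσ hs (hs.pow hs.generator hc) (hs.pow hs.generator hz) hρ
      (hx.congr fun _ _ _ => rfl) (hE.trans Det.snd)

theorem expect_le_one {lam : ℕ} {f : (γ : 𝒢.Idx lam) → AllChoices (𝒢.grp lam γ.1).p lam → ℝ≥0∞}
    (h : ∀ γ q, f γ q ≤ 1) : expect 𝒢 lam f ≤ 1 :=
  (expect_mono h).trans_eq (expect_const lam 1)

theorem idealProb_le_one {lam : ℕ} (A : Prog) (m : Bits (σ lam)) (γ : 𝒢.Idx lam)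
    (q : AllChoices (𝒢.grp lam γ.1).p lam) (o : List Bool) : idealProb 𝒢 A m γ q o ≤ 1 :=
  (PMF.mean_mono _ fun _ => lintegral_run_le_one _ A o).trans_eq (PMF.mean_const _ 1)

theorem hitExp_le_one (lam : ℕ) (A : Prog) (m : Bits (σ lam)) : hitExp 𝒢 lam A m ≤ 1 :=
  expect_le_one fun γ q => idealProb_le_one A m γ q _

open Classical in
/-- The difference of the real and the ideal view is the probability of finding the hidden query,
up to a negligible amount. -/
theorem expect_realProb_le (lam : ℕ) (D : Prog) (x : Inputs (σ lam)) :
    let ε := ∑ j ∈ Finset.range D.code.length, hitExp 𝒢 lam (D.probe j) (x.m x.s) +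
      7 * (2 ^ lam : ℝ≥0∞)⁻¹
    (expect 𝒢 lam fun γ q => realProb 𝒢 D x γ q) ≤
        (expect 𝒢 lam fun γ q => idealProb 𝒢 D (x.m x.s) γ q [true]) + ε ∧
      (expect 𝒢 lam fun γ q => idealProb 𝒢 D (x.m x.s) γ q [true]) ≤
        (expect 𝒢 lam fun γ q => realProb 𝒢 D x γ q) + ε := by
  intro ε
  have hε : (expect 𝒢 lam fun γ q => distance 𝒢 D (x.m x.s) γ q +
      if Degenerate 𝒢 γ q then 1 else 0) ≤ ε := by
    simp only [distance, expect_add, expect_const]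
    have h1 : (expect 𝒢 lam fun γ q => ∑ j ∈ Finset.range D.code.length,
        idealProb 𝒢 (D.probe j) (x.m x.s) γ q (hiddenQueryOf 𝒢 γ q)) =
        ∑ j ∈ Finset.range D.code.length, hitExp 𝒢 lam (D.probe j) (x.m x.s) := by
      simp only [expect, PMF.mean_sum, hitExp]
    have h2 : (expect 𝒢 lam fun γ q => if Degenerate 𝒢 γ q then 1 else 0) ≤
        6 * (2 ^ lam : ℝ≥0∞)⁻¹ :=
      (PMF.mean_mono _ fun γ => mean_degenerate_le γ).trans_eq (PMF.mean_const _ _)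
    rw [h1, add_assoc]
    refine add_le_add_right ((add_le_add_right h2 _).trans_eq ?_) _
    ring
  have h : ∀ (γ : 𝒢.Idx lam) (q : AllChoices (𝒢.grp lam γ.1).p lam),
      realProb 𝒢 D x γ q ≤ idealProb 𝒢 D (x.m x.s) γ q [true] +
        (distance 𝒢 D (x.m x.s) γ q + if Degenerate 𝒢 γ q then 1 else 0) ∧
      idealProb 𝒢 D (x.m x.s) γ q [true] ≤ realProb 𝒢 D x γ q +
        (distance 𝒢 D (x.m x.s) γ q + if Degenerate 𝒢 γ q then 1 else 0) := by
    intro γ q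
    split_ifs with hq
    · exact ⟨(lintegral_run_le_one _ D _).trans (le_add_left (le_add_left le_rfl)),
        (idealProb_le_one D _ γ q _).trans (le_add_left (le_add_left le_rfl))⟩
    · simpa only [add_zero] using realProb_idealProb_le D x hq
  constructor
  · refine (expect_mono fun γ q => (h γ q).1).trans ?_
    rw [expect_add]
    exact add_le_add_right hε _
  · refine (expect_mono fun γ q => (h γ q).2).trans ?_
    rw [expect_add]
    exact add_le_add_right hε _

/-- The simulator of the receiver outputs the ideal view. -/
theorem simulatable_R (hCDH : 𝒢.CDH) (hσ : PolyBounded σ)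
    (hπ : ∀ lam, SecurePermutation (π lam)) : (protocol 𝒢 σ π).Simulatable .R := by
  obtain ⟨Sim, hSim, hrun⟩ := Impl.idealLaw (𝒢 := 𝒢) hσ
  refine ⟨Sim, hSim, fun D hD => ?_⟩
  -- The probe and the message for which the hidden query is found most often.
  have hworst : ∀ lam, ∃ w : ℕ × Bits (σ lam), ∀ j < (D lam).code.length, ∀ m,
      hitExp (σ := σ) 𝒢 lam ((D lam).probe j) m ≤
        hitExp (σ := σ) 𝒢 lam ((D lam).probe w.1) w.2 := by
    intro lam
    obtain ⟨w, -, hw⟩ := Finset.exists_max_image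
      (Finset.range ((D lam).code.length + 1) ×ˢ (Finset.univ : Finset (Bits (σ lam))))
      (fun w => hitExp (σ := σ) 𝒢 lam ((D lam).probe w.1) w.2)
      ⟨(0, fun _ => false), by simp⟩
    exact ⟨w, fun j hj m => hw (j, m) (by simp; omega)⟩
  choose w hw using hworst
  have hA : PolySize fun lam => (D lam).probe (w lam).1 :=
    hD.mono fun lam => (D lam).size_probe_le _
  have hneg := negligible_hitExp hCDH hσ hA fun lam => (w lam).2
  have hlen : PolyBounded fun lam => (D lam).code.length :=
    hD.mono fun lam => (length_le_cost _).trans (Nat.le_add_right _ _)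
  refine ⟨_, (Negligible.polyBounded_mul hlen hneg fun _ => ENNReal.toReal_nonneg).add
    (Negligible.two_pow.const_mul 7), fun lam x => ?_⟩
  have hS : (fun O : RO (σ lam + lam) => (Sim lam).run O (x.ofParty .R ++ x.functionality .R)) =
      fun O => idealLaw 𝒢 lam O (x.m x.s) := funext fun O => hrun lam O x
  change |acceptProb (D lam) (fun O : RO (σ lam + lam) => (Sim lam).run O (x.ofParty .R ++
    x.functionality .R)) - acceptProb (D lam) fun O : RO (σ lam + lam) =>
      (protocol 𝒢 σ π lam O x).map fun e => e.view x .R| ≤ _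
  rw [hS, acceptProb, acceptProb, lintegral_view_eq hπ, lintegral_idealLaw_eq]
  obtain ⟨h1, h2⟩ := expect_realProb_le (𝒢 := 𝒢) lam (D lam) x
  set R := expect 𝒢 lam fun γ q => realProb 𝒢 (D lam) x γ q with hR
  set T := expect 𝒢 lam fun γ q => idealProb 𝒢 (D lam) (x.m x.s) γ q [true] with hT
  have hR1 : R ≠ ∞ := ne_top_of_le_ne_top ENNReal.one_ne_top
    (expect_le_one fun γ q => lintegral_run_le_one _ (D lam) _)
  have hT1 : T ≠ ∞ := ne_top_of_le_ne_top ENNReal.one_ne_top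
    (expect_le_one fun γ q => idealProb_le_one (D lam) _ γ q _)
  set H := hitExp 𝒢 lam ((D lam).probe (w lam).1) (w lam).2 with hH
  have hH1 : H ≠ ∞ := ne_top_of_le_ne_top ENNReal.one_ne_top (hitExp_le_one _ _ _)
  have hε : ∑ j ∈ Finset.range (D lam).code.length, hitExp 𝒢 lam ((D lam).probe j) (x.m x.s) +
      7 * (2 ^ lam : ℝ≥0∞)⁻¹ ≤ (D lam).code.length * H + 7 * (2 ^ lam : ℝ≥0∞)⁻¹ := by
    refine add_le_add_left ((Finset.sum_le_sum fun j hj =>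
      hw lam j (Finset.mem_range.1 hj) _).trans_eq ?_) _
    rw [Finset.sum_const, Finset.card_range, nsmul_eq_mul]
  have hfin : (D lam).code.length * H + 7 * (2 ^ lam : ℝ≥0∞)⁻¹ ≠ ∞ := by
    refine ENNReal.add_ne_top.2 ⟨ENNReal.mul_ne_top (by simp) hH1, ENNReal.mul_ne_top (by simp) ?_⟩
    simp
  have hreal : ((D lam).code.length * H + 7 * (2 ^ lam : ℝ≥0∞)⁻¹).toReal =
      (D lam).code.length * H.toReal + 7 * (2 ^ lam : ℝ)⁻¹ := by
    rw [ENNReal.toReal_add (ENNReal.mul_ne_top (by simp) hH1)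
      (ENNReal.mul_ne_top (by simp) (by simp))]
    simp
  have hsub : ∀ {a b : ℝ≥0∞}, b ≠ ∞ → a ≤ b + ((D lam).code.length * H +
      7 * (2 ^ lam : ℝ≥0∞)⁻¹) → a.toReal ≤ b.toReal + ((D lam).code.length * H.toReal +
      7 * (2 ^ lam : ℝ)⁻¹) := fun {a b} hb h => by
    rw [← hreal, ← ENNReal.toReal_add hb hfin]
    exact ENNReal.toReal_mono (ENNReal.add_ne_top.2 ⟨hb, hfin⟩) h
  rw [abs_le]
  have e1 := hsub hT1 (h1.trans (add_le_add_right hε _))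
  have e2 := hsub hR1 (h2.trans (add_le_add_right hε _))
  constructor <;> linarith

/-! ### Correctness -/

open Classical in
theorem correct (hπ : ∀ lam, SecurePermutation (π lam)) : (protocol 𝒢 σ π).Correct := by
  refine ⟨fun lam => 7 * (2 ^ lam : ℝ)⁻¹, Negligible.two_pow.const_mul 7, fun lam x => ?_⟩
  let Bad : Execution → Prop := fun e => ∃ P, e.output P ≠ some (x.functionality P)
  have h1 : ∀ O, (protocol 𝒢 σ π lam O x).toOuterMeasure {e | Bad e} =
      expect 𝒢 lam fun γ q => if Bad (runOf 𝒢 lam O x γ q) then 1 else 0 := by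
    intro O
    have h := protocol_map_eq_runOf 𝒢 lam hπ O x fun e => decide (Bad e)
    have h' := congrArg (fun p : PMF Bool => p true) h
    simp only [PMF.bind_apply_eq_mean] at h'
    have e1 : (protocol 𝒢 σ π lam O x).toOuterMeasure {e | Bad e} =
        ((protocol 𝒢 σ π lam O x).map fun e => decide (Bad e)) true := by
      rw [← PMF.toOuterMeasure_apply_singleton, PMF.toOuterMeasure_map_apply]
      congr 1
      ext e
      simp
    rw [e1, h']
    simp only [expect]
    congr 1
    funext γ
    congr 1
    funext q
    by_cases hb : Bad (runOf 𝒢 lam O x γ q) <;> simp [hb]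
  have hmeas : ∀ (γ : 𝒢.Idx lam) q, Measurable fun O : RO (σ lam + lam) =>
      if Bad (runOf 𝒢 lam O x γ q) then (1 : ℝ≥0∞) else 0 := fun γ q =>
    ((dependsUpTo_runOf 𝒢 x γ q).comp fun e => if Bad e then (1 : ℝ≥0∞) else 0).measurable
  have h2 : ∀ (γ : 𝒢.Idx lam) q, ∫⁻ O, (if Bad (runOf 𝒢 lam O x γ q) then (1 : ℝ≥0∞) else 0)
      ∂roMeasure (σ lam + lam) ≤ (2 ^ lam : ℝ≥0∞)⁻¹ + if Degenerate 𝒢 γ q then 1 else 0 := by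
    intro γ q
    split_ifs with hq
    · refine (lintegral_mono (g := fun _ => 1) fun O => ?_).trans ?_
      · dsimp only
        split_ifs <;> simp
      · simp
    · have hne : wrongQueryOf 𝒢 γ q ≠ hiddenQueryOf 𝒢 γ q := (not_or.1 hq).2
      rw [add_zero, ← lintegral_tag_eq (σ := σ lam) hne]
      refine lintegral_mono fun O => ?_
      by_cases ht : tag (O (wrongQueryOf 𝒢 γ q)) = tag (O (hiddenQueryOf 𝒢 γ q))
      · rw [if_pos ht]
        split_ifs <;> simp
      · rw [if_neg ht, if_neg]
        rintro ⟨P, hP⟩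
        exact hP (output_runOf 𝒢 ht P)
  have h3 : ∫⁻ O, (protocol 𝒢 σ π lam O x).toOuterMeasure {e | Bad e} ∂roMeasure (σ lam + lam) ≤
      7 * (2 ^ lam : ℝ≥0∞)⁻¹ := by
    simp only [h1]
    rw [lintegral_expect hmeas]
    refine (expect_mono h2).trans ?_
    rw [expect_add, expect_const]
    have : (expect 𝒢 lam fun γ q => if Degenerate 𝒢 γ q then 1 else 0) ≤
        6 * (2 ^ lam : ℝ≥0∞)⁻¹ :=
      (PMF.mean_mono _ fun γ => mean_degenerate_le γ).trans_eq (PMF.mean_const _ _)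
    refine (add_le_add_right this _).trans_eq ?_
    ring
  refine (ENNReal.toReal_mono (ENNReal.mul_ne_top (by simp) (by simp)) h3).trans_eq ?_
  simp

/-! ### Communication, and the work of the receiver -/

theorem senderPush : (protocol 𝒢 σ π).SenderPush := by
  intro lam O x e he v hv
  simp only [protocol, PMF.mem_support_bind_iff, PMF.mem_support_map_iff] at he
  obtain ⟨c, -, r, -, s₁, -, r₃, -, rfl⟩ := he
  simp only [execution, List.mem_append] at hv
  rcases hv with hv | hv
  · fin_cases hv <;> simp
  · split at hv
    · simp at hv
    · rw [List.mem_singleton] at hv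
      subst hv
      simp

theorem receiverEfficient : ReceiverEfficient 𝒢 := by
  -- The order of the group follows its description in the public key.
  refine ⟨2, fun lam => ⟨[.unif (ordLen lam) (𝒢.descLen lam) (𝒢.descLen lam + ordLen lam),
    .unif (ordLen lam) (𝒢.descLen lam) (𝒢.descLen lam + ordLen lam + ordLen lam)],
    𝒢.descLen lam + ordLen lam, ordLen lam + ordLen lam⟩,
    fun lam => le_rfl, fun lam i hi => ?_, fun lam ω hω C => ?_⟩
  · simp only [List.mem_cons, List.not_mem_nil, or_false] at hi
    rcases hi with rfl | rfl <;> exact not_false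
  have hp : (𝒢.grp lam ω).p < 2 ^ ordLen lam := GroupScheme.p_lt ⟨ω, hω⟩
  obtain ⟨m, hm⟩ : ∃ m, m = Mem.ofInput (pk 𝒢 lam ω C) := ⟨_, rfl⟩
  have hr : m.read (𝒢.descLen lam) (ordLen lam) = natBits (ordLen lam) (𝒢.grp lam ω).p := by
    refine List.map_congr_left fun j hj => ?_
    have hj := List.mem_range.1 hj
    simp only [hm, Mem.ofInput, pk, GroupScheme.setup, GroupInst.setup, List.append_assoc]
    rw [List.getD_append_right _ _ _ _ (by simp ), List.getD_append _ _ _ _ (by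
      simpa [natBits] using hj)]
    simp [natBits, hj]
  have hr' : ∀ r, (m.write (𝒢.descLen lam + ordLen lam) (natBits (ordLen lam) r)).read
      (𝒢.descLen lam) (ordLen lam) =
      natBits (ordLen lam) (𝒢.grp lam ω).p := fun r => by
    rw [Mem.read_write_of_le _ _ _ _ _ le_rfl, hr]
  rw [Prog.runPlain, Prog.run_eq, ← hm]
  simp only [execAll, Instr.exec_unif _ hp hr, PMF.bind_map, Function.comp_def,
    Instr.exec_unif _ hp (hr' _)]
  simp only [request, ← PMF.bind_pure_comp, PMF.bind_bind, PMF.pure_bind, Function.comp_def]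
  refine congrArg _ (funext fun r₁ => congrArg _ (funext fun r₂ => congrArg _ ?_))
  have hsplit : ∀ (m : Mem) (a b c : ℕ), m.read a (b + c) = m.read a b ++ m.read (a + b) c :=
    fun m a b c => by simp [Mem.read, List.range_add, Function.comp_def, add_assoc]
  have hrw : ∀ (m : Mem) (a r : ℕ), (m.write a (natBits (ordLen lam) r)).read a (ordLen lam) =
      natBits (ordLen lam) r := fun m a r => by
    have := m.read_write a (natBits (ordLen lam) r)
    rwa [show (natBits (ordLen lam) r).length = ordLen lam by simp [natBits]] at this
  rw [hsplit, Mem.read_write_of_le _ _ _ _ _ le_rfl, hrw, hrw]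
  rfl

end DUQOT

theorem theorem2 (𝒢 : GroupScheme) (hDL : 𝒢.DL) (hCDH : 𝒢.CDH)
    (σ : ℕ → ℕ) (hσ : PolyBounded σ)
    (π : ℕ → PMF (Equiv.Perm Bool)) (hπ : ∀ lam, SecurePermutation (π lam)) :
    (DUQOT.protocol 𝒢 σ π).SecurelyComputes ∧
      (DUQOT.protocol 𝒢 σ π).SenderPush ∧
      DUQOT.ReceiverEfficient 𝒢 :=
  ⟨⟨DUQOT.correct hπ, fun P => match P with
    | .S => DUQOT.simulatable_S hσ hπ
    | .R => DUQOT.simulatable_R hCDH hσ hπ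
    | .T => DUQOT.simulatable_T hσ
    | .P1 => DUQOT.simulatable_P1 hσ
    | .P2 => DUQOT.simulatable_P2 hσ⟩, DUQOT.senderPush, DUQOT.receiverEfficient⟩
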